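/- **Setting.** In random order online set cover there are $n\ge 1$ elements $U$ and $m\ge 1$ sets $\mathcal S$ (subsets of $U$) with costs $c_S>0$, and every element lies in at least one set. The algorithm knows $m$ and the costs, but knows neither $n$ nor the elements. The elements arrive in uniformly random order; when an element arrives it is revealed which sets contain it, and the algorithm must immediately and irrevocably buy sets so that the element is covered. Let $\mathrm{OPT}$ be the cost of a cheapest set cover and $\mathrm{LP}$ the optimal value of its linear relaxation $\min\{\sum_S c_Sx_S : x\ge 0,\ \sum_{S\ni v}x_S\ge 1\ \forall v\in U\}$. For an element $v$ put $\kappa_v=\min\{c_S: S\ni v\}$. The logarithm is natural. **Algorithm LearnOrCover with guess $\beta>0$.** Let $m'=|\{S:c_S\le\beta\}|$. Initially nothing is bought, and $x_S=\beta/(c_S m')$ if $c_S\le\beta$ and $x_S=0$ otherwise. When an element $v$ arrives that is not covered by the sets bought so far, and $x$ is the current vector: 1. for each set $S$ independently, buy $S$ with probability $\min(\kappa_v x_S/\beta,1)$; 2. if $\sum_{S\ni v}x_S<1$, multiply $x_S$ by $e^{\kappa_v/c_S}$ for every $S\ni v$, and then divide the resulting vector $x$ by $Z=\frac1\beta\sum_S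 c_Sx_S$; 3. buy a cheapest set containing $v$ (ties are broken by a fixed order of the sets). When a covered element arrives, nothing is done. "Polynomial time" is meant on a randomized real-arithmetic machine, on which each operation $+,-,\cdot,/,\exp$ on reals, each comparison, each memory access (with indirect addressing by natural-number registers, which allow addition and truncated subtraction), each membership query and each coin flip with computed bias takes one step: there is one program, not depending on the instance, that processes the arrivals online, buys sets with exactly the law of the algorithm, and with certainty takes at most $(m+n+2)^d$ steps in total, for an absolute constant $d$. **Theorem.** (a) LearnOrCover runs in polynomial time and, for every guess $\beta>0$ and every order of arrival, with certainty covers each element upon its arrival. There is an absolute constant $K$ such that for every instance with $mn\ge 2$ and every $\beta$ with $\mathrm{LP}\le\beta\le 2\,\mathrm{LP}$, the expected cost of the sets bought by LearnOrCover with guess $\beta$, over the random order and the algorithm's coins, is at most $K\,\beta\log(mn)$. (b) Without being given a guess, guess-and-double achieves competitive ratio $O(\log(mn))$: there is a rule that determines at each arrival a positive current guess from $m$, the costs and the arrivals so far, such that each change of the guess at least doubles it, and such that the following holds for the algorithm that runs LearnOrCover with the current guess, keeping all sets bought and reinitializing the vector $x$ whenever the guess changes. The algorithm (including the computation of the guesses)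 runs in polynomial time, it always covers each element upon its arrival, and for an absolute constant $K'$ its expected cost is at most $K'\log(mn)\cdot\mathrm{OPT}$ on every instance with $mn\ge 2$. -/

import Mathlib

/-! ### Set cover instances -/

/-- A weighted set system with elements `Fin n` and sets `Fin m`: positive costs, and every element
lies in some set. -/
structure SetCoverInstance (m n : ℕ) where
  sets : Fin m → Finset (Fin n)
  cost : Fin m → ℝ
  cost_pos : ∀ S, 0 < cost S
  covered : ∀ v, ∃ S, v ∈ sets S

namespace SetCoverInstance

variable {m n : ℕ} (I : SetCoverInstance m n)

/-- `x` is a feasible solution of the linear relaxation. -/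
def IsFractionalCover (x : Fin m → ℝ) : Prop :=
  (∀ S, 0 ≤ x S) ∧ ∀ v, 1 ≤ ∑ S with v ∈ I.sets S, x S

/-- The optimal value of the linear relaxation. -/
noncomputable def lpOpt : ℝ :=
  sInf {r | ∃ x, I.IsFractionalCover x ∧ r = ∑ S, I.cost S * x S}

/-- The cost of a cheapest (integral) set cover. -/
noncomputable def opt : ℝ :=
  sInf {r | ∃ C : Finset (Fin m), (∀ v, ∃ S ∈ C, v ∈ I.sets S) ∧ r = ∑ S ∈ C, I.cost S}

/-- What is revealed, arrival by arrival, when the elements arrive in the order `σ`: the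
collection of the sets that contain the arriving element. -/
def arrivals (σ : Equiv.Perm (Fin n)) : List (Finset (Fin m)) :=
  List.ofFn fun t => Finset.univ.filter fun S => σ t ∈ I.sets S

end SetCoverInstance

/-! ### Online algorithms -/

/-- The law of the collection bought by a randomized online algorithm. The algorithm knows the
number `m` of sets and their costs; the list contains, for every element that has arrived so far,
the collection of the sets containing it. The number of elements is not known in advance. -/
abbrev OnlineAlg : Type :=
  (m : ℕ) → (Fin m → ℝ) → List (Finset (Fin m)) → PMF (Finset (Fin m))

/-- With certainty, all elements that have arrived are covered. The list of arrivals is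
arbitrary, so this holds after every arrival. -/
def OnlineAlg.AlwaysCovers (A : OnlineAlg) : Prop :=
  ∀ (m : ℕ) (c : Fin m → ℝ) (rows : List (Finset (Fin m))),
    (∀ S, 0 < c S) → (∀ a ∈ rows, a.Nonempty) →
      ∀ C ∈ (A m c rows).support, ∀ a ∈ rows, ∃ S ∈ C, S ∈ a

/-- The law of the final collection when the elements arrive in uniformly random order. -/
noncomputable def OnlineAlg.randomOrderLaw (A : OnlineAlg) {m n : ℕ} (I : SetCoverInstance m n) :
    PMF (Finset (Fin m)) :=
  (PMF.uniformOfFintype (Equiv.Perm (Fin n))).bind fun σ => A m I.cost (I.arrivals σ)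

/-- The expected cost when the elements arrive in uniformly random order. -/
noncomputable def OnlineAlg.expectedCost (A : OnlineAlg) {m n : ℕ} (I : SetCoverInstance m n) : ℝ :=
  ∑ C, (A.randomOrderLaw I C).toReal * ∑ S ∈ C, I.cost S

/-- A coin that shows `true` with probability `p`, where `p` is first clamped to `[0, 1]`. -/
noncomputable def coin (p : ℝ) : PMF Bool :=
  PMF.ofFintype
    (fun b => if b then ENNReal.ofReal (max 0 (min p 1)) else ENNReal.ofReal (1 - max 0 (min p 1)))
    (by
      have h1 : max 0 (min p 1) ≤ (1 : ℝ) := max_le zero_le_one (min_le_right _ _)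
      have h0 : (0 : ℝ) ≤ max 0 (min p 1) := le_max_left _ _
      simp only [Fintype.sum_bool, if_true, Bool.false_eq_true, if_false]
      rw [← ENNReal.ofReal_add h0 (by linarith)]
      simp)

/-! ### LearnOrCover -/

namespace LearnOrCover

variable {m : ℕ}

/-- The cost of a cheapest set containing the element, `a` being the collection of the sets that
contain it. -/
noncomputable def kappa (c : Fin m → ℝ) (a : Finset (Fin m)) : ℝ :=
  sInf (c '' a)

/-- The collection consisting of the cheapest set containing the element (ties are broken in
favour of the smallest index). -/
noncomputable def cheapest (c : Fin m → ℝ) (a : Finset (Fin m)) : Finset (Fin m) :=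
  open Classical in a.filter fun S => ∀ T ∈ a, c S < c T ∨ (c S = c T ∧ S ≤ T)

/-- The initial fractional vector for the guess `β`. -/
noncomputable def initWeights (c : Fin m → ℝ) (β : ℝ) : Fin m → ℝ := fun S =>
  if c S ≤ β then β / (c S * ((Finset.univ.filter fun T => c T ≤ β).card : ℝ)) else 0

/-- The random collection to which each set `S` is added independently with probability `p S`. -/
noncomputable def sampleSets (p : Fin m → ℝ) : PMF (Finset (Fin m)) :=
  (List.finRange m).foldl
    (fun μ S => μ.bind fun R => (coin (p S)).map fun b => if b then insert S R else R) (PMF.pure ∅)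

/-- The multiplicative update for the sets in `a`, before normalization. -/
noncomputable def scaleUp (c : Fin m → ℝ) (x : Fin m → ℝ) (a : Finset (Fin m)) : Fin m → ℝ :=
  fun S => x S * Real.exp (if S ∈ a then kappa c a / c S else 0)

/-- The normalization `x / Z` with `Z = ⟨c, x⟩ / β`. -/
noncomputable def normalize (c : Fin m → ℝ) (β : ℝ) (x : Fin m → ℝ) : Fin m → ℝ :=
  fun S => x S / ((∑ T, c T * x T) / β)

/-- The new fractional vector after the arrival of an uncovered element. -/
noncomputable def updateWeights (c : Fin m → ℝ) (β : ℝ) (x : Fin m → ℝ) (a : Finset (Fin m)) :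
    Fin m → ℝ :=
  if ∑ S ∈ a, x S < 1 then normalize c β (scaleUp c x a) else x

/-- The state of the algorithm: the fractional vector and the collection bought so far. -/
structure State (m : ℕ) where
  x : Fin m → ℝ
  bought : Finset (Fin m)

/-- One round with guess `β`, for an arriving element that is contained in the sets in `a`. -/
noncomputable def step (c : Fin m → ℝ) (β : ℝ) (s : State m) (a : Finset (Fin m)) :
    PMF (State m) :=
  if ∃ S ∈ s.bought, S ∈ a then PMF.pure s
  else (sampleSets fun S => min (kappa c a * s.x S / β) 1).map fun R =>
    ⟨updateWeights c β s.x a, s.bought ∪ R ∪ cheapest c a⟩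

/-- The rounds for a list of arrivals, from a given state. -/
noncomputable def runFrom (c : Fin m → ℝ) (β : ℝ) :
    List (Finset (Fin m)) → State m → PMF (State m)
  | [], s => PMF.pure s
  | a :: rows, s => (step c β s a).bind (runFrom c β rows)

end LearnOrCover

/-- The algorithm LearnOrCover with guess `β`. -/
noncomputable def learnOrCover (β : ℝ) : OnlineAlg := fun _ c rows =>
  (LearnOrCover.runFrom c β rows ⟨LearnOrCover.initWeights c β, ∅⟩).map LearnOrCover.State.bought

/-! ### Guess-and-double -/

/-- A rule that chooses the current guess from the number of sets, their costs and the arrivals up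
to and including the current one. -/
abbrev GuessRule : Type := (m : ℕ) → (Fin m → ℝ) → List (Finset (Fin m)) → ℝ

/-- The guesses are positive, and whenever the guess changes it at least doubles. -/
def GuessRule.IsDoubling (g : GuessRule) : Prop :=
  ∀ (m : ℕ) (c : Fin m → ℝ) (h : List (Finset (Fin m))) (a : Finset (Fin m)),
    (∀ S, 0 < c S) → (∀ b ∈ h ++ [a], b.Nonempty) →
      0 < g m c (h ++ [a]) ∧
        (h ≠ [] → g m c (h ++ [a]) = g m c h ∨ 2 * g m c h ≤ g m c (h ++ [a]))

namespace LearnOrCover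

variable {m : ℕ}

/-- One round of LearnOrCover with guess-and-double, after the arrivals `h`: at the first arrival
and whenever the guess changes, LearnOrCover is restarted with the new guess. The sets bought
so far are kept. -/
noncomputable def doublingStep (g : GuessRule) (c : Fin m → ℝ) (h : List (Finset (Fin m)))
    (s : State m) (a : Finset (Fin m)) : PMF (State m) :=
  open Classical in
  step c (g m c (h ++ [a]))
    ⟨if h ≠ [] ∧ g m c (h ++ [a]) = g m c h then s.x else initWeights c (g m c (h ++ [a])),
      s.bought⟩ a

/-- The rounds for a list of arrivals, after the arrivals `h`, from a given state. -/
noncomputable def doublingRunFrom (g : GuessRule) (c : Fin m → ℝ) :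
    List (Finset (Fin m)) → List (Finset (Fin m)) → State m → PMF (State m)
  | _, [], s => PMF.pure s
  | h, a :: rows, s => (doublingStep g c h s a).bind (doublingRunFrom g c (h ++ [a]) rows)

end LearnOrCover

/-- LearnOrCover with guess-and-double, where the guesses are chosen by the rule `g`. -/
noncomputable def guessAndDouble (g : GuessRule) : OnlineAlg := fun _ c rows =>
  (LearnOrCover.doublingRunFrom g c [] rows ⟨fun _ => 0, ∅⟩).map LearnOrCover.State.bought

/-! ### A randomized real-arithmetic machine with a step count

Programs of a small imperative language. The memory consists of arrays of natural numbers and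
arrays of real numbers, indexed by natural numbers and initially zero. Each elementary operation
(reading or writing a memory cell, reading an input, addition and truncated subtraction of naturals,
`+`, `-`, `*`, `/`, `exp` of reals, comparison, a coin flip with computed bias, buying a set) takes
one step. There is no conversion from reals to naturals, and the constants are rational. -/

namespace Machine

inductive NatExpr : Type
  | lit (k : ℕ)
  | numSets
  | read (array : ℕ) (i : NatExpr)
  | plus (e f : NatExpr)
  | minus (e f : NatExpr)

inductive RealExpr : Type
  | lit (q : ℚ)
  | guess
  | cost (i : NatExpr)
  | read (array : ℕ) (i : NatExpr)
  | plus (e f : RealExpr)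
  | minus (e f : RealExpr)
  | times (e f : RealExpr)
  | quot (e f : RealExpr)
  | expo (e : RealExpr)

inductive Cond : Type
  | natLt (e f : NatExpr)
  | realLt (e f : RealExpr)
  | mem (i : NatExpr)
  | neg (b : Cond)
  | conj (b b' : Cond)

inductive Cmd : Type
  | skip
  | seq (P Q : Cmd)
  | setNat (array : ℕ) (i e : NatExpr)
  | setReal (array : ℕ) (i : NatExpr) (e : RealExpr)
  | ite (b : Cond) (P Q : Cmd)
  | loop (e : NatExpr) (P : Cmd)
  | flip (p : RealExpr) (P Q : Cmd)
  | buy (i : NatExpr)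

/-- The read-only input: the costs of the `m` sets, the guess, and the collection of the sets that
contain the element that has just arrived. -/
structure Env (m : ℕ) where
  cost : Fin m → ℝ
  guess : ℝ
  row : Finset (Fin m)

/-- The contents of the memory, the collection bought so far, and the number of steps so far. -/
structure State (m : ℕ) where
  nat : ℕ → ℕ → ℕ
  real : ℕ → ℕ → ℝ
  bought : Finset (Fin m)
  steps : ℕ

variable {m : ℕ}

def State.start (m : ℕ) : State m := ⟨fun _ _ => 0, fun _ _ => 0, ∅, 0⟩

def State.tick (s : State m) (k : ℕ) : State m := { s with steps := s.steps + k }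

def NatExpr.eval (s : State m) : NatExpr → ℕ
  | lit k => k
  | numSets => m
  | read a i => s.nat a (i.eval s)
  | plus e f => e.eval s + f.eval s
  | minus e f => e.eval s - f.eval s

/-- The number of steps needed to evaluate the expression. -/
def NatExpr.time : NatExpr → ℕ
  | lit _ => 1
  | numSets => 1
  | read _ i => i.time + 1
  | plus e f => e.time + f.time + 1
  | minus e f => e.time + f.time + 1

noncomputable def RealExpr.eval (E : Env m) (s : State m) : RealExpr → ℝ
  | lit q => (q : ℝ)
  | guess => E.guess
  | cost i => if h : i.eval s < m then E.cost ⟨i.eval s, h⟩ else 0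
  | read a i => s.real a (i.eval s)
  | plus e f => e.eval E s + f.eval E s
  | minus e f => e.eval E s - f.eval E s
  | times e f => e.eval E s * f.eval E s
  | quot e f => e.eval E s / f.eval E s
  | expo e => Real.exp (e.eval E s)

/-- The number of steps needed to evaluate the expression. -/
def RealExpr.time : RealExpr → ℕ
  | lit _ => 1
  | guess => 1
  | cost i => i.time + 1
  | read _ i => i.time + 1
  | plus e f => e.time + f.time + 1
  | minus e f => e.time + f.time + 1
  | times e f => e.time + f.time + 1
  | quot e f => e.time + f.time + 1
  | expo e => e.time + 1

def Cond.Holds (E : Env m) (s : State m) : Cond → Prop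
  | natLt e f => e.eval s < f.eval s
  | realLt e f => e.eval E s < f.eval E s
  | mem i => ∃ h : i.eval s < m, (⟨i.eval s, h⟩ : Fin m) ∈ E.row
  | neg b => ¬ b.Holds E s
  | conj b b' => b.Holds E s ∧ b'.Holds E s

/-- The number of steps needed to evaluate the condition. -/
def Cond.time : Cond → ℕ
  | natLt e f => e.time + f.time + 1
  | realLt e f => e.time + f.time + 1
  | mem i => i.time + 1
  | neg b => b.time + 1
  | conj b b' => b.time + b'.time + 1

def State.writeNat (s : State m) (array i k : ℕ) : State m :=
  { s with nat := Function.update s.nat array (Function.update (s.nat array) i k) }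

noncomputable def State.writeReal (s : State m) (array i : ℕ) (r : ℝ) : State m :=
  { s with real := Function.update s.real array (Function.update (s.real array) i r) }

def State.buy (s : State m) (i : ℕ) : State m :=
  if h : i < m then { s with bought := insert ⟨i, h⟩ s.bought } else s

open Classical in
/-- The law of the state after the execution of a command. The command `loop e P` evaluates `e` once
and then executes `P` that many times; `flip p P Q` executes `P` with probability `p`, and
`Q` otherwise. -/
noncomputable def Cmd.run (E : Env m) : Cmd → State m → PMF (State m)
  | skip, s => PMF.pure (s.tick 1)
  | seq P Q, s => (P.run E s).bind (Q.run E)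
  | setNat a i e, s =>
      PMF.pure ((s.writeNat a (i.eval s) (e.eval s)).tick (i.time + e.time + 1))
  | setReal a i e, s =>
      PMF.pure ((s.writeReal a (i.eval s) (e.eval E s)).tick (i.time + e.time + 1))
  | ite b P Q, s =>
      if b.Holds E s then P.run E (s.tick (b.time + 1)) else Q.run E (s.tick (b.time + 1))
  | loop e P, s =>
      (fun μ => μ.bind fun s' => P.run E (s'.tick 1))^[e.eval s] (PMF.pure (s.tick (e.time + 1)))
  | flip p P Q, s =>
      (coin (p.eval E s)).bind fun b =>
        if b then P.run E (s.tick (p.time + 1)) else Q.run E (s.tick (p.time + 1))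
  | buy i, s => PMF.pure ((s.buy (i.eval s)).tick (i.time + 1))

/-- An online program: a command executed once at the beginning and a command executed at each
arrival. -/
structure OnlineProgram where
  init : Cmd
  arrive : Cmd

/-- The law of the state of the machine after a list of arrivals. -/
noncomputable def OnlineProgram.run (P : OnlineProgram) (c : Fin m → ℝ) (β : ℝ)
    (rows : List (Finset (Fin m))) : PMF (State m) :=
  rows.foldl (fun μ a => μ.bind (P.arrive.run ⟨c, β, a⟩)) (P.init.run ⟨c, β, ∅⟩ (State.start m))

end Machine

/-- A family of online algorithms indexed by a guess `β` runs in polynomial time: a single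
online program, given the guess, buys collections with the law of the algorithm, and its total number
of steps is, with certainty, bounded by a polynomial in the number of sets and the number of
elements. -/
def IsPolyTime (A : ℝ → OnlineAlg) : Prop :=
  ∃ (P : Machine.OnlineProgram) (d : ℕ), ∀ (m : ℕ) (c : Fin m → ℝ) (β : ℝ)
    (rows : List (Finset (Fin m))), (∀ S, 0 < c S) → 0 < β → (∀ a ∈ rows, a.Nonempty) →
      (P.run c β rows).map Machine.State.bought = A β m c rows ∧
        ∀ s ∈ (P.run c β rows).support, s.steps ≤ (m + rows.length + 2) ^ d

/-! ### Expectations over finite types -/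

/-! An uncovered arrival `v` costs at most `2κ_v` in expectation: `κ_v` for its cheapest set, and at
most `κ_v` for the sample, because the vector `x` costs at most `β`. It remains to bound the
expected sum of the `κ_v`. Fix a fractional cover `y` of cost at most `β` that uses no set dearer
than `β`, let `ρ` be the sum of the `κ_u` over the uncovered rows still to come, and take the
potential `Φ = β + D(y‖x) + 2eβ log(1 + ρ/β)` with the cost-weighted divergence `D`.

Write `X_u` for the fractional coverage of `u`, and `W` for the sum of `κ_u min(X_u, 1)` over the
uncovered rows. Learning: the update for `v` changes `D` by at most `(e-1) κ_v min(X_v, 1) - κ_v`.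
Covering: the sample hits `u` with probability at least `(1-1/e)(κ_v/β) min(X_u, 1)`, so the
logarithmic term falls in expectation by at least `(e-1) κ_v W/ρ`. Neither change is favourable
alone, but if `v` is uniform among the remaining rows, then `κ_v min(X_v, 1)` and `κ_v W/ρ` have the
same average. Hence the expected fall of `Φ` pays for `κ_v` (`expect_potential_le`,
`sum_stepExpect_potential_le`), and `Φ` is of order `β log(mn)` at the start.

For guess-and-double, the guess is a function of the arrivals and not of the coins, so the cost
splits according to the value `γ` of the guess. Two things disturb uniformity. The arrival that
triggers a restart selects itself; that single round is bounded in the worst case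
(`first_round_le`). Moreover, the rows still to come may have no cover within the budget `γ`; but
then the guess at the last arrival is not `γ`, whichever row comes last, so that arrival can be
deleted, and the other rows are still in uniformly random order (`sum_charge_le`). The phases then
add up because the guesses double (`sum_mul_starts_le`). A fixed guess is the case of a constant
rule, so one analysis serves both parts.

The guess comes from a deterministic multiplicative-weights computation that approximates the
relaxation for the arrived rows within the factor `2(e-1)` (`exists_cover_le_estimate`,
`estimate_le`). Up to constants the guess is therefore the value of the relaxation, and it never
exceeds `4(e-1)` times the final value.

For the running time, explicit programs are given. Their law is computed after erasing the step
counter: all parts except the sampling loop are deterministic and treated as functions on states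
(`erasedRun_sample`, `erasedRun_learnRound`). The number of steps is bounded separately, by a
syntactic criterion on loop bounds (`Cmd.Tame.exists_steps_le`). -/

namespace PMF

variable {α β : Type*} [Fintype α] [Fintype β]

/-- The expectation of a real function under a law on a finite type. -/
noncomputable def expect (p : PMF α) (f : α → ℝ) : ℝ := ∑ a, (p a).toReal * f a

lemma sum_toReal (p : PMF α) : ∑ a, (p a).toReal = 1 := by
  rw [← ENNReal.toReal_sum (fun a _ => p.apply_ne_top a), ← tsum_fintype (L := .unconditional _),
    p.tsum_coe, ENNReal.toReal_one]

lemma expect_const (p : PMF α) (r : ℝ) : p.expect (fun _ => r) = r := by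
  rw [expect, ← Finset.sum_mul, p.sum_toReal, one_mul]

lemma expect_mono (p : PMF α) {f g : α → ℝ} (h : ∀ a, f a ≤ g a) : p.expect f ≤ p.expect g :=
  Finset.sum_le_sum fun a _ => mul_le_mul_of_nonneg_left (h a) ENNReal.toReal_nonneg

lemma expect_add (p : PMF α) (f g : α → ℝ) :
    p.expect (fun a => f a + g a) = p.expect f + p.expect g := by
  simp only [expect, mul_add, Finset.sum_add_distrib]

lemma expect_const_mul (p : PMF α) (r : ℝ) (f : α → ℝ) :
    p.expect (fun a => r * f a) = r * p.expect f := by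
  simp only [expect, Finset.mul_sum]
  exact Finset.sum_congr rfl fun a _ => by ring

lemma expect_sum {ι : Type*} (p : PMF α) (s : Finset ι) (f : ι → α → ℝ) :
    p.expect (fun a => ∑ i ∈ s, f i a) = ∑ i ∈ s, p.expect (f i) := by
  simp only [expect, Finset.mul_sum]
  exact Finset.sum_comm

lemma expect_pure (a : α) (f : α → ℝ) : (PMF.pure a).expect f = f a := by
  classical
  rw [expect, Finset.sum_eq_single a]
  · simp
  · intro b _ hb
    simp [PMF.pure_apply, hb]
  · simp

lemma expect_bind (p : PMF α) (q : α → PMF β) (f : β → ℝ) :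
    (p.bind q).expect f = p.expect fun a => (q a).expect f := by
  simp only [expect, Finset.mul_sum]
  rw [Finset.sum_comm]
  refine Finset.sum_congr rfl fun b _ => ?_
  rw [PMF.bind_apply, tsum_fintype,
    ENNReal.toReal_sum (fun a _ => ENNReal.mul_ne_top (p.apply_ne_top a) ((q a).apply_ne_top b)),
    Finset.sum_mul]
  exact Finset.sum_congr rfl fun a _ => by rw [ENNReal.toReal_mul, mul_assoc]

lemma expect_map (p : PMF α) (g : α → β) (f : β → ℝ) :
    (p.map g).expect f = p.expect fun a => f (g a) := by
  rw [← PMF.bind_pure_comp, expect_bind]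
  simp only [Function.comp, expect_pure]

lemma expect_uniform [Nonempty α] (f : α → ℝ) :
    (PMF.uniformOfFintype α).expect f = (Fintype.card α : ℝ)⁻¹ * ∑ a, f a := by
  simp [expect, Finset.mul_sum]

end PMF

lemma expect_coin (p : ℝ) (f : Bool → ℝ) :
    (coin p).expect f = max 0 (min p 1) * f true + (1 - max 0 (min p 1)) * f false := by
  have h1 : max 0 (min p 1) ≤ (1 : ℝ) := max_le zero_le_one (min_le_right _ _)
  have h0 : (0 : ℝ) ≤ max 0 (min p 1) := le_max_left _ _
  simp only [PMF.expect, coin, PMF.ofFintype_apply, Fintype.sum_bool, if_true, Bool.false_eq_true,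
    if_false]
  rw [ENNReal.toReal_ofReal h0, ENNReal.toReal_ofReal (by linarith)]

/-- The coin clamps its bias by itself, so a program may flip with the raw quotient although the
algorithm caps it at `1`. -/
lemma coin_min_one (p : ℝ) : coin (min p 1) = coin p := by
  simp [coin]

namespace Real

/-- Convexity of `exp` on the segment from `0` to `b`. The value `b = 1` linearizes the
multiplicative update, and `b = -1` the probability that the sample misses a row. -/
lemma exp_le_chord {t b : ℝ} (h0 : 0 ≤ t) (h1 : t ≤ 1) : exp (t * b) ≤ 1 + t * (exp b - 1) := by
  have h := convexOn_exp.2 (Set.mem_univ 0) (Set.mem_univ b) (sub_nonneg.2 h1) h0 (by ring)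
  simp only [smul_eq_mul, mul_zero, zero_add, exp_zero, mul_one] at h
  linarith

end Real

namespace LearnOrCover

variable {m : ℕ}

/-! ### Sampling -/

lemma expect_sample_step (p : Fin m → ℝ) (S : Fin m) (μ : PMF (Finset (Fin m)))
    (F : Finset (Fin m) → ℝ) :
    (μ.bind fun R => (coin (p S)).map fun b => if b then insert S R else R).expect F =
      μ.expect fun R => max 0 (min (p S) 1) * F (insert S R) + (1 - max 0 (min (p S) 1)) * F R := by
  rw [PMF.expect_bind]
  simp only [PMF.expect_map, expect_coin]
  simp

/-- The probability that no set of `b` is sampled. -/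
lemma expect_sampleSets_disjoint (p : Fin m → ℝ) (b : Finset (Fin m)) :
    (sampleSets p).expect (fun R => if ∃ S ∈ R, S ∈ b then 0 else 1) =
      ∏ S ∈ b, (1 - max 0 (min (p S) 1)) := by
  -- The induction needs an arbitrary starting law: each flip of a set in `b` multiplies the miss
  -- probability by its factor, and the other flips leave it unchanged.
  have key : ∀ (l : List (Fin m)) (μ : PMF (Finset (Fin m))),
      (l.foldl (fun μ S => μ.bind fun R => (coin (p S)).map fun b => if b then insert S R else R)
        μ).expect (fun R => if ∃ S ∈ R, S ∈ b then (0 : ℝ) else 1) =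
      μ.expect (fun R => if ∃ S ∈ R, S ∈ b then (0 : ℝ) else 1) *
        (l.map fun S => if S ∈ b then 1 - max 0 (min (p S) 1) else 1).prod := by
    intro l
    induction l with
    | nil => intro μ; simp
    | cons S l ih =>
      intro μ
      rw [List.foldl_cons, ih, expect_sample_step, List.map_cons, List.prod_cons, ← mul_assoc]
      congr 1
      rw [mul_comm, ← PMF.expect_const_mul]
      congr 1
      funext R
      by_cases hS : S ∈ b
      · have h : ∃ T ∈ insert S R, T ∈ b := ⟨S, Finset.mem_insert_self _ _, hS⟩
        rw [if_pos h, if_pos hS]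
        ring
      · have h : (∃ T ∈ insert S R, T ∈ b) ↔ ∃ T ∈ R, T ∈ b := by
          constructor
          · rintro ⟨T, hT, hTb⟩
            rcases Finset.mem_insert.1 hT with rfl | hT
            · exact absurd hTb hS
            · exact ⟨T, hT, hTb⟩
          · rintro ⟨T, hT, hTb⟩
            exact ⟨T, Finset.mem_insert_of_mem hT, hTb⟩
        simp only [h, if_neg hS]
        ring
  rw [sampleSets, key, PMF.expect_pure]
  simp only [Finset.notMem_empty, false_and, exists_false, if_false, one_mul]
  rw [← List.ofFn_eq_map, List.prod_ofFn, ← Finset.prod_filter]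
  simp

/-- The expected cost of the sampled sets. -/
lemma expect_sampleSets_cost_le (p c : Fin m → ℝ) (hc : ∀ S, 0 < c S) :
    (sampleSets p).expect (fun R => ∑ S ∈ R, c S) ≤ ∑ S, max 0 (min (p S) 1) * c S := by
  have key : ∀ (l : List (Fin m)) (μ : PMF (Finset (Fin m))),
      (l.foldl (fun μ S => μ.bind fun R => (coin (p S)).map fun b => if b then insert S R else R)
        μ).expect (fun R => ∑ S ∈ R, c S) ≤
      μ.expect (fun R => ∑ S ∈ R, c S) + (l.map fun S => max 0 (min (p S) 1) * c S).sum := by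
    intro l
    induction l with
    | nil => intro μ; simp
    | cons S l ih =>
      intro μ
      rw [List.foldl_cons, List.map_cons, List.sum_cons]
      refine (ih _).trans ?_
      rw [expect_sample_step, ← add_assoc]
      refine add_le_add_left ?_ _
      rw [← PMF.expect_const μ (max 0 (min (p S) 1) * c S), ← PMF.expect_add]
      refine PMF.expect_mono _ fun R => ?_
      have h0 : 0 ≤ max 0 (min (p S) 1) := le_max_left _ _
      -- Only an inequality, since a collection drawn from a general `μ` may already contain `S`.
      have h : ∑ T ∈ insert S R, c T ≤ ∑ T ∈ R, c T + c S := by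
        by_cases hS : S ∈ R
        · rw [Finset.insert_eq_of_mem hS]
          linarith [hc S]
        · rw [Finset.sum_insert hS]
          linarith
      nlinarith [mul_le_mul_of_nonneg_left h h0]
  refine (key _ _).trans ?_
  rw [PMF.expect_pure, Finset.sum_empty, zero_add, ← List.ofFn_eq_map, List.sum_ofFn]

/-! ### Cheapest sets -/

section kappa

variable {c : Fin m → ℝ} {a : Finset (Fin m)}

lemma kappa_le {S : Fin m} (hS : S ∈ a) : kappa c a ≤ c S :=
  csInf_le (a.finite_toSet.image c).bddBelow ⟨S, hS, rfl⟩

lemma exists_eq_kappa (ha : a.Nonempty) : ∃ S ∈ a, c S = kappa c a :=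
  Set.Nonempty.csInf_mem (ha.to_set.image c) (a.finite_toSet.image c)

lemma kappa_pos (hc : ∀ S, 0 < c S) (ha : a.Nonempty) : 0 < kappa c a := by
  obtain ⟨S, -, hS⟩ := exists_eq_kappa (c := c) ha
  exact hS ▸ hc S

lemma mem_cheapest {S : Fin m} :
    S ∈ cheapest c a ↔ S ∈ a ∧ ∀ T ∈ a, c S < c T ∨ (c S = c T ∧ S ≤ T) := by
  simp [cheapest]

lemma cheapest_eq_singleton {S : Fin m} (hS : S ∈ a)
    (h : ∀ T ∈ a, c S < c T ∨ (c S = c T ∧ S ≤ T)) : cheapest c a = {S} := by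
  ext T
  rw [mem_cheapest, Finset.mem_singleton]
  constructor
  · rintro ⟨hT, hT'⟩
    rcases h T hT with h1 | ⟨h1, h2⟩ <;> rcases hT' S hS with h3 | ⟨h3, h4⟩
    · linarith
    · linarith
    · linarith
    · exact le_antisymm h4 h2
  · rintro rfl
    exact ⟨hS, h⟩

/-- Lexicographic order by cost and index has a unique minimum, so exactly one set is bought in the
last step of a round, at cost `kappa`. -/
lemma exists_cheapest (ha : a.Nonempty) :
    ∃ S ∈ a, cheapest c a = {S} ∧ c S = kappa c a := by
  obtain ⟨S₀, hS₀, h₀⟩ := exists_eq_kappa (c := c) ha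
  obtain ⟨S, hS, hmin⟩ := (a.filter fun S => c S = kappa c a).exists_min_image id
    ⟨S₀, Finset.mem_filter.2 ⟨hS₀, h₀⟩⟩
  rw [Finset.mem_filter] at hS
  refine ⟨S, hS.1, cheapest_eq_singleton hS.1 fun T hT => ?_, hS.2⟩
  rcases (kappa_le (c := c) hT).lt_or_eq with h | h
  · exact Or.inl (hS.2 ▸ h)
  · exact Or.inr ⟨hS.2.trans h, hmin T (Finset.mem_filter.2 ⟨hT, h.symm⟩)⟩

end kappa

/-! ### Budget covers and balanced vectors -/

/-- `y` is a fractional cover of the rows in `A` that costs at most `β` and uses no set of cost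
above `β`. -/
structure IsBudgetCover (c : Fin m → ℝ) (β : ℝ) (A : Set (Finset (Fin m))) (y : Fin m → ℝ) :
    Prop where
  nonneg : ∀ S, 0 ≤ y S
  support : ∀ S, β < c S → y S = 0
  cost_le : ∑ S, c S * y S ≤ β
  covers : ∀ a ∈ A, 1 ≤ ∑ S ∈ a, y S

/-- `x` is supported exactly on the sets of cost at most `β` and costs `β`. -/
structure IsBalanced (c : Fin m → ℝ) (β : ℝ) (x : Fin m → ℝ) : Prop where
  pos : ∀ S, c S ≤ β → 0 < x S
  zero : ∀ S, β < c S → x S = 0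
  cost_eq : ∑ S, c S * x S = β

/-- A fractional cover of cost at most `β` can be turned into one that avoids sets of cost above
`β`. -/
lemma exists_isBudgetCover {c : Fin m → ℝ} {β : ℝ} (hc : ∀ S, 0 < c S) (hβ : 0 < β)
    {A : Set (Finset (Fin m))} {x : Fin m → ℝ} (h0 : ∀ S, 0 ≤ x S)
    (hx : ∑ S, c S * x S ≤ β) (hcov : ∀ a ∈ A, 1 ≤ ∑ S ∈ a, x S) :
    ∃ y, IsBudgetCover c β A y := by
  -- `t` is the mass on the expensive sets and `u` the cost of the rest, so `u + β t ≤ β`. Deleting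
  -- the expensive sets lowers the coverage of a row by at most `t`; dividing by `1 - t` repairs
  -- this and keeps the cost at most `β`.
  set t := ∑ S, if β < c S then x S else 0 with ht
  set u := ∑ S, c S * (if β < c S then 0 else x S) with hu
  have ht0 : 0 ≤ t := Finset.sum_nonneg fun S _ => by split_ifs; exacts [h0 S, le_rfl]
  have hu0 : 0 ≤ u := Finset.sum_nonneg fun S _ => by
    split_ifs
    · simp
    · exact mul_nonneg (hc S).le (h0 S)
  have hsplit : u + ∑ S, c S * (if β < c S then x S else 0) ≤ β := by
    rw [hu, ← Finset.sum_add_distrib]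
    refine le_trans (le_of_eq (Finset.sum_congr rfl fun S _ => ?_)) hx
    split_ifs <;> simp
  have hterm : ∀ S, β * (if β < c S then x S else 0) ≤ c S * (if β < c S then x S else 0) := by
    intro S
    split_ifs with h
    · exact mul_le_mul_of_nonneg_right h.le (h0 S)
    · simp
  have hle : β * t ≤ ∑ S, c S * (if β < c S then x S else 0) := by
    rw [ht, Finset.mul_sum]
    exact Finset.sum_le_sum fun S _ => hterm S
  have ht1 : t < 1 := by
    by_contra hcon
    have ht2 : 1 ≤ t := not_lt.1 hcon
    obtain ⟨S, -, hS⟩ : ∃ S ∈ Finset.univ, 0 < (if β < c S then x S else 0) := by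
      by_contra hall
      push Not at hall
      have : t ≤ 0 := Finset.sum_nonpos hall
      linarith
    -- Strict, because some expensive set has positive mass. This excludes `t = 1`, where the
    -- rescaling would break down.
    have hlt : β * t < ∑ S, c S * (if β < c S then x S else 0) := by
      rw [ht, Finset.mul_sum]
      refine Finset.sum_lt_sum (fun S _ => hterm S) ⟨S, Finset.mem_univ S, ?_⟩
      have hb : β < c S := by
        by_contra hb
        simp [hb] at hS
      exact mul_lt_mul_of_pos_right hb hS
    nlinarith
  have h1t : 0 < 1 - t := by linarith
  refine ⟨fun S => (if β < c S then 0 else x S) / (1 - t), ⟨fun S => ?_, fun S hS => ?_, ?_, ?_⟩⟩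
  · refine div_nonneg ?_ h1t.le
    split_ifs
    exacts [le_rfl, h0 S]
  · simp [hS]
  · simp only [← mul_div_assoc, ← Finset.sum_div]
    rw [div_le_iff₀ h1t]
    nlinarith
  · intro a ha
    rw [← Finset.sum_div, le_div_iff₀ h1t, one_mul]
    have h1 := hcov a ha
    have h2 : ∑ S ∈ a, (if β < c S then x S else 0) ≤ t :=
      Finset.sum_le_sum_of_subset_of_nonneg (Finset.subset_univ _) fun S _ _ => by
        split_ifs
        exacts [h0 S, le_rfl]
    have h3 : ∑ S ∈ a, x S = ∑ S ∈ a, (if β < c S then 0 else x S) +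
        ∑ S ∈ a, (if β < c S then x S else 0) := by
      rw [← Finset.sum_add_distrib]
      exact Finset.sum_congr rfl fun S _ => by split_ifs <;> simp
    linarith

/-! ### Drift of the weighted divergence under the multiplicative update -/

section potential

variable {c : Fin m → ℝ} {β : ℝ} {A : Set (Finset (Fin m))} {x y : Fin m → ℝ}
  {a : Finset (Fin m)}

lemma IsBudgetCover.exists_cheap (hy : IsBudgetCover c β A y) (ha : a ∈ A) :
    ∃ S ∈ a, c S ≤ β := by
  by_contra! h
  have h1 := hy.covers a ha
  rw [Finset.sum_eq_zero fun S hS => hy.support S (h S hS)] at h1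
  linarith

lemma IsBudgetCover.kappa_le (hy : IsBudgetCover c β A y) (ha : a ∈ A) : kappa c a ≤ β := by
  obtain ⟨S, hS, hSβ⟩ := hy.exists_cheap ha
  exact (LearnOrCover.kappa_le hS).trans hSβ

lemma IsBudgetCover.nonempty (hy : IsBudgetCover c β A y) (ha : a ∈ A) : a.Nonempty := by
  obtain ⟨S, hS, -⟩ := hy.exists_cheap ha
  exact ⟨S, hS⟩

lemma IsBalanced.nonneg (hx : IsBalanced c β x) (S : Fin m) : 0 ≤ x S := by
  rcases le_or_gt (c S) β with h | h
  · exact (hx.pos S h).le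
  · exact (hx.zero S h).ge

lemma isBalanced_initWeights (hc : ∀ S, 0 < c S) (hβ : 0 < β) (h : ∃ S, c S ≤ β) :
    IsBalanced c β (initWeights c β) := by
  obtain ⟨S₀, hS₀⟩ := h
  have hcard : 0 < ((Finset.univ.filter fun T => c T ≤ β).card : ℝ) :=
    Nat.cast_pos.2 (Finset.card_pos.2 ⟨S₀, by simpa using hS₀⟩)
  refine ⟨fun S hS => ?_, fun S hS => ?_, ?_⟩
  · rw [initWeights, if_pos hS]
    have := hc S
    positivity
  · rw [initWeights, if_neg (not_le.2 hS)]
  · have h : ∀ S, c S * initWeights c β S =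
        if c S ≤ β then β / ((Finset.univ.filter fun T => c T ≤ β).card : ℝ) else 0 := by
      intro S
      rw [initWeights]
      split_ifs with hS
      · have := (hc S).ne'
        field_simp
      · simp
    simp only [h]
    rw [← Finset.sum_filter, Finset.sum_const, nsmul_eq_mul]
    field_simp

lemma exp_scale_ge_one (hc : ∀ S, 0 < c S) (ha : a.Nonempty) (S : Fin m) :
    1 ≤ Real.exp (if S ∈ a then kappa c a / c S else 0) := by
  rw [Real.one_le_exp_iff]
  split_ifs
  · exact div_nonneg (kappa_pos hc ha).le (hc S).le
  · exact le_rfl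

lemma le_scaleUp (hc : ∀ S, 0 < c S) (ha : a.Nonempty) (hx : ∀ S, 0 ≤ x S) (S : Fin m) :
    x S ≤ scaleUp c x a S :=
  le_mul_of_one_le_right (hx S) (exp_scale_ge_one hc ha S)

/-- Since `kappa c a ≤ c S` on `a`, the chord bound gives `exp (κ / c S) ≤ 1 + (e - 1) κ / c S`.
Multiplied by `c S * x S`, the increase is `(e - 1) κ x S`, independent of the cost of the set; this
is what the exponent `κ / c S` is made for. -/
lemma sum_cost_scaleUp_le (hc : ∀ S, 0 < c S) (hx : ∀ S, 0 ≤ x S) (ha : a.Nonempty) :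
    ∑ S, c S * scaleUp c x a S ≤
      ∑ S, c S * x S + (Real.exp 1 - 1) * kappa c a * ∑ S ∈ a, x S := by
  have h : ∑ S ∈ a, x S = ∑ S, if S ∈ a then x S else 0 := by
    rw [← Finset.sum_filter]
    simp
  rw [h, Finset.mul_sum, ← Finset.sum_add_distrib]
  refine Finset.sum_le_sum fun S _ => ?_
  rw [scaleUp]
  split_ifs with hS
  · have hcS := hc S
    have h := Real.exp_le_chord (t := kappa c a / c S) (b := 1)
      (div_nonneg (kappa_pos hc ha).le hcS.le) ((div_le_one hcS).2 (kappa_le hS))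
    rw [mul_one] at h
    calc c S * (x S * Real.exp (kappa c a / c S))
        ≤ c S * (x S * (1 + kappa c a / c S * (Real.exp 1 - 1))) := by
          have := hx S
          gcongr
      _ = _ := by field_simp
  · simp

lemma IsBalanced.one_le_norm (hc : ∀ S, 0 < c S) (hβ : 0 < β) (hx : IsBalanced c β x)
    (ha : a.Nonempty) : 1 ≤ (∑ T, c T * scaleUp c x a T) / β := by
  rw [one_le_div hβ]
  conv_lhs => rw [← hx.cost_eq]
  exact Finset.sum_le_sum fun S _ =>
    mul_le_mul_of_nonneg_left (le_scaleUp hc ha hx.nonneg S) (hc S).le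

lemma IsBalanced.updateWeights (hc : ∀ S, 0 < c S) (hβ : 0 < β) (hx : IsBalanced c β x)
    (ha : a.Nonempty) : IsBalanced c β (updateWeights c β x a) := by
  rw [LearnOrCover.updateWeights]
  split_ifs
  swap
  · exact hx
  have hZ : 0 < (∑ T, c T * scaleUp c x a T) / β := one_pos.trans_le (hx.one_le_norm hc hβ ha)
  refine ⟨fun S hS => ?_, fun S hS => ?_, ?_⟩
  · exact div_pos (mul_pos (hx.pos S hS) (Real.exp_pos _)) hZ
  · simp [normalize, scaleUp, hx.zero S hS]
  · simp only [normalize, ← mul_div_assoc, ← Finset.sum_div]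
    have hne : ∑ T, c T * scaleUp c x a T ≠ 0 := fun h => by simp [h] at hZ
    field_simp

/-- The weighted Kullback–Leibler divergence of `x` from `y`. -/
noncomputable def divergence (c y x : Fin m → ℝ) : ℝ := ∑ S, c S * y S * Real.log (y S / x S)

/-- From `log u ≥ 1 - 1/u`, each term is at least `c S * y S - c S * x S`. As `y` need not cost
exactly `β`, the divergence can be negative; the summand `β` in the potential compensates for this.
-/
lemma divergence_ge (hc : ∀ S, 0 < c S) (hy : IsBudgetCover c β A y) (hx : IsBalanced c β x) :
    -β ≤ divergence c y x := by
  have h : ∀ S, - (c S * x S) ≤ c S * y S * Real.log (y S / x S) := by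
    intro S
    rcases (hy.nonneg S).lt_or_eq with hpos | hzero
    · have hS : c S ≤ β := by
        by_contra hS
        exact hpos.ne' (hy.support S (not_le.1 hS))
      have hxS := hx.pos S hS
      have hl := Real.one_sub_inv_le_log_of_pos (div_pos hpos hxS)
      have hcS := hc S
      have h1 : c S * y S * (1 - (y S / x S)⁻¹) ≤ c S * y S * Real.log (y S / x S) := by
        gcongr
      have h2 : c S * y S * (1 - (y S / x S)⁻¹) = c S * y S - c S * x S := by
        field_simp
      have h3 : 0 ≤ c S * y S := by positivity
      linarith
    · rw [← hzero]
      simpa using mul_nonneg (hc S).le (hx.nonneg S)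
  calc -β = ∑ S, -(c S * x S) := by rw [Finset.sum_neg_distrib, hx.cost_eq]
    _ ≤ _ := Finset.sum_le_sum fun S _ => h S

/-- The ratio `y S / x S` equals `(c S * y S / β)` times the number of affordable sets. The first
factor is at most `1`, because a single set of `y` cannot cost more than all of `y`. -/
lemma divergence_initWeights_le (hc : ∀ S, 0 < c S) (hβ : 0 < β) (hm : 0 < m)
    (hy : IsBudgetCover c β A y) : divergence c y (initWeights c β) ≤ β * Real.log m := by
  have hm1 : (1 : ℝ) ≤ m := by exact_mod_cast hm
  have hlog : 0 ≤ Real.log m := Real.log_nonneg hm1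
  calc divergence c y (initWeights c β) ≤ ∑ S, c S * y S * Real.log m := by
        refine Finset.sum_le_sum fun S _ => ?_
        rcases (hy.nonneg S).lt_or_eq with hpos | hzero
        · have hS : c S ≤ β := by
            by_contra hS
            exact hpos.ne' (hy.support S (not_le.1 hS))
          have hcard : 0 < ((Finset.univ.filter fun T => c T ≤ β).card : ℝ) :=
            Nat.cast_pos.2 (Finset.card_pos.2 ⟨S, by simpa using hS⟩)
          have hcS := hc S
          have hle : c S * y S ≤ β := le_trans
            (Finset.single_le_sum (f := fun S => c S * y S)
              (fun T _ => mul_nonneg (hc T).le (hy.nonneg T)) (Finset.mem_univ S)) hy.cost_le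
          have hcard' : ((Finset.univ.filter fun T => c T ≤ β).card : ℝ) ≤ m := by
            exact_mod_cast (Finset.card_filter_le _ _).trans (by simp)
          refine mul_le_mul_of_nonneg_left (Real.log_le_log ?_ ?_)
            (mul_nonneg hcS.le hpos.le)
          · rw [initWeights, if_pos hS]
            positivity
          · rw [initWeights, if_pos hS]
            calc y S / (β / (c S * ((Finset.univ.filter fun T => c T ≤ β).card : ℝ)))
                = (c S * y S) / β * ((Finset.univ.filter fun T => c T ≤ β).card : ℝ) := by
                  field_simp
              _ ≤ 1 * m := mul_le_mul ((div_le_one hβ).2 hle) hcard' hcard.le zero_le_one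
              _ = m := one_mul _
        · rw [← hzero]
          simp
    _ = (∑ S, c S * y S) * Real.log m := by rw [Finset.sum_mul]
    _ ≤ β * Real.log m := mul_le_mul_of_nonneg_right hy.cost_le hlog

/-- The change of the divergence in one round. -/
lemma divergence_updateWeights_le (hc : ∀ S, 0 < c S) (hβ : 0 < β) (hy : IsBudgetCover c β A y)
    (hx : IsBalanced c β x) (ha : a ∈ A) :
    divergence c y (updateWeights c β x a) ≤
      divergence c y x + kappa c a * ((Real.exp 1 - 1) * min (∑ S ∈ a, x S) 1 - 1) := by
  have hne := hy.nonempty ha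
  have hκ := kappa_pos hc hne
  have he : 2 ≤ Real.exp 1 := by
    have := Real.add_one_le_exp (1 : ℝ)
    linarith
  rw [updateWeights]
  split_ifs with hX
  swap
  · rw [min_eq_right (not_lt.1 hX)]
    have : 0 ≤ kappa c a * ((Real.exp 1 - 1) * 1 - 1) := mul_nonneg hκ.le (by linarith)
    linarith
  rw [min_eq_left hX.le]
  set Z := (∑ T, c T * scaleUp c x a T) / β with hZ
  have hZ1 : 1 ≤ Z := hx.one_le_norm hc hβ hne
  have hlogZ : 0 ≤ Real.log Z := Real.log_nonneg hZ1
  -- Normalization adds `log Z` and the scaling subtracts `κ / c S` on `a`. The weight `c S` of the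
  -- divergence cancels that denominator, so the gain is `κ` times the coverage of `a` by `y`, which
  -- is at least `κ`.
  have hterm : ∀ S, c S * y S * Real.log (y S / normalize c β (scaleUp c x a) S) =
      c S * y S * Real.log (y S / x S) + c S * y S * Real.log Z -
        (if S ∈ a then y S else 0) * kappa c a := by
    intro S
    rcases (hy.nonneg S).lt_or_eq with hpos | hzero
    · have hS : c S ≤ β := by
        by_contra hS
        exact hpos.ne' (hy.support S (not_le.1 hS))
      have hxS := hx.pos S hS
      have hcS := hc S
      rw [normalize, ← hZ, scaleUp,
        show y S / (x S * Real.exp (if S ∈ a then kappa c a / c S else 0) / Z) =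
          y S / x S * (Z / Real.exp (if S ∈ a then kappa c a / c S else 0)) by field_simp,
        Real.log_mul (by positivity) (by positivity),
        Real.log_div (x := Z) (by positivity) (by positivity), Real.log_exp]
      split_ifs
      · field_simp
        ring
      · ring
    · rw [← hzero]
      simp
  have hsum : ∑ S, (if S ∈ a then y S else 0) = ∑ S ∈ a, y S := by
    rw [← Finset.sum_filter]
    simp
  have hcov := hy.covers a ha
  have hZβ : β * Z = ∑ T, c T * scaleUp c x a T := by
    rw [hZ]
    field_simp
  have hup := sum_cost_scaleUp_le hc hx.nonneg hne
  rw [hx.cost_eq, ← hZβ] at hup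
  have hlog : Real.log Z ≤ Z - 1 := Real.log_le_sub_one_of_pos (by linarith)
  -- By `hup`, the right-hand side is at most `(e - 1) κ` times the coverage of `a` by `x`.
  have h1 : (∑ S, c S * y S) * Real.log Z ≤ β * (Z - 1) :=
    mul_le_mul hy.cost_le hlog hlogZ hβ.le
  calc divergence c y (normalize c β (scaleUp c x a))
      = divergence c y x + (∑ S, c S * y S) * Real.log Z - (∑ S ∈ a, y S) * kappa c a := by
        simp only [divergence, hterm, Finset.sum_sub_distrib, Finset.sum_add_distrib,
          ← Finset.sum_mul, hsum]
    _ ≤ _ := by nlinarith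

end potential

end LearnOrCover

namespace LearnOrCover

variable {m n : ℕ}

/-! ### The potential -/

/-- The total cheapest cost of the rows that are not covered by `B`. -/
noncomputable def residual (c : Fin m → ℝ) (r : Fin n → Finset (Fin m)) (B : Finset (Fin m)) : ℝ :=
  ∑ j, if ∃ S ∈ B, S ∈ r j then 0 else kappa c (r j)

/-- The rows `r` are those still to arrive. The first summand makes the potential nonnegative, the
divergence measures what is left to learn, and the logarithm what is left to cover. The `1 +` keeps
the logarithm nonnegative and bounds its slope once the residual is below `β`. The factor `2e` turns
the guaranteed fall, which carries `(1 - 1/e) / 2`, into the factor `e - 1` of the learning term. -/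
noncomputable def potential (c : Fin m → ℝ) (β : ℝ) (y : Fin m → ℝ) (r : Fin n → Finset (Fin m))
    (s : State m) : ℝ :=
  β + divergence c y s.x + 2 * Real.exp 1 * (β * Real.log (1 + residual c r s.bought / β))

/-- The expectation of `F` over the state after one round. -/
noncomputable def stepExpect (c : Fin m → ℝ) (β : ℝ) (s : State m) (a : Finset (Fin m))
    (F : State m → ℝ) : ℝ :=
  if ∃ S ∈ s.bought, S ∈ a then F s
  else (sampleSets fun S => min (kappa c a * s.x S / β) 1).expect fun R =>
    F ⟨updateWeights c β s.x a, s.bought ∪ R ∪ cheapest c a⟩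

/-! ### Drift of the full potential in one round -/

section potential

variable {c : Fin m → ℝ} {β : ℝ} {x y : Fin m → ℝ} {a : Finset (Fin m)}
  {r : Fin (n + 1) → Finset (Fin m)} {r' : Fin n → Finset (Fin m)} {B : Finset (Fin m)}

lemma uncovered_weight_nonneg (hc : ∀ S, 0 < c S) {a : Finset (Fin m)} (ha : a.Nonempty)
    (B : Finset (Fin m)) : 0 ≤ if ∃ S ∈ B, S ∈ a then 0 else kappa c a := by
  split_ifs
  exacts [le_rfl, (kappa_pos hc ha).le]

lemma residual_nonneg (hc : ∀ S, 0 < c S) {r : Fin n → Finset (Fin m)}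
    (hr : ∀ j, (r j).Nonempty) (B : Finset (Fin m)) : 0 ≤ residual c r B :=
  Finset.sum_nonneg fun j _ => uncovered_weight_nonneg hc (hr j) B

lemma residual_anti (hc : ∀ S, 0 < c S) {r : Fin n → Finset (Fin m)}
    (hr : ∀ j, (r j).Nonempty) {B B' : Finset (Fin m)} (h : B ⊆ B') :
    residual c r B' ≤ residual c r B := by
  refine Finset.sum_le_sum fun j _ => ?_
  by_cases hB : ∃ S ∈ B, S ∈ r j
  · obtain ⟨S, hS, hSj⟩ := hB
    rw [if_pos ⟨S, h hS, hSj⟩, if_pos ⟨S, hS, hSj⟩]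
  · rw [if_neg hB]
    split_ifs
    exacts [(kappa_pos hc (hr j)).le, le_rfl]

lemma residual_le {r : Fin n → Finset (Fin m)} (hβ : 0 < β) (h : ∀ j, kappa c (r j) ≤ β)
    (B : Finset (Fin m)) : residual c r B ≤ n * β := by
  calc residual c r B ≤ ∑ _j : Fin n, β := Finset.sum_le_sum fun j _ => by
        split_ifs
        exacts [hβ.le, h j]
    _ = n * β := by simp

lemma potential_nonneg (hc : ∀ S, 0 < c S) (hβ : 0 < β) {r : Fin n → Finset (Fin m)}
    (hy : IsBudgetCover c β (Set.range r) y) {s : State m} (hs : IsBalanced c β s.x) :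
    0 ≤ potential c β y r s := by
  have h1 := divergence_ge hc hy hs
  have h2 := residual_nonneg hc (fun j => hy.nonempty ⟨j, rfl⟩) s.bought
  have h3 : 0 ≤ Real.log (1 + residual c r s.bought / β) :=
    Real.log_nonneg (by have := div_nonneg h2 hβ.le; linarith)
  have h4 : 0 ≤ 2 * Real.exp 1 * (β * Real.log (1 + residual c r s.bought / β)) := by positivity
  unfold potential
  linarith

/-- The probability that the sample misses `b`. -/
lemma expect_miss_le {κ : ℝ} (hβ : 0 < β) (hx : ∀ S, 0 ≤ x S) (hκ : 0 ≤ κ) (hκβ : κ ≤ β)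
    (b : Finset (Fin m)) :
    (sampleSets fun S => min (κ * x S / β) 1).expect (fun R => if ∃ S ∈ R, S ∈ b then 0 else 1) ≤
      1 - (1 - Real.exp (-1)) * (κ / β) * min (∑ S ∈ b, x S) 1 := by
  have hX : 0 ≤ ∑ S ∈ b, x S := Finset.sum_nonneg fun S _ => hx S
  rw [expect_sampleSets_disjoint]
  have hq : 0 ≤ κ / β := div_nonneg hκ hβ.le
  calc ∏ S ∈ b, (1 - max 0 (min (min (κ * x S / β) 1) 1))
      ≤ ∏ S ∈ b, Real.exp (-(κ * x S / β)) := by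
        refine Finset.prod_le_prod (fun S _ => ?_) fun S _ => ?_
        · have : max 0 (min (min (κ * x S / β) 1) 1) ≤ (1 : ℝ) :=
            max_le zero_le_one (min_le_right _ _)
          linarith
        · have h0 : 0 ≤ κ * x S / β := div_nonneg (mul_nonneg hκ (hx S)) hβ.le
          rw [min_assoc, min_self, max_eq_right (le_min h0 zero_le_one)]
          rcases le_total (κ * x S / β) 1 with h | h
          · rw [min_eq_left h]
            have := Real.add_one_le_exp (-(κ * x S / β))
            linarith
          · rw [min_eq_right h, sub_self]
            exact (Real.exp_pos _).le
    _ = Real.exp (-(κ / β * ∑ S ∈ b, x S)) := by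
        rw [← Real.exp_sum, Finset.sum_neg_distrib, Finset.mul_sum]
        congr 2
        exact Finset.sum_congr rfl fun S _ => by ring
    -- Truncation of the coverage at `1` puts the coefficient into `[0, 1]`, as the chord bound
    -- requires.
    _ ≤ Real.exp ((κ / β * min (∑ S ∈ b, x S) 1) * (-1)) := by
        rw [Real.exp_le_exp]
        have := mul_le_mul_of_nonneg_left (min_le_left (∑ S ∈ b, x S) 1) hq
        linarith
    _ ≤ 1 + (κ / β * min (∑ S ∈ b, x S) 1) * (Real.exp (-1) - 1) :=
        Real.exp_le_chord (mul_nonneg hq (le_min hX zero_le_one))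
          (mul_le_one₀ ((div_le_one hβ).2 hκβ) (le_min hX zero_le_one) (min_le_right _ _))
    _ = _ := by ring

/-- The uncovered weight, discounted by the fractional coverage. -/
noncomputable def learned (c x : Fin m → ℝ) (r : Fin n → Finset (Fin m)) (B : Finset (Fin m)) : ℝ :=
  ∑ j, (if ∃ S ∈ B, S ∈ r j then 0 else kappa c (r j)) * min (∑ S ∈ r j, x S) 1

lemma learned_le_residual (hc : ∀ S, 0 < c S) {r : Fin n → Finset (Fin m)}
    (hr : ∀ j, (r j).Nonempty) (B : Finset (Fin m)) :
    learned c x r B ≤ residual c r B :=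
  Finset.sum_le_sum fun j _ =>
    mul_le_of_le_one_right (uncovered_weight_nonneg hc (hr j) B) (min_le_right _ _)

/-- The expected change of the residual in a round in which the uncovered row `a` arrives. -/
lemma expect_residual_le (hc : ∀ S, 0 < c S) (hβ : 0 < β) (hx : ∀ S, 0 ≤ x S)
    (hr : ∀ j, (r j).Nonempty)
    (hr' : ∀ F : Finset (Fin m) → ℝ, ∑ i, F (r' i) + F a = ∑ j, F (r j)) (hr'' : ∀ i, (r' i).Nonempty)
    (ha : a.Nonempty) (haβ : kappa c a ≤ β) :
    (sampleSets fun S => min (kappa c a * x S / β) 1).expect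
        (fun R => residual c r' (B ∪ R ∪ cheapest c a)) ≤
      residual c r B - (1 - Real.exp (-1)) * (kappa c a / β) * learned c x r B := by
  have hκ := (kappa_pos hc ha).le
  calc _ ≤ (sampleSets fun S => min (kappa c a * x S / β) 1).expect (fun R =>
        ∑ j, (if ∃ S ∈ B, S ∈ r j then 0 else kappa c (r j)) *
          if ∃ S ∈ R, S ∈ r j then 0 else 1) := by
        refine PMF.expect_mono _ fun R => ?_
        -- Only the sample is used here: the cheapest set is discarded, and the arriving row is
        -- counted back among the remaining ones. The departure of that row is exploited separately.
        refine (residual_anti hc hr'' Finset.subset_union_left).trans ?_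
        have h1 := hr' fun b => if ∃ S ∈ B ∪ R, S ∈ b then 0 else kappa c b
        have h2 := uncovered_weight_nonneg hc ha (B ∪ R)
        have h3 : residual c r' (B ∪ R) ≤ ∑ j, if ∃ S ∈ B ∪ R, S ∈ r j then 0 else kappa c (r j) := by
          rw [← h1, residual]
          linarith
        refine h3.trans (le_of_eq (Finset.sum_congr rfl fun j _ => ?_))
        have hor : (∃ S ∈ B ∪ R, S ∈ r j) ↔ (∃ S ∈ B, S ∈ r j) ∨ ∃ S ∈ R, S ∈ r j := by
          simp only [Finset.mem_union, or_and_right, exists_or]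
        by_cases hB : ∃ S ∈ B, S ∈ r j
        · rw [if_pos (hor.2 (Or.inl hB)), if_pos hB, zero_mul]
        · rw [if_neg hB]
          by_cases hR : ∃ S ∈ R, S ∈ r j
          · rw [if_pos (hor.2 (Or.inr hR)), if_pos hR, mul_zero]
          · rw [if_neg fun h => (hor.1 h).elim hB hR, if_neg hR, mul_one]
    _ ≤ ∑ j, (if ∃ S ∈ B, S ∈ r j then 0 else kappa c (r j)) *
          (1 - (1 - Real.exp (-1)) * (kappa c a / β) * min (∑ S ∈ r j, x S) 1) := by
        rw [PMF.expect_sum]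
        refine Finset.sum_le_sum fun j _ => ?_
        rw [PMF.expect_const_mul]
        exact mul_le_mul_of_nonneg_left (expect_miss_le hβ hx hκ haβ _)
          (uncovered_weight_nonneg hc (hr j) B)
    _ = _ := by
        rw [learned, Finset.mul_sum, residual, ← Finset.sum_sub_distrib]
        exact Finset.sum_congr rfl fun j _ => by ring

/-- The expected potential after a round in which the uncovered row `a` arrives. -/
lemma expect_potential_le (hc : ∀ S, 0 < c S) (hβ : 0 < β)
    (hy : IsBudgetCover c β (Set.range r) y) (hx : IsBalanced c β x) (ha : a ∈ Set.range r)
    (hr' : ∀ F : Finset (Fin m) → ℝ, ∑ i, F (r' i) + F a = ∑ j, F (r j))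
    (hr'' : ∀ i, (r' i).Nonempty) (hun : ¬ ∃ S ∈ B, S ∈ a) :
    (sampleSets fun S => min (kappa c a * x S / β) 1).expect
        (fun R => potential c β y r' ⟨updateWeights c β x a, B ∪ R ∪ cheapest c a⟩) + kappa c a ≤
      potential c β y r ⟨x, B⟩ + (Real.exp 1 - 1) *
        (kappa c a * min (∑ S ∈ a, x S) 1 - kappa c a * learned c x r B / residual c r B) := by
  have hr : ∀ j, (r j).Nonempty := fun j => hy.nonempty ⟨j, rfl⟩
  have hne := hy.nonempty ha
  have hκ := kappa_pos hc hne
  have hκβ := hy.kappa_le ha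
  set ρ := residual c r B with hρ
  set W := learned c x r B with hW
  have hWρ : W ≤ ρ := learned_le_residual hc hr B
  have hW0 : 0 ≤ W := Finset.sum_nonneg fun j _ => mul_nonneg (uncovered_weight_nonneg hc (hr j) B)
    (le_min (Finset.sum_nonneg fun S _ => hx.nonneg S) zero_le_one)
  have hres : residual c r' B = ρ - kappa c a := by
    have h := hr' fun b => if ∃ S ∈ B, S ∈ b then 0 else kappa c b
    rw [if_neg hun] at h
    rw [hρ, residual, residual, ← h]
    ring
  have hρpos : 0 < ρ := by
    have := residual_nonneg hc hr'' B
    linarith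
  have hpt : ∀ R : Finset (Fin m), residual c r' (B ∪ R ∪ cheapest c a) ≤ ρ - kappa c a := fun R =>
    (residual_anti hc hr'' (Finset.union_assoc B R _ ▸ Finset.subset_union_left)).trans hres.le
  set μ := sampleSets fun S => min (kappa c a * x S / β) 1
  set E := μ.expect fun R => residual c r' (B ∪ R ∪ cheapest c a) with hE
  -- Two bounds on the new residual, needed in different regimes: the departure of the arriving row
  -- alone, and the effect of the sample alone.
  have hE1 : E ≤ ρ - kappa c a := (PMF.expect_mono _ hpt).trans_eq (PMF.expect_const _ _)
  have hE2 : E ≤ ρ - (1 - Real.exp (-1)) * (kappa c a / β) * W :=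
    expect_residual_le hc hβ hx.nonneg hr hr' hr'' hne hκβ
  have hden : 0 < β + ρ := by linarith
  -- The tangent at `ρ` of the concave function, which makes the bound linear in the residual, so
  -- that only the expectation `E` matters.
  have hlog : ∀ R : Finset (Fin m), β * Real.log (1 + residual c r' (B ∪ R ∪ cheapest c a) / β) ≤
      β * Real.log (1 + ρ / β) - β * ρ / (β + ρ) +
        β / (β + ρ) * residual c r' (B ∪ R ∪ cheapest c a) := by
    intro R
    have h0 := residual_nonneg hc hr'' (B ∪ R ∪ cheapest c a)
    set q := residual c r' (B ∪ R ∪ cheapest c a)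
    have h1 : 0 < 1 + q / β := by positivity
    have h2 : 0 < 1 + ρ / β := by positivity
    have h3 := Real.log_le_sub_one_of_pos (div_pos h1 h2)
    rw [Real.log_div h1.ne' h2.ne'] at h3
    have h4 : (1 + q / β) / (1 + ρ / β) - 1 = (q - ρ) / (β + ρ) := by
      field_simp
      ring
    rw [h4] at h3
    have h5 : β * (Real.log (1 + q / β) - Real.log (1 + ρ / β)) ≤ β * ((q - ρ) / (β + ρ)) :=
      mul_le_mul_of_nonneg_left h3 hβ.le
    have h6 : β * ((q - ρ) / (β + ρ)) = β / (β + ρ) * q - β * ρ / (β + ρ) := by ring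
    linarith
  have hElog : μ.expect (fun R => β * Real.log (1 + residual c r' (B ∪ R ∪ cheapest c a) / β)) ≤
      β * Real.log (1 + ρ / β) - β * ρ / (β + ρ) + β / (β + ρ) * E := by
    refine (PMF.expect_mono _ hlog).trans_eq ?_
    rw [PMF.expect_add, PMF.expect_const, PMF.expect_const_mul]
  have he1 : Real.exp (-1) * Real.exp 1 = 1 := by rw [← Real.exp_add]; simp
  have he2 : 2 ≤ Real.exp 1 := by
    have := Real.add_one_le_exp (1 : ℝ)
    linarith
  have he3 : 0 < Real.exp (-1) := Real.exp_pos _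
  have he4 : 0 ≤ 1 - Real.exp (-1) := by nlinarith
  -- If `β ≤ ρ`, the slope is at least `β / (2ρ)` and the sample bound suffices. If `ρ ≤ β`, the
  -- slope is at least `1/2`, and the departure of the row suffices because `W ≤ ρ`.
  have hdrop : (1 - Real.exp (-1)) * (kappa c a * W / ρ) ≤ 2 * (β / (β + ρ) * (ρ - E)) := by
    rcases le_total β ρ with h | h
    · have h1 : (1 - Real.exp (-1)) * (kappa c a / β) * W ≤ ρ - E := by linarith
      have h2 : 1 / (2 * ρ) ≤ 1 / (β + ρ) := one_div_le_one_div_of_le hden (by linarith)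
      calc (1 - Real.exp (-1)) * (kappa c a * W / ρ)
          = 2 * (β * (1 / (2 * ρ)) * ((1 - Real.exp (-1)) * (kappa c a / β) * W)) := by
            field_simp
        _ ≤ 2 * (β * (1 / (β + ρ)) * (ρ - E)) := by
            have h3 : 0 ≤ (1 - Real.exp (-1)) * (kappa c a / β) * W := by positivity
            gcongr
        _ = _ := by ring
    · have h1 : kappa c a ≤ ρ - E := by linarith
      have h2 : 1 / 2 ≤ β / (β + ρ) := by
        rw [div_le_div_iff₀ two_pos hden]
        linarith
      have h3 : kappa c a * W / ρ ≤ kappa c a := by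
        rw [div_le_iff₀ hρpos]
        exact mul_le_mul_of_nonneg_left hWρ hκ.le
      have h4 : 0 ≤ kappa c a * W / ρ := by positivity
      calc (1 - Real.exp (-1)) * (kappa c a * W / ρ) ≤ 1 * kappa c a := by
            gcongr
            linarith
        _ = 2 * (1 / 2 * kappa c a) := by ring
        _ ≤ _ := by gcongr
  have hdiv := divergence_updateWeights_le hc hβ hy hx ha
  have hEpot : μ.expect (fun R => potential c β y r' ⟨updateWeights c β x a,
      B ∪ R ∪ cheapest c a⟩) = β + divergence c y (updateWeights c β x a) + 2 * Real.exp 1 *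
        μ.expect (fun R => β * Real.log (1 + residual c r' (B ∪ R ∪ cheapest c a) / β)) := by
    simp only [potential]
    rw [PMF.expect_add, PMF.expect_const, PMF.expect_const_mul]
  rw [hEpot, potential]
  have h7 : 2 * Real.exp 1 *
      μ.expect (fun R => β * Real.log (1 + residual c r' (B ∪ R ∪ cheapest c a) / β)) ≤
      2 * Real.exp 1 * (β * Real.log (1 + ρ / β) - β * ρ / (β + ρ) + β / (β + ρ) * E) := by
    gcongr
  -- Since `e (1 - 1/e) = e - 1`, the fall of the logarithmic term gets the same factor as the rise
  -- of the divergence.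
  have h8 : Real.exp 1 * ((1 - Real.exp (-1)) * (kappa c a * W / ρ)) ≤
      Real.exp 1 * (2 * (β / (β + ρ) * (ρ - E))) := by gcongr
  have h9 : Real.exp 1 * ((1 - Real.exp (-1)) * (kappa c a * W / ρ)) =
      (Real.exp 1 - 1) * (kappa c a * W / ρ) := by
    linear_combination -(kappa c a * W / ρ) * he1
  have h10 : β / (β + ρ) * (ρ - E) = β * ρ / (β + ρ) - β / (β + ρ) * E := by ring
  rw [h10] at h8
  nlinarith

/-- The potential of a covered arrival does not change. -/
lemma potential_of_covered {s : State m}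
    (hr' : ∀ F : Finset (Fin m) → ℝ, ∑ i, F (r' i) + F a = ∑ j, F (r j))
    (hcov : ∃ S ∈ s.bought, S ∈ a) : potential c β y r' s = potential c β y r s := by
  have h := hr' fun b => if ∃ S ∈ s.bought, S ∈ b then 0 else kappa c b
  rw [if_pos hcov, add_zero] at h
  rw [potential, potential, residual, h, residual]

/-- The rows that remain after the arrival of the row with index `p`. -/
def dropRow (r : Fin (n + 1) → Finset (Fin m)) (p : Fin (n + 1)) : Fin n → Finset (Fin m) :=
  fun i => r (Equiv.swap 0 p i.succ)

/-- The form with a swap is that of `Equiv.Perm.decomposeFin`, so it fits the peeling of the first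
arrival off a permutation. The identity is stated for arbitrary `F` because it is all that the
potential argument needs to know about the remaining rows. -/
lemma sum_dropRow (r : Fin (n + 1) → Finset (Fin m)) (p : Fin (n + 1))
    (F : Finset (Fin m) → ℝ) : ∑ i, F (dropRow r p i) + F (r p) = ∑ j, F (r j) := by
  rw [← Equiv.sum_comp (Equiv.swap 0 p) fun j => F (r j), Fin.sum_univ_succ, Equiv.swap_apply_left,
    add_comm]
  rfl

lemma range_dropRow_subset (r : Fin (n + 1) → Finset (Fin m)) (p : Fin (n + 1)) :
    Set.range (dropRow r p) ⊆ Set.range r := by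
  rintro _ ⟨i, rfl⟩
  exact ⟨_, rfl⟩

lemma IsBudgetCover.mono {A A' : Set (Finset (Fin m))} (hy : IsBudgetCover c β A y) (h : A' ⊆ A) :
    IsBudgetCover c β A' y :=
  ⟨hy.nonneg, hy.support, hy.cost_le, fun a ha => hy.covers a (h ha)⟩

/-- The potential pays for the rounds when the next row is uniformly random. -/
lemma sum_stepExpect_potential_le (hc : ∀ S, 0 < c S) (hβ : 0 < β)
    (hy : IsBudgetCover c β (Set.range r) y) {s : State m} (hs : IsBalanced c β s.x) :
    ∑ p, ((if ∃ S ∈ s.bought, S ∈ r p then 0 else kappa c (r p)) +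
        stepExpect c β s (r p) (potential c β y (dropRow r p))) ≤
      (n + 1) * potential c β y r s := by
  have hr : ∀ j, (r j).Nonempty := fun j => hy.nonempty ⟨j, rfl⟩
  set κ : Fin (n + 1) → ℝ := fun j => if ∃ S ∈ s.bought, S ∈ r j then 0 else kappa c (r j) with hκ
  have hterm : ∀ p, κ p + stepExpect c β s (r p) (potential c β y (dropRow r p)) ≤
      potential c β y r s + (Real.exp 1 - 1) * (κ p * min (∑ S ∈ r p, s.x S) 1 -
        κ p * learned c s.x r s.bought / residual c r s.bought) := by
    intro p
    rw [stepExpect]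
    by_cases h : ∃ S ∈ s.bought, S ∈ r p
    · rw [if_pos h, potential_of_covered (sum_dropRow r p) h]
      simp [hκ, h]
    · rw [if_neg h]
      simp only [hκ, if_neg h]
      rw [add_comm]
      exact expect_potential_le hc hβ hy hs ⟨p, rfl⟩ (sum_dropRow r p)
        (fun i => hr _) h
  refine (Finset.sum_le_sum fun p _ => hterm p).trans ?_
  have h1 : ∑ p, κ p * min (∑ S ∈ r p, s.x S) 1 = learned c s.x r s.bought := rfl
  have h2 : ∑ p, κ p = residual c r s.bought := rfl
  rw [Finset.sum_add_distrib, Finset.sum_const, ← Finset.mul_sum, Finset.sum_sub_distrib, h1,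
    ← Finset.sum_div, ← Finset.sum_mul, h2]
  have hW0 : 0 ≤ learned c s.x r s.bought := Finset.sum_nonneg fun j _ =>
    mul_nonneg (uncovered_weight_nonneg hc (hr j) _)
      (le_min (Finset.sum_nonneg fun S _ => hs.nonneg S) zero_le_one)
  -- The averaging argument: summed over the next row, the learning loss is `learned`, and so is the
  -- covering gain. If the residual is `0`, the quotient is `0` by convention and `learned` vanishes
  -- too.
  have h3 : learned c s.x r s.bought -
      residual c r s.bought * learned c s.x r s.bought / residual c r s.bought = 0 := by
    rcases eq_or_ne (residual c r s.bought) 0 with h | h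
    · have := learned_le_residual (x := s.x) hc hr s.bought
      rw [h]
      simp
      linarith
    · field_simp
      ring
  rw [h3]
  simp

end potential

end LearnOrCover

/-! ### Sums over all orders -/

section orders

variable {m n : ℕ}

open LearnOrCover in
-- In a uniformly random order the first row is uniform, and given it, the others are in uniformly
-- random order. Working with sums over permutations avoids conditional laws.
lemma sum_perm_eq_sum_first {M : Type*} [AddCommMonoid M] (r : Fin (n + 1) → Finset (Fin m))
    (F : List (Finset (Fin m)) → M) :
    ∑ σ : Equiv.Perm (Fin (n + 1)), F (List.ofFn (r ∘ σ)) =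
      ∑ p, ∑ σ : Equiv.Perm (Fin n), F (r p :: List.ofFn (dropRow r p ∘ σ)) := by
  rw [← Equiv.sum_comp Equiv.Perm.decomposeFin.symm, Fintype.sum_prod_type]
  refine Finset.sum_congr rfl fun p _ => Finset.sum_congr rfl fun σ _ => ?_
  rw [List.ofFn_succ]
  simp only [Function.comp, Equiv.Perm.decomposeFin_symm_apply_zero,
    Equiv.Perm.decomposeFin_symm_apply_succ]
  rfl

lemma ofFn_comp_rev {α : Type*} (f : Fin n → α) :
    List.ofFn (fun i => f i.rev) = (List.ofFn f).reverse := by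
  refine List.ext_getElem (by simp) fun i h1 h2 => ?_
  simp only [List.getElem_ofFn, List.getElem_reverse, List.length_ofFn]
  congr 1
  ext
  simp [Fin.val_rev]
  omega

lemma sum_perm_reverse {M : Type*} [AddCommMonoid M] (r : Fin n → Finset (Fin m))
    (F : List (Finset (Fin m)) → M) :
    ∑ σ : Equiv.Perm (Fin n), F (List.ofFn (r ∘ σ)).reverse =
      ∑ σ : Equiv.Perm (Fin n), F (List.ofFn (r ∘ σ)) := by
  rw [← Equiv.sum_comp (Equiv.mulRight (Fin.revPerm : Equiv.Perm (Fin n)))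
    fun σ => F (List.ofFn (r ∘ σ))]
  refine Finset.sum_congr rfl fun σ _ => ?_
  rw [← ofFn_comp_rev]
  rfl

open LearnOrCover in
-- Reversal is a bijection of the orders, so the decomposition by the first row yields the one by
-- the last. It allows a last arrival to be deleted without spoiling the uniformity of the rest.
lemma sum_perm_eq_sum_last {M : Type*} [AddCommMonoid M] (r : Fin (n + 1) → Finset (Fin m))
    (F : List (Finset (Fin m)) → M) :
    ∑ σ : Equiv.Perm (Fin (n + 1)), F (List.ofFn (r ∘ σ)) =
      ∑ p, ∑ σ : Equiv.Perm (Fin n), F (List.ofFn (dropRow r p ∘ σ) ++ [r p]) := by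
  rw [← sum_perm_reverse, sum_perm_eq_sum_first r fun l => F l.reverse]
  refine Finset.sum_congr rfl fun p _ => ?_
  simp only [List.reverse_cons]
  exact sum_perm_reverse (dropRow r p) fun l => F (l ++ [r p])

end orders

namespace LearnOrCover

variable {m n : ℕ}

/-! ### The expectation over one round as a monotone linear functional -/

section stepExpect

variable {c : Fin m → ℝ} {β : ℝ} {s : State m} {a : Finset (Fin m)}

/-- The new vector does not depend on the coins, so invariants of the vector are available when the
integrands are compared. -/
lemma stepExpect_mono {F F' : State m → ℝ}
    (h : ∀ s' : State m, (s'.x = s.x ∨ s'.x = updateWeights c β s.x a) → F s' ≤ F' s') :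
    stepExpect c β s a F ≤ stepExpect c β s a F' := by
  unfold stepExpect
  split_ifs
  · exact h s (Or.inl rfl)
  · exact PMF.expect_mono _ fun R => h _ (Or.inr rfl)

lemma stepExpect_const (r : ℝ) : stepExpect c β s a (fun _ => r) = r := by
  unfold stepExpect
  split_ifs
  · rfl
  · exact PMF.expect_const _ r

lemma stepExpect_add (F F' : State m → ℝ) :
    stepExpect c β s a (fun s' => F s' + F' s') = stepExpect c β s a F + stepExpect c β s a F' := by
  unfold stepExpect
  split_ifs
  · rfl
  · exact PMF.expect_add _ _ _

lemma stepExpect_const_mul (r : ℝ) (F : State m → ℝ) :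
    stepExpect c β s a (fun s' => r * F s') = r * stepExpect c β s a F := by
  unfold stepExpect
  split_ifs
  · rfl
  · exact PMF.expect_const_mul _ _ _

lemma stepExpect_sum {ι : Type*} (t : Finset ι) (F : ι → State m → ℝ) :
    stepExpect c β s a (fun s' => ∑ i ∈ t, F i s') = ∑ i ∈ t, stepExpect c β s a (F i) := by
  unfold stepExpect
  split_ifs
  · rfl
  · exact PMF.expect_sum _ _ _

end stepExpect

/-! ### Charging the cost to the guesses -/

variable (g : GuessRule) (c : Fin m → ℝ)

/-- The state at the arrival of `a` after the arrivals `h`, restarted if the guess changes. -/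
noncomputable def restarted (h : List (Finset (Fin m))) (s : State m) (a : Finset (Fin m)) :
    State m :=
  open Classical in
  ⟨if h ≠ [] ∧ g m c (h ++ [a]) = g m c h then s.x else initWeights c (g m c (h ++ [a])), s.bought⟩

/-- Twice the expected total of the cheapest costs of the uncovered arrivals, each weighted by a
function of the current guess. -/
noncomputable def charge (φ : ℝ → ℝ) :
    List (Finset (Fin m)) → List (Finset (Fin m)) → State m → ℝ
  | _, [], _ => 0
  | h, a :: rows, s =>
      φ (g m c (h ++ [a])) * (2 * if ∃ S ∈ s.bought, S ∈ a then 0 else kappa c a) +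
        stepExpect c (g m c (h ++ [a])) (restarted g c h s a) a (charge φ (h ++ [a]) rows)

/-- The number of restarts with guess `γ`. -/
noncomputable def starts (γ : ℝ) : List (Finset (Fin m)) → List (Finset (Fin m)) → ℝ
  | _, [] => 0
  | h, a :: rows =>
      (open Classical in
        if g m c (h ++ [a]) = γ ∧ ¬ (h ≠ [] ∧ g m c (h ++ [a]) = g m c h) then 1 else 0) +
        starts γ (h ++ [a]) rows

noncomputable def indicatorAt (γ : ℝ) : ℝ → ℝ :=
  open Classical in fun r => if r = γ then 1 else 0

/-- An upper bound for the charge of a phase with guess `γ` and at most `N` arrivals. -/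
noncomputable def phaseBound (m : ℕ) (γ : ℝ) (N : ℕ) : ℝ :=
  γ * (6 + 2 * Real.log m + 4 * Real.exp 1 * Real.log (1 + N))

variable {g c}

lemma starts_nonneg (γ : ℝ) (rows h : List (Finset (Fin m))) : 0 ≤ starts g c γ h rows := by
  induction rows generalizing h with
  | nil => exact le_rfl
  | cons a rows ih =>
    rw [starts]
    refine add_nonneg ?_ (ih _)
    split_ifs <;> norm_num

/-- Every row has a set of cost at most `γ`, so the residual is at most `n γ`. The separate bound
`N` stays fixed while rows are used up in the inductions. -/
lemma potential_le {γ : ℝ} {y : Fin m → ℝ} {N : ℕ} (hc : ∀ S, 0 < c S) (hγ : 0 < γ)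
    {r : Fin n → Finset (Fin m)} (hy : IsBudgetCover c γ (Set.range r) y) (hn : n ≤ N)
    {s : State m} {D : ℝ} (hD : divergence c y s.x ≤ D) :
    potential c γ y r s ≤ γ + D + 2 * Real.exp 1 * (γ * Real.log (1 + N)) := by
  have h0 := residual_nonneg hc (fun j => hy.nonempty ⟨j, rfl⟩) s.bought
  have h1 : residual c r s.bought ≤ n * γ := residual_le hγ (fun j => hy.kappa_le ⟨j, rfl⟩) _
  have h2 : Real.log (1 + residual c r s.bought / γ) ≤ Real.log (1 + N) := by
    refine Real.log_le_log (by positivity) ?_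
    have h3 : residual c r s.bought / γ ≤ n := by rwa [div_le_iff₀ hγ]
    have h4 : (n : ℝ) ≤ N := by exact_mod_cast hn
    linarith
  have h5 : 2 * Real.exp 1 * (γ * Real.log (1 + residual c r s.bought / γ)) ≤
      2 * Real.exp 1 * (γ * Real.log (1 + N)) := by gcongr
  unfold potential
  linarith

/-- The first round after a restart and all that follow are paid for by `phaseBound`. -/
lemma first_round_le {γ : ℝ} {y : Fin m → ℝ} {N : ℕ} (hc : ∀ S, 0 < c S) (hγ : 0 < γ) (hm : 0 < m)
    {r : Fin n → Finset (Fin m)} {A : Set (Finset (Fin m))} {a : Finset (Fin m)}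
    (hy : IsBudgetCover c γ A y) (hr : Set.range r ⊆ A) (ha : a ∈ A) (hn : n ≤ N)
    (B : Finset (Fin m)) :
    2 * (if ∃ S ∈ B, S ∈ a then 0 else kappa c a) +
      stepExpect c γ ⟨initWeights c γ, B⟩ a (fun s' => 2 * potential c γ y r s') ≤
        phaseBound m γ N := by
  obtain ⟨S₀, -, hS₀⟩ := hy.exists_cheap ha
  have hinit := divergence_initWeights_le hc hγ hm hy
  have hup := divergence_updateWeights_le hc hγ hy (isBalanced_initWeights hc hγ ⟨S₀, hS₀⟩) ha
  have hκ := kappa_pos hc (hy.nonempty ha)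
  have hκγ := hy.kappa_le ha
  have he : Real.exp 1 ≤ 3 := Real.exp_one_lt_three.le
  have he2 : 2 ≤ Real.exp 1 := by
    have := Real.add_one_le_exp (1 : ℝ)
    linarith
  have hmin : min (∑ S ∈ a, initWeights c γ S) 1 ≤ 1 := min_le_right _ _
  -- The row that triggers the restart is not uniform, so nothing is gained on average here. In the
  -- worst case the update raises the divergence by `(e - 2) κ ≤ κ ≤ γ`; this and the cost `2γ` of
  -- the round explain the constant `6` in `phaseBound`.
  have hup' : divergence c y (updateWeights c γ (initWeights c γ) a) ≤ γ * Real.log m + γ := by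
    have h1 : (Real.exp 1 - 1) * min (∑ S ∈ a, initWeights c γ S) 1 - 1 ≤ 1 := by nlinarith
    have h2 := mul_le_mul_of_nonneg_left h1 hκ.le
    linarith
  have hall : stepExpect c γ ⟨initWeights c γ, B⟩ a (fun s' => 2 * potential c γ y r s') ≤
      2 * (γ + (γ * Real.log m + γ) + 2 * Real.exp 1 * (γ * Real.log (1 + N))) := by
    rw [stepExpect_const_mul, ← stepExpect_const (c := c) (β := γ) (s := ⟨initWeights c γ, B⟩)
      (a := a) (γ + (γ * Real.log m + γ) + 2 * Real.exp 1 * (γ * Real.log (1 + N)))]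
    refine mul_le_mul_of_nonneg_left (stepExpect_mono fun s' hs' => ?_) two_pos.le
    refine potential_le hc hγ (hy.mono hr) hn ?_
    rcases hs' with h | h <;> rw [h]
    · exact hinit.trans (by linarith)
    · exact hup'
  have hcost : (if ∃ S ∈ B, S ∈ a then 0 else kappa c a) ≤ γ := by
    split_ifs
    exacts [hγ.le, hκγ]
  unfold phaseBound
  linarith

/-- A phase with guess `γ` costs little if all rows have a cover within the budget `γ`. -/
lemma sum_charge_le_of_isBudgetCover {γ : ℝ} {y : Fin m → ℝ} {N : ℕ} (hc : ∀ S, 0 < c S)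
    (hγ : 0 < γ) (hm : 0 < m) (r : Fin n → Finset (Fin m))
    (hy : IsBudgetCover c γ (Set.range r) y) (hn : n ≤ N) (h : List (Finset (Fin m)))
    (s : State m) (hs : h ≠ [] ∧ g m c h = γ → IsBalanced c γ s.x) :
    ∑ σ : Equiv.Perm (Fin n), charge g c (indicatorAt γ) h (List.ofFn (r ∘ σ)) s ≤
      (open Classical in
        if h ≠ [] ∧ g m c h = γ then (n.factorial : ℝ) * (2 * potential c γ y r s) else 0) +
      phaseBound m γ N * ∑ σ : Equiv.Perm (Fin n), starts g c γ h (List.ofFn (r ∘ σ)) := by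
  classical
  induction n generalizing h s with
  | zero =>
    have h0 : 0 ≤ (if h ≠ [] ∧ g m c h = γ then
        ((0 : ℕ).factorial : ℝ) * (2 * potential c γ y r s) else 0) := by
      split_ifs with hact
      · have := potential_nonneg hc hγ hy (hs hact)
        positivity
      · exact le_rfl
    simpa [charge, starts] using h0
  | succ n ih =>
    rw [sum_perm_eq_sum_first r fun l => charge g c (indicatorAt γ) h l s,
      sum_perm_eq_sum_first r fun l => starts g c γ h l]
    have hcov : ∀ p, IsBudgetCover c γ (Set.range (dropRow r p)) y := fun p =>
      hy.mono (range_dropRow_subset r p)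
    have hbal : ∀ p, g m c (h ++ [r p]) = γ → IsBalanced c γ (restarted g c h s (r p)).x := by
      intro p hp
      simp only [restarted]
      split_ifs with hcont
      · exact hs ⟨hcont.1, hcont.2 ▸ hp⟩
      · obtain ⟨S₀, -, hS₀⟩ := hy.exists_cheap ⟨p, rfl⟩
        rw [hp]
        exact isBalanced_initWeights hc hγ ⟨S₀, hS₀⟩
    -- Condition on the next row `p` and apply the induction hypothesis to the rest. Whether `p`
    -- belongs to the phase depends on the arrivals only, so it is constant over the coins.
    have hp : ∀ p, ∑ σ : Equiv.Perm (Fin n), charge g c (indicatorAt γ) h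
          (r p :: List.ofFn (dropRow r p ∘ σ)) s ≤
        (if g m c (h ++ [r p]) = γ then (n.factorial : ℝ) *
          (2 * (if ∃ S ∈ s.bought, S ∈ r p then 0 else kappa c (r p)) +
            stepExpect c γ (restarted g c h s (r p)) (r p)
              (fun s' => 2 * potential c γ y (dropRow r p) s')) else 0) +
        phaseBound m γ N * ∑ σ : Equiv.Perm (Fin n),
          starts g c γ (h ++ [r p]) (List.ofFn (dropRow r p ∘ σ)) := by
      intro p
      simp only [charge]
      rw [Finset.sum_add_distrib, ← stepExpect_sum]
      have hmono : stepExpect c (g m c (h ++ [r p])) (restarted g c h s (r p)) (r p)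
          (fun s' => ∑ σ : Equiv.Perm (Fin n), charge g c (indicatorAt γ) (h ++ [r p])
            (List.ofFn (dropRow r p ∘ σ)) s') ≤
          stepExpect c (g m c (h ++ [r p])) (restarted g c h s (r p)) (r p)
          (fun s' => (if g m c (h ++ [r p]) = γ then
              (n.factorial : ℝ) * (2 * potential c γ y (dropRow r p) s') else 0) +
            phaseBound m γ N * ∑ σ : Equiv.Perm (Fin n),
              starts g c γ (h ++ [r p]) (List.ofFn (dropRow r p ∘ σ))) := by
        refine stepExpect_mono fun s' hs' => ?_
        have := ih (dropRow r p) (hcov p) (by omega) (h ++ [r p]) s' (fun hact => by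
          have hb := hbal p hact.2
          rcases hs' with hs' | hs' <;> rw [hs']
          · exact hb
          · rw [hact.2]
            exact hb.updateWeights hc hγ (hy.nonempty ⟨p, rfl⟩))
        simpa using this
      refine (add_le_add_right hmono _).trans ?_
      rw [stepExpect_add, stepExpect_const]
      by_cases hg : g m c (h ++ [r p]) = γ
      · simp only [hg, if_true, indicatorAt, Finset.sum_const, stepExpect_const_mul, mul_add,
          Finset.card_univ, Fintype.card_perm, Fintype.card_fin, nsmul_eq_mul]
        linarith
      · simp [hg, indicatorAt, stepExpect_const]
    refine (Finset.sum_le_sum fun p _ => hp p).trans ?_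
    rw [Finset.sum_add_distrib, Finset.mul_sum]
    by_cases hact : h ≠ [] ∧ g m c h = γ
    · rw [if_pos hact]
      refine add_le_add ?_ (Finset.sum_le_sum fun p _ => ?_)
      · have hb := hs hact
        have key := sum_stepExpect_potential_le hc hγ hy hb
        have hfac : (0 : ℝ) ≤ 2 * (n.factorial : ℝ) := by positivity
        have := mul_le_mul_of_nonneg_left key hfac
        rw [Nat.factorial_succ]
        push_cast
        refine le_trans ?_ (this.trans_eq (by ring))
        rw [Finset.mul_sum]
        refine Finset.sum_le_sum fun p _ => ?_
        by_cases hg : g m c (h ++ [r p]) = γ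
        · rw [if_pos hg]
          have hre : restarted g c h s (r p) = s := by
            rw [restarted, if_pos ⟨hact.1, hg.trans hact.2.symm⟩]
          rw [hre, stepExpect_const_mul]
          linarith
        -- Rows whose arrival would end the phase contribute nothing to the charge but a nonnegative
        -- term to the average. Including them makes the next row uniform over all remaining rows.
        · rw [if_neg hg]
          refine mul_nonneg hfac (add_nonneg ?_ ?_)
          · exact uncovered_weight_nonneg hc (hy.nonempty ⟨p, rfl⟩) _
          · rw [← stepExpect_const (c := c) (β := γ) (s := s) (a := r p) 0]
            refine stepExpect_mono fun s' hs' => potential_nonneg hc hγ (hcov p) ?_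
            rcases hs' with hs' | hs' <;> rw [hs']
            · exact hb
            · exact hb.updateWeights hc hγ (hy.nonempty ⟨p, rfl⟩)
      · refine mul_le_mul_of_nonneg_left (Finset.sum_le_sum fun σ _ => ?_) ?_
        · rw [starts]
          refine le_add_of_nonneg_left ?_
          split_ifs <;> norm_num
        · unfold phaseBound
          have := Real.log_natCast_nonneg m
          have : 0 ≤ Real.log (1 + N) := Real.log_nonneg (by simp)
          positivity
    -- Outside the phase no potential is at hand. If `p` starts a phase, the summand that it adds to
    -- `starts` pays for its first round and for the potential created by it.
    · rw [if_neg hact, zero_add, ← Finset.sum_add_distrib]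
      refine Finset.sum_le_sum fun p _ => ?_
      simp only [starts]
      rw [Finset.sum_add_distrib, mul_add (phaseBound m γ N)]
      refine add_le_add_left ?_ _
      by_cases hg : g m c (h ++ [r p]) = γ
      · have hno : ¬ (h ≠ [] ∧ g m c (h ++ [r p]) = g m c h) := fun hh =>
          hact ⟨hh.1, hh.2 ▸ hg⟩
        have hboth : g m c (h ++ [r p]) = γ ∧ ¬ (h ≠ [] ∧ g m c (h ++ [r p]) = g m c h) := ⟨hg, hno⟩
        rw [if_pos hg, if_pos hboth, Finset.sum_const, Finset.card_univ, Fintype.card_perm,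
          Fintype.card_fin, nsmul_eq_mul, mul_one, mul_comm (phaseBound m γ N)]
        refine mul_le_mul_of_nonneg_left ?_ (Nat.cast_nonneg _)
        rw [restarted, if_neg hno, hg]
        exact first_round_le hc hγ hm hy (range_dropRow_subset r p) ⟨p, rfl⟩ (by omega) _
      · rw [if_neg hg, if_neg (fun hh => hg hh.1)]
        simp

lemma charge_append_singleton {γ : ℝ} (l h : List (Finset (Fin m))) (a : Finset (Fin m))
    (s : State m) (hg : g m c (h ++ l ++ [a]) ≠ γ) :
    charge g c (indicatorAt γ) h (l ++ [a]) s = charge g c (indicatorAt γ) h l s := by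
  induction l generalizing h s with
  | nil =>
    rw [List.append_nil] at hg
    simp only [List.nil_append, charge, indicatorAt, if_neg hg, zero_mul, zero_add]
    exact stepExpect_const 0
  | cons b l ih =>
    simp only [List.cons_append, charge]
    congr 2
    funext s'
    exact ih (h ++ [b]) s' (by simpa using hg)

lemma starts_append_singleton {γ : ℝ} (l h : List (Finset (Fin m))) (a : Finset (Fin m))
    (hg : g m c (h ++ l ++ [a]) ≠ γ) :
    starts g c γ h (l ++ [a]) = starts g c γ h l := by
  induction l generalizing h with
  | nil =>
    rw [List.append_nil] at hg
    simp [starts, hg]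
  | cons b l ih =>
    simp only [List.cons_append, starts]
    congr 1
    exact ih (h ++ [b]) (by simpa using hg)

/-- A phase with guess `γ` costs little if the guess is `γ` only while the rows that have arrived
have a cover within the budget `γ`. -/
lemma sum_charge_le {γ : ℝ} {N : ℕ} (hc : ∀ S, 0 < c S) (hγ : 0 < γ) (hm : 0 < m)
    (hg : ∀ l : List (Finset (Fin m)), (∀ a ∈ l, a.Nonempty) → g m c l = γ →
      ∃ y, IsBudgetCover c γ {a | a ∈ l} y)
    (r : Fin n → Finset (Fin m)) (hr : ∀ j, (r j).Nonempty) (hn : n ≤ N) (s : State m) :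
    ∑ σ : Equiv.Perm (Fin n), charge g c (indicatorAt γ) [] (List.ofFn (r ∘ σ)) s ≤
      phaseBound m γ N * ∑ σ : Equiv.Perm (Fin n), starts g c γ [] (List.ofFn (r ∘ σ)) := by
  induction n with
  | zero => simp [charge, starts]
  | succ n ih =>
    by_cases hy : ∃ y, IsBudgetCover c γ (Set.range r) y
    · obtain ⟨y, hy⟩ := hy
      simpa using sum_charge_le_of_isBudgetCover (g := g) hc hγ hm r hy hn [] s (by simp)
    -- If the rows together have no cover within the budget `γ`, the guess after the last arrival is
    -- not `γ` in any order. The last row then affects neither the charge nor the starts, and the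
    -- induction hypothesis applies to the others.
    · rw [sum_perm_eq_sum_last r fun l => charge g c (indicatorAt γ) [] l s,
        sum_perm_eq_sum_last r fun l => starts g c γ [] l, Finset.mul_sum]
      refine Finset.sum_le_sum fun p _ => ?_
      have hne : ∀ σ : Equiv.Perm (Fin n), g m c ([] ++ List.ofFn (dropRow r p ∘ σ) ++ [r p]) ≠ γ := by
        intro σ hσ
        obtain ⟨y, hy'⟩ := hg _ (by
          intro a ha
          simp only [List.nil_append, List.mem_append, List.mem_ofFn, List.mem_singleton] at ha
          rcases ha with ⟨i, rfl⟩ | rfl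
          · exact hr _
          · exact hr _) hσ
        refine hy ⟨y, hy'.mono ?_⟩
        rintro _ ⟨j, rfl⟩
        simp only [List.nil_append, Set.mem_ofPred_eq, List.mem_append, List.mem_ofFn,
          List.mem_singleton]
        by_cases hj : Equiv.swap 0 p j = 0
        · right
          rw [← Equiv.swap_apply_self 0 p j, hj, Equiv.swap_apply_left]
        · left
          obtain ⟨i, hi⟩ := Fin.exists_succ_eq.2 hj
          refine ⟨σ.symm i, ?_⟩
          simp only [Function.comp, Equiv.apply_symm_apply, dropRow]
          rw [hi, Equiv.swap_apply_self]
      simp only [charge_append_singleton _ _ _ _ (hne _), starts_append_singleton _ _ _ (hne _)]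
      exact ih _ (fun i => hr _) (by omega)

end LearnOrCover

namespace LearnOrCover

variable {m n : ℕ}

/-! ### The cost of guess-and-double -/

/-- The law of the collection bought, after the arrivals `h`, from a given state. -/
noncomputable def boughtLaw (g : GuessRule) (c : Fin m → ℝ) (h rows : List (Finset (Fin m)))
    (s : State m) : PMF (Finset (Fin m)) :=
  (doublingRunFrom g c h rows s).map State.bought

section cost

variable {g : GuessRule} {c : Fin m → ℝ}

lemma expect_boughtLaw_cons (h rows : List (Finset (Fin m))) (a : Finset (Fin m)) (s : State m)
    (f : Finset (Fin m) → ℝ) :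
    (boughtLaw g c h (a :: rows) s).expect f =
      stepExpect c (g m c (h ++ [a])) (restarted g c h s a) a
        fun s' => (boughtLaw g c (h ++ [a]) rows s').expect f := by
  have h1 : boughtLaw g c h (a :: rows) s =
      (step c (g m c (h ++ [a])) (restarted g c h s a) a).bind
        (boughtLaw g c (h ++ [a]) rows) := by
    rw [boughtLaw, doublingRunFrom, PMF.map_bind]
    rfl
  rw [h1, step, stepExpect]
  by_cases hcov : ∃ S ∈ (restarted g c h s a).bought, S ∈ a
  · rw [if_pos hcov, if_pos hcov, PMF.pure_bind]
  · rw [if_neg hcov, if_neg hcov, PMF.bind_map, PMF.expect_bind]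
    rfl

/-- `x` is nonnegative and costs at most `β`. -/
def IsWithinBudget (c : Fin m → ℝ) (β : ℝ) (x : Fin m → ℝ) : Prop :=
  (∀ S, 0 ≤ x S) ∧ ∑ S, c S * x S ≤ β

/-- Unlike being balanced, this also holds if no set is affordable, when the initial vector is zero.
Thus charging costs to `kappa` needs no assumption that the guess is large enough. -/
lemma isWithinBudget_initWeights {β : ℝ} (hc : ∀ S, 0 < c S) (hβ : 0 < β) :
    IsWithinBudget c β (initWeights c β) := by
  by_cases h : ∃ S, c S ≤ β
  · have := isBalanced_initWeights hc hβ h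
    exact ⟨this.nonneg, this.cost_eq.le⟩
  · have h0 : ∀ S, initWeights c β S = 0 := fun S => if_neg fun hS => h ⟨S, hS⟩
    exact ⟨fun S => (h0 S).ge, by simp [h0, hβ.le]⟩

lemma IsWithinBudget.updateWeights {β : ℝ} (hc : ∀ S, 0 < c S) (hβ : 0 < β) {x : Fin m → ℝ}
    (hx : IsWithinBudget c β x) (a : Finset (Fin m)) :
    IsWithinBudget c β (updateWeights c β x a) := by
  rw [LearnOrCover.updateWeights]
  split_ifs
  swap
  · exact hx
  have h0 : ∀ S, 0 ≤ scaleUp c x a S := fun S => mul_nonneg (hx.1 S) (Real.exp_pos _).le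
  have hsum : 0 ≤ ∑ T, c T * scaleUp c x a T :=
    Finset.sum_nonneg fun S _ => mul_nonneg (hc S).le (h0 S)
  refine ⟨fun S => div_nonneg (h0 S) (div_nonneg hsum hβ.le), ?_⟩
  simp only [normalize, ← mul_div_assoc, ← Finset.sum_div]
  -- If the weighted sum is `0`, division by zero makes the normalized vector zero, which is within
  -- the budget.
  rcases hsum.eq_or_lt with h | h
  · rw [← h]
    simpa using hβ.le
  · refine le_of_eq ?_
    field_simp

/-- The expected cost of the sets sampled in one round. -/
lemma expect_sample_cost_le {β κ : ℝ} (hc : ∀ S, 0 < c S) (hβ : 0 < β) (hκ : 0 ≤ κ)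
    {x : Fin m → ℝ} (hx : IsWithinBudget c β x) :
    (sampleSets fun S => min (κ * x S / β) 1).expect (fun R => ∑ S ∈ R, c S) ≤ κ := by
  calc _ ≤ ∑ S, max 0 (min (min (κ * x S / β) 1) 1) * c S := expect_sampleSets_cost_le _ _ hc
    _ ≤ ∑ S, κ / β * (c S * x S) := Finset.sum_le_sum fun S _ => by
        have h0 : 0 ≤ κ * x S / β := div_nonneg (mul_nonneg hκ (hx.1 S)) hβ.le
        have h1 : max 0 (min (min (κ * x S / β) 1) 1) ≤ κ * x S / β :=
          max_le h0 ((min_le_left _ _).trans (min_le_left _ _))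
        calc _ ≤ κ * x S / β * c S := mul_le_mul_of_nonneg_right h1 (hc S).le
          _ = _ := by ring
    _ = κ / β * ∑ S, c S * x S := by rw [Finset.mul_sum]
    _ ≤ κ / β * β := mul_le_mul_of_nonneg_left hx.2 (div_nonneg hκ hβ.le)
    _ = κ := by field_simp

/-- The factor `2` in `charge`: an uncovered arrival pays `kappa` for its cheapest set and, as the
vector is within the budget, at most `kappa` in expectation for the sample. Of the doubling property
only the positivity of the guesses matters here. -/
lemma expect_cost_le_charge (hd : g.IsDoubling) (hc : ∀ S, 0 < c S)
    (rows h : List (Finset (Fin m))) (hrows : ∀ b ∈ h ++ rows, b.Nonempty) (s : State m)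
    (hs : h ≠ [] → IsWithinBudget c (g m c h) s.x) :
    (boughtLaw g c h rows s).expect (fun C => ∑ S ∈ C, c S) ≤
      ∑ S ∈ s.bought, c S + charge g c (fun _ => 1) h rows s := by
  induction rows generalizing h s with
  | nil =>
    rw [boughtLaw, doublingRunFrom, PMF.pure_map, PMF.expect_pure, charge, add_zero]
  | cons a rows ih =>
    rw [expect_boughtLaw_cons, charge]
    have hne : ∀ b ∈ h ++ [a], b.Nonempty := fun b hb => hrows b (by
      rw [List.mem_append] at hb ⊢
      exact hb.imp id fun hb => by simp at hb; simp [hb])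
    have hpos := (hd m c h a hc hne).1
    have ha : a.Nonempty := hrows a (by simp)
    have hb : IsWithinBudget c (g m c (h ++ [a])) (restarted g c h s a).x := by
      simp only [restarted]
      split_ifs with hcont
      · exact hcont.2 ▸ hs hcont.1
      · exact isWithinBudget_initWeights hc hpos
    have hmono : stepExpect c (g m c (h ++ [a])) (restarted g c h s a) a
        (fun s' => (boughtLaw g c (h ++ [a]) rows s').expect fun C => ∑ S ∈ C, c S) ≤
        stepExpect c (g m c (h ++ [a])) (restarted g c h s a) a
          (fun s' => ∑ S ∈ s'.bought, c S + charge g c (fun _ => 1) (h ++ [a]) rows s') := by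
      refine stepExpect_mono fun s' hs' => ih (h ++ [a]) (by simpa using hrows) s' fun _ => ?_
      rcases hs' with hs' | hs' <;> rw [hs']
      · exact hb
      · exact hb.updateWeights hc hpos a
    refine hmono.trans ?_
    rw [stepExpect_add, ← add_assoc, one_mul]
    refine add_le_add_left ?_ _
    rw [stepExpect]
    by_cases hcov : ∃ S ∈ s.bought, S ∈ a
    · rw [if_pos (show ∃ S ∈ (restarted g c h s a).bought, S ∈ a from hcov), if_pos hcov]
      simp [restarted]
    · rw [if_neg (show ¬ ∃ S ∈ (restarted g c h s a).bought, S ∈ a from hcov), if_neg hcov]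
      obtain ⟨S₀, -, hS₀, hκ⟩ := exists_cheapest (c := c) ha
      have hstep := expect_sample_cost_le hc hpos (kappa_pos hc ha).le hb
      refine (PMF.expect_mono _ (g := fun R => (∑ S ∈ s.bought, c S + kappa c a) +
        ∑ S ∈ R, c S) fun R => ?_).trans ?_
      · have h1 : ∀ P Q : Finset (Fin m), ∑ S ∈ P ∪ Q, c S ≤ ∑ S ∈ P, c S + ∑ S ∈ Q, c S :=
          fun P Q => by
            rw [← Finset.sum_union_inter]
            exact le_add_of_nonneg_right (Finset.sum_nonneg fun S _ => (hc S).le)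
        have h2 := h1 (s.bought ∪ R) (cheapest c a)
        have h3 := h1 s.bought R
        rw [hS₀, Finset.sum_singleton, hκ] at h2
        simp only [restarted]
        rw [hS₀]
        linarith
      · rw [PMF.expect_add, PMF.expect_const]
        linarith

lemma charge_eq_sum (Γ : Finset ℝ) (rows h : List (Finset (Fin m))) (s : State m)
    (hΓ : ∀ p, p ≠ [] → p <+: rows → g m c (h ++ p) ∈ Γ) :
    charge g c (fun _ => 1) h rows s = ∑ γ ∈ Γ, charge g c (indicatorAt γ) h rows s := by
  induction rows generalizing h s with
  | nil => simp [charge]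
  | cons a rows ih =>
    simp only [charge]
    rw [Finset.sum_add_distrib, ← stepExpect_sum, ← Finset.sum_mul]
    congr 1
    · have h1 : g m c (h ++ [a]) ∈ Γ := hΓ [a] (by simp) (by simp)
      simp [indicatorAt, h1]
    · congr 1
      funext s'
      refine ih (h ++ [a]) s' fun p _ hpr => ?_
      have := hΓ (a :: p) (by simp) (by simpa using hpr)
      simpa using this

/-- A telescoping sum: when the guess rises from `r` to `r' ≥ 2 r`, the new value satisfies `r' ≤ 2
(r' - r)`. The first arrival always starts a phase, which is the same step with `r = 0`; this is why
the baseline is `0` for the empty history. -/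
lemma sum_mul_starts_le (hd : g.IsDoubling) (hc : ∀ S, 0 < c S) (h0 : 0 ≤ g m c []) (Γ : Finset ℝ)
    (rows h : List (Finset (Fin m))) (hrows : ∀ b ∈ h ++ rows, b.Nonempty) :
    ∑ γ ∈ Γ, γ * starts g c γ h rows ≤
      2 * (g m c (h ++ rows) - if h = [] then 0 else g m c h) := by
  induction rows generalizing h with
  | nil =>
    simp only [starts, mul_zero, Finset.sum_const_zero, List.append_nil]
    split_ifs with hh
    · subst hh
      linarith
    · linarith
  | cons a rows ih =>
    have hne : ∀ b ∈ h ++ [a], b.Nonempty := fun b hb => hrows b (by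
      rw [List.mem_append] at hb ⊢
      exact hb.imp id fun hb => by simp at hb; simp [hb])
    obtain ⟨hpos, hdbl⟩ := hd m c h a hc hne
    have key := ih (h ++ [a]) (by simpa using hrows)
    rw [if_neg (by simp), List.append_assoc, List.singleton_append] at key
    simp only [starts, mul_add, Finset.sum_add_distrib]
    have hfirst : ∑ γ ∈ Γ, γ * (open Classical in if g m c (h ++ [a]) = γ ∧
        ¬ (h ≠ [] ∧ g m c (h ++ [a]) = g m c h) then (1 : ℝ) else 0) ≤
        open Classical in
        if h ≠ [] ∧ g m c (h ++ [a]) = g m c h then 0 else g m c (h ++ [a]) := by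
      split_ifs with hh
      · simp [hh]
      · simp only [hh, not_false_eq_true, and_true, mul_ite, mul_one, mul_zero]
        rw [Finset.sum_ite_eq]
        split_ifs
        exacts [le_rfl, hpos.le]
    refine (add_le_add hfirst key).trans ?_
    by_cases hh : h = []
    · subst hh
      simp only [ne_eq, not_true_eq_false, false_and, if_false, if_true]
      linarith
    · rw [if_neg hh]
      rcases hdbl hh with he | hle
      · rw [if_pos ⟨hh, he⟩, he]
        linarith
      · split_ifs with hcont
        · linarith [hcont.2]
        · linarith

end cost

/-- For `mn ≥ 2`, the constant `6` is absorbed by `log (mn) ≥ log 2 ≥ 1/2`, and `1 + n ≤ (mn)²`. -/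
lemma phaseBound_le {γ : ℝ} (hγ : 0 ≤ γ) (hmn : 2 ≤ m * n) :
    phaseBound m γ n ≤ (14 + 8 * Real.exp 1) * (γ * Real.log (m * n)) := by
  have hm : 1 ≤ m := Nat.pos_of_ne_zero (by rintro rfl; simp at hmn)
  have hn : 1 ≤ n := Nat.pos_of_ne_zero (by rintro rfl; simp at hmn)
  have hmR : (1 : ℝ) ≤ m := by exact_mod_cast hm
  have hnR : (1 : ℝ) ≤ n := by exact_mod_cast hn
  have hmnR : (2 : ℝ) ≤ m * n := by exact_mod_cast hmn
  have h1 : Real.log m ≤ Real.log (m * n) :=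
    Real.log_le_log (by linarith) (le_mul_of_one_le_right (by linarith) hnR)
  have h2 : Real.log (1 + n) ≤ 2 * Real.log (m * n) := by
    have : (1 + n : ℝ) ≤ (m * n) ^ 2 := by
      have : (n : ℝ) ≤ m * n := le_mul_of_one_le_left (by linarith) hmR
      nlinarith
    calc Real.log (1 + n) ≤ Real.log ((m * n) ^ 2) := Real.log_le_log (by linarith) this
      _ = _ := by rw [Real.log_pow]; norm_num
  have h3 : 1 / 2 ≤ Real.log (m * n) := by
    have := Real.log_two_gt_d9
    have := Real.log_le_log two_pos hmnR
    linarith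
  have he := Real.exp_pos 1
  unfold phaseBound
  calc γ * (6 + 2 * Real.log m + 4 * Real.exp 1 * Real.log (1 + n))
      ≤ γ * (12 * Real.log (m * n) + 2 * Real.log (m * n) +
          4 * Real.exp 1 * (2 * Real.log (m * n))) := by
        gcongr
        linarith
    _ = _ := by ring

lemma step_covers {c : Fin m → ℝ} {β : ℝ} {s s' : State m} {a : Finset (Fin m)} (ha : a.Nonempty)
    (hs' : s' ∈ (step c β s a).support) : s.bought ⊆ s'.bought ∧ ∃ S ∈ s'.bought, S ∈ a := by
  rw [step] at hs'
  split_ifs at hs' with h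
  · rw [PMF.mem_support_pure_iff] at hs'
    subst hs'
    exact ⟨subset_rfl, h⟩
  · rw [PMF.support_map] at hs'
    obtain ⟨R, -, rfl⟩ := hs'
    obtain ⟨S, hS, hS', -⟩ := exists_cheapest (c := c) ha
    refine ⟨fun T hT => by simp [hT], S, ?_, hS⟩
    simp [hS']

end LearnOrCover

/-! ### Certain coverage, and a fixed guess as a constant rule -/

open LearnOrCover

lemma guessAndDouble_alwaysCovers (g : GuessRule) : (guessAndDouble g).AlwaysCovers := by
  intro m c rows _ hrows C hC
  have key : ∀ (rows h : List (Finset (Fin m))) (s : LearnOrCover.State m),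
      (∀ a ∈ rows, a.Nonempty) → ∀ s' ∈ (doublingRunFrom g c h rows s).support,
        s.bought ⊆ s'.bought ∧ ∀ a ∈ rows, ∃ S ∈ s'.bought, S ∈ a := by
    intro rows
    induction rows with
    | nil =>
      intro h s _ s' hs'
      rw [doublingRunFrom, PMF.mem_support_pure_iff] at hs'
      subst hs'
      exact ⟨subset_rfl, by simp⟩
    | cons a rows ih =>
      intro h s hr s' hs'
      rw [doublingRunFrom, PMF.mem_support_bind_iff] at hs'
      obtain ⟨s₁, hs₁, hs'⟩ := hs'
      obtain ⟨h1, S, hS, hSa⟩ := step_covers (hr a (by simp)) hs₁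
      obtain ⟨h2, h3⟩ := ih _ s₁ (fun b hb => hr b (by simp [hb])) s' hs'
      refine ⟨fun T hT => h2 (h1 hT), fun b hb => ?_⟩
      rcases List.mem_cons.1 hb with rfl | hb
      · exact ⟨S, h2 hS, hSa⟩
      · exact h3 b hb
  rw [guessAndDouble, PMF.support_map] at hC
  obtain ⟨s', hs', rfl⟩ := hC
  exact (key rows [] _ hrows s' hs').2

/-- LearnOrCover with a fixed guess is guess-and-double with a constant guess. -/
lemma learnOrCover_eq (β : ℝ) : learnOrCover β = guessAndDouble fun _ _ _ => β := by
  funext m c rows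
  have key : ∀ (rows h : List (Finset (Fin m))) (s : LearnOrCover.State m), h ≠ [] →
      doublingRunFrom (fun _ _ _ => β) c h rows s = runFrom c β rows s := by
    intro rows
    induction rows with
    | nil => intro h s _; rfl
    | cons a rows ih =>
      intro h s hh
      rw [doublingRunFrom, runFrom, doublingStep, if_pos ⟨hh, rfl⟩]
      congr 1
      funext s'
      exact ih _ _ (by simp)
  rw [learnOrCover, guessAndDouble]
  cases rows with
  | nil => simp [runFrom, doublingRunFrom, PMF.pure_map]
  | cons a rows =>
    rw [doublingRunFrom, runFrom, doublingStep, if_neg (by simp)]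
    congr 2
    funext s'
    exact (key _ _ _ (by simp)).symm

lemma const_isDoubling {β : ℝ} (hβ : 0 < β) : GuessRule.IsDoubling fun _ _ _ => β :=
  fun _ _ _ _ _ _ => ⟨hβ, fun _ => Or.inl rfl⟩

/-! ### Optimal values of an instance and the bounds on the expected cost -/

namespace SetCoverInstance

variable {m n : ℕ} (I : SetCoverInstance m n)

/-- The sets that contain the element `v`. -/
def row (v : Fin n) : Finset (Fin m) := Finset.univ.filter fun S => v ∈ I.sets S

lemma row_nonempty (v : Fin n) : (I.row v).Nonempty := by
  obtain ⟨S, hS⟩ := I.covered v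
  exact ⟨S, by simpa [row] using hS⟩

lemma arrivals_eq (σ : Equiv.Perm (Fin n)) : I.arrivals σ = List.ofFn (I.row ∘ σ) := rfl

lemma expectedCost_guessAndDouble (g : GuessRule) :
    (guessAndDouble g).expectedCost I = ((n.factorial : ℝ))⁻¹ * ∑ σ : Equiv.Perm (Fin n),
      (boughtLaw g I.cost [] (I.arrivals σ) ⟨fun _ => 0, ∅⟩).expect
        fun C => ∑ S ∈ C, I.cost S := by
  have h : (guessAndDouble g).expectedCost I =
      ((guessAndDouble g).randomOrderLaw I).expect fun C => ∑ S ∈ C, I.cost S := rfl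
  rw [h, OnlineAlg.randomOrderLaw, PMF.expect_bind, PMF.expect_uniform, Fintype.card_perm,
    Fintype.card_fin]
  rfl

lemma exists_opt_cover : ∃ C : Finset (Fin m), (∀ v, ∃ S ∈ C, v ∈ I.sets S) ∧
    I.opt = ∑ S ∈ C, I.cost S := by
  refine Set.Nonempty.csInf_mem (s := {r | ∃ C : Finset (Fin m),
    (∀ v, ∃ S ∈ C, v ∈ I.sets S) ∧ r = ∑ S ∈ C, I.cost S}) ?_ ?_
  · exact ⟨_, Finset.univ, fun v => (I.covered v).imp fun S hS => ⟨Finset.mem_univ S, hS⟩, rfl⟩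
  · refine (Set.finite_range fun C : Finset (Fin m) => ∑ S ∈ C, I.cost S).subset ?_
    rintro _ ⟨C, -, rfl⟩
    exact ⟨C, rfl⟩

/-- The optimal value of the linear relaxation is attained. -/
lemma exists_lpOpt_cover : ∃ x, I.IsFractionalCover x ∧ I.lpOpt = ∑ S, I.cost S * x S := by
  set L := ∑ S, I.cost S with hL
  have hone : I.IsFractionalCover fun _ => 1 := by
    refine ⟨fun _ => zero_le_one, fun v => ?_⟩
    obtain ⟨S, hS⟩ := I.covered v
    rw [Finset.sum_const, nsmul_eq_mul, mul_one]
    exact_mod_cast Finset.card_pos.2 ⟨S, by simpa using hS⟩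
  -- Solutions dearer than the all-ones vector are irrelevant. Since all costs are positive, what
  -- remains lies in a box, hence is compact.
  set X := {x | I.IsFractionalCover x ∧ ∑ S, I.cost S * x S ≤ L} with hX
  have hcomp : IsCompact X := by
    refine (isCompact_Icc (a := (0 : Fin m → ℝ)) (b := fun S => L / I.cost S)).of_isClosed_subset
      ?_ ?_
    · have h1 : IsClosed {x : Fin m → ℝ | ∀ S, 0 ≤ x S} := by
        simp only [Set.ofPred_forall]
        exact isClosed_iInter fun S => isClosed_le continuous_const (continuous_apply S)
      have h2 : IsClosed {x : Fin m → ℝ | ∀ v, 1 ≤ ∑ S with v ∈ I.sets S, x S} := by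
        simp only [Set.ofPred_forall]
        exact isClosed_iInter fun v => isClosed_le continuous_const
          (continuous_finsetSum _ fun S _ => continuous_apply S)
      have h3 : IsClosed {x : Fin m → ℝ | ∑ S, I.cost S * x S ≤ L} :=
        isClosed_le (continuous_finsetSum _ fun S _ => continuous_const.mul (continuous_apply S))
          continuous_const
      exact (h1.inter h2).inter h3
    · rintro x ⟨⟨h0, -⟩, hle⟩
      refine ⟨h0, fun S => ?_⟩
      show x S ≤ L / I.cost S
      rw [le_div_iff₀ (I.cost_pos S), mul_comm]
      exact (Finset.single_le_sum (f := fun S => I.cost S * x S)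
        (fun T _ => mul_nonneg (I.cost_pos T).le (h0 T)) (Finset.mem_univ S)).trans hle
  obtain ⟨x, hx, hmin⟩ := hcomp.exists_isMinOn ⟨fun _ => 1, hone, by simp [hL]⟩
    (f := fun x => ∑ S, I.cost S * x S)
    (continuous_finsetSum _ fun S _ => continuous_const.mul (continuous_apply S)).continuousOn
  refine ⟨x, hx.1, IsLeast.csInf_eq ⟨⟨x, hx.1, rfl⟩, ?_⟩⟩
  rintro _ ⟨z, hz, rfl⟩
  rcases le_total (∑ S, I.cost S * z S) L with h | h
  · exact hmin ⟨hz, h⟩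
  · exact hx.2.trans h

end SetCoverInstance

/-- The guarantee of LearnOrCover with a guess that is at least the value of the relaxation. -/
lemma learnOrCover_expectedCost_le {m n : ℕ} (I : SetCoverInstance m n) {β : ℝ} (hmn : 2 ≤ m * n)
    (hβ : I.lpOpt ≤ β) :
    (learnOrCover β).expectedCost I ≤
      (14 + 8 * Real.exp 1) * (β * Real.log ((m : ℝ) * n)) := by
  classical
  obtain ⟨x, ⟨hx0, hxc⟩, hx⟩ := I.exists_lpOpt_cover
  have hm : 0 < m := Nat.pos_of_ne_zero (by rintro rfl; simp at hmn)
  have hn : 0 < n := Nat.pos_of_ne_zero (by rintro rfl; simp at hmn)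
  -- The relaxation has positive value: a cover of cost zero would be the zero vector, which does
  -- not cover the first element.
  have hβ0 : 0 < β := by
    refine lt_of_lt_of_le ?_ hβ
    rw [hx]
    refine lt_of_le_of_ne (Finset.sum_nonneg fun S _ => mul_nonneg (I.cost_pos S).le (hx0 S)) ?_
    intro h
    have h0 := (Finset.sum_eq_zero_iff_of_nonneg
      fun S _ => mul_nonneg (I.cost_pos S).le (hx0 S)).1 h.symm
    have h1 := hxc ⟨0, hn⟩
    rw [Finset.sum_eq_zero fun S _ => ?_] at h1
    · linarith
    · have := h0 S (Finset.mem_univ S)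
      exact (mul_eq_zero.1 this).resolve_left (I.cost_pos S).ne'
  obtain ⟨y, hy⟩ := exists_isBudgetCover (A := Set.range I.row) I.cost_pos hβ0 hx0
    (hx.symm.le.trans hβ) (by rintro _ ⟨v, rfl⟩; exact hxc v)
  rw [learnOrCover_eq, I.expectedCost_guessAndDouble,
    inv_mul_le_iff₀ (by exact_mod_cast n.factorial_pos)]
  set g : GuessRule := fun _ _ _ => β with hg
  have hcost : ∀ σ : Equiv.Perm (Fin n),
      (boughtLaw g I.cost [] (I.arrivals σ) ⟨fun _ => 0, ∅⟩).expect (fun C => ∑ S ∈ C, I.cost S) ≤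
        charge g I.cost (indicatorAt β) [] (List.ofFn (I.row ∘ σ)) ⟨fun _ => 0, ∅⟩ := by
    intro σ
    refine (expect_cost_le_charge (const_isDoubling hβ0) I.cost_pos _ [] ?_ _ (by simp)).trans ?_
    · intro b hb
      rw [List.nil_append, I.arrivals_eq, List.mem_ofFn] at hb
      obtain ⟨i, rfl⟩ := hb
      exact I.row_nonempty _
    · rw [charge_eq_sum {β} _ [] _ fun p _ _ => Finset.mem_singleton.2 rfl, Finset.sum_singleton,
        Finset.sum_empty, zero_add, I.arrivals_eq]
  refine (Finset.sum_le_sum fun σ _ => hcost σ).trans ?_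
  refine (sum_charge_le_of_isBudgetCover I.cost_pos hβ0 hm I.row hy le_rfl [] _ (by simp)).trans ?_
  -- A constant guess starts a phase only at the first arrival.
  have hstart : ∀ σ : Equiv.Perm (Fin n), starts g I.cost β [] (List.ofFn (I.row ∘ σ)) ≤ 1 := by
    intro σ
    have hzero : ∀ (rows h : List (Finset (Fin m))), h ≠ [] → starts g I.cost β h rows = 0 := by
      intro rows
      induction rows with
      | nil => intro h _; rfl
      | cons a rows ih =>
        intro h hh
        rw [starts, ih _ (by simp)]
        simp [hg, hh]
    cases List.ofFn (I.row ∘ σ) with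
    | nil => exact zero_le_one
    | cons a rows =>
      rw [starts, hzero _ _ (by simp), add_zero]
      split_ifs <;> norm_num
  have hpb := phaseBound_le hβ0.le hmn
  have hpb0 : 0 ≤ phaseBound m β n := by
    unfold phaseBound
    have := Real.log_natCast_nonneg m
    have : 0 ≤ Real.log (1 + n) := Real.log_nonneg (by simp)
    positivity
  rw [if_neg (by simp), zero_add]
  calc phaseBound m β n * ∑ σ : Equiv.Perm (Fin n), starts g I.cost β [] (List.ofFn (I.row ∘ σ))
      ≤ phaseBound m β n * ∑ _σ : Equiv.Perm (Fin n), 1 := by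
        gcongr with σ
        exact hstart σ
    _ = n.factorial * phaseBound m β n := by
        simp [Fintype.card_perm]
        ring
    _ ≤ _ := by gcongr

/-- The guarantee of guess-and-double for a rule whose guess is at least, and up to a constant factor
at most, the value of the relaxation for the arrivals so far. -/
lemma guessAndDouble_expectedCost_le {g : GuessRule} {K : ℝ} (hd : g.IsDoubling)
    (h0 : ∀ m c, 0 ≤ g m c [])
    (hcov : ∀ (m : ℕ) (c : Fin m → ℝ) (l : List (Finset (Fin m))), (∀ S, 0 < c S) → l ≠ [] →
      (∀ a ∈ l, a.Nonempty) → ∃ y, IsBudgetCover c (g m c l) {a | a ∈ l} y)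
    (hle : ∀ (m : ℕ) (c : Fin m → ℝ) (l : List (Finset (Fin m))) (x : Fin m → ℝ),
      (∀ S, 0 < c S) → (∀ a ∈ l, a.Nonempty) → (∀ S, 0 ≤ x S) → (∀ a ∈ l, 1 ≤ ∑ S ∈ a, x S) →
        g m c l ≤ K * ∑ S, c S * x S)
    {m n : ℕ} (I : SetCoverInstance m n) (hmn : 2 ≤ m * n) :
    (guessAndDouble g).expectedCost I ≤
      ((14 + 8 * Real.exp 1) * (2 * K)) * Real.log ((m : ℝ) * n) * I.opt := by
  classical
  have hm : 0 < m := Nat.pos_of_ne_zero (by rintro rfl; simp at hmn)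
  obtain ⟨C, hC, hopt⟩ := I.exists_opt_cover
  have hrow : ∀ σ : Equiv.Perm (Fin n), ∀ b ∈ List.ofFn (I.row ∘ σ), b.Nonempty := by
    intro σ b hb
    obtain ⟨i, rfl⟩ := List.mem_ofFn.1 hb
    exact I.row_nonempty _
  have hguess : ∀ σ : Equiv.Perm (Fin n), g m I.cost (List.ofFn (I.row ∘ σ)) ≤ K * I.opt := by
    intro σ
    refine (hle m I.cost _ (fun S => if S ∈ C then 1 else 0) I.cost_pos (hrow σ)
      (fun S => by split_ifs <;> norm_num) ?_).trans_eq ?_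
    · intro a ha
      obtain ⟨i, rfl⟩ := List.mem_ofFn.1 ha
      obtain ⟨S, hSC, hS⟩ := hC (σ i)
      have hSr : S ∈ I.row (σ i) := by simpa [SetCoverInstance.row] using hS
      calc (1 : ℝ) = if S ∈ C then 1 else 0 := by rw [if_pos hSC]
        _ ≤ _ := Finset.single_le_sum (f := fun S => if S ∈ C then (1 : ℝ) else 0)
          (fun T _ => by split_ifs <;> norm_num) hSr
    · rw [hopt]
      simp
  -- All guesses that occur in some order, a finite set common to all orders. The sum over `Γ` can
  -- thus be interchanged with the sum over the orders.
  set Γ : Finset ℝ := (Finset.univ : Finset (Equiv.Perm (Fin n))).biUnion fun σ =>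
    ((List.ofFn (I.row ∘ σ)).inits.filter (· ≠ [])).toFinset.image (g m I.cost) with hΓ
  have hΓmem : ∀ (σ : Equiv.Perm (Fin n)) (p : List (Finset (Fin m))), p ≠ [] →
      p <+: List.ofFn (I.row ∘ σ) → g m I.cost p ∈ Γ := by
    intro σ p hp hpr
    rw [hΓ, Finset.mem_biUnion]
    exact ⟨σ, Finset.mem_univ σ, Finset.mem_image.2 ⟨p, by simp [hp, hpr], rfl⟩⟩
  have hΓpos : ∀ γ ∈ Γ, 0 < γ := by
    intro γ hγ
    rw [hΓ, Finset.mem_biUnion] at hγ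
    obtain ⟨σ, -, hγ⟩ := hγ
    obtain ⟨p, hp, rfl⟩ := Finset.mem_image.1 hγ
    simp only [List.mem_toFinset, List.mem_filter, List.mem_inits, decide_eq_true_eq] at hp
    obtain ⟨q, b, rfl⟩ := (List.eq_nil_or_concat p).resolve_left hp.2
    rw [List.concat_eq_append] at hp ⊢
    exact (hd m I.cost q b I.cost_pos fun b' hb => hrow σ b' (hp.1.subset hb)).1
  rw [I.expectedCost_guessAndDouble, inv_mul_le_iff₀ (by exact_mod_cast n.factorial_pos)]
  have hcost : ∀ σ : Equiv.Perm (Fin n),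
      (boughtLaw g I.cost [] (I.arrivals σ) ⟨fun _ => 0, ∅⟩).expect (fun C => ∑ S ∈ C, I.cost S) ≤
        ∑ γ ∈ Γ, charge g I.cost (indicatorAt γ) [] (List.ofFn (I.row ∘ σ)) ⟨fun _ => 0, ∅⟩ := by
    intro σ
    rw [I.arrivals_eq, ← charge_eq_sum Γ _ [] _ fun p hp hpr => hΓmem σ p hp hpr]
    exact (expect_cost_le_charge hd I.cost_pos (List.ofFn (I.row ∘ σ)) [] (hrow σ) _ (by simp)).trans_eq
      (by rw [Finset.sum_empty, zero_add])
  have hlog : 0 ≤ Real.log ((m : ℝ) * n) :=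
    Real.log_nonneg (by exact_mod_cast (by omega : 1 ≤ m * n))
  have hK : 0 ≤ (14 + 8 * Real.exp 1) * Real.log ((m : ℝ) * n) := by
    have := Real.exp_pos 1
    positivity
  calc _ ≤ ∑ σ : Equiv.Perm (Fin n), ∑ γ ∈ Γ,
        charge g I.cost (indicatorAt γ) [] (List.ofFn (I.row ∘ σ)) ⟨fun _ => 0, ∅⟩ :=
        Finset.sum_le_sum fun σ _ => hcost σ
    _ = ∑ γ ∈ Γ, ∑ σ : Equiv.Perm (Fin n),
        charge g I.cost (indicatorAt γ) [] (List.ofFn (I.row ∘ σ)) ⟨fun _ => 0, ∅⟩ :=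
        Finset.sum_comm
    _ ≤ ∑ γ ∈ Γ, phaseBound m γ n * ∑ σ : Equiv.Perm (Fin n),
          starts g I.cost γ [] (List.ofFn (I.row ∘ σ)) := by
        refine Finset.sum_le_sum fun γ hγ => sum_charge_le I.cost_pos (hΓpos γ hγ) hm ?_ I.row
          I.row_nonempty le_rfl _
        rintro l hl rfl
        by_cases hnil : l = []
        · subst hnil
          exact ⟨fun _ => 0, ⟨fun _ => le_rfl, fun _ _ => rfl, by simpa using (hΓpos _ hγ).le,
            by simp⟩⟩
        · exact hcov m I.cost l I.cost_pos hnil hl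
    _ ≤ ∑ γ ∈ Γ, ((14 + 8 * Real.exp 1) * (γ * Real.log (m * n))) * ∑ σ : Equiv.Perm (Fin n),
          starts g I.cost γ [] (List.ofFn (I.row ∘ σ)) := by
        refine Finset.sum_le_sum fun γ hγ => ?_
        exact mul_le_mul_of_nonneg_right (phaseBound_le (hΓpos γ hγ).le hmn)
          (Finset.sum_nonneg fun σ _ => starts_nonneg _ _ _)
    _ = (14 + 8 * Real.exp 1) * Real.log (m * n) * ∑ σ : Equiv.Perm (Fin n), ∑ γ ∈ Γ,
          γ * starts g I.cost γ [] (List.ofFn (I.row ∘ σ)) := by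
        rw [Finset.sum_comm, Finset.mul_sum]
        refine Finset.sum_congr rfl fun γ _ => ?_
        rw [← Finset.mul_sum]
        ring
    -- In every order the guesses at the starts sum to at most twice the final guess, which is at
    -- most `K` times the cost of an optimal integral cover.
    _ ≤ (14 + 8 * Real.exp 1) * Real.log (m * n) * ∑ _σ : Equiv.Perm (Fin n), 2 * (K * I.opt) := by
        refine mul_le_mul_of_nonneg_left (Finset.sum_le_sum fun σ _ => ?_) hK
        refine (sum_mul_starts_le hd I.cost_pos (h0 m I.cost) Γ _ [] (hrow σ)).trans ?_
        rw [if_pos rfl, sub_zero]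
        exact mul_le_mul_of_nonneg_left (hguess σ) two_pos.le
    _ = _ := by
        simp only [Finset.sum_const, Finset.card_univ, Fintype.card_perm, Fintype.card_fin,
          nsmul_eq_mul]
        ring

/-! ### An estimate of the value of the relaxation -/

namespace LearnOrCover

variable {m : ℕ}

/-- The first row of minimal weight, together with its weight. -/
noncomputable def lightestRow (w : Fin m → ℝ) (rows : List (Finset (Fin m))) :
    ℝ × Finset (Fin m) :=
  rows.foldl (fun b a => if ∑ S ∈ a, w S < b.1 then (∑ S ∈ a, w S, a) else b) (∑ S, w S + 1, ∅)

/-- One multiplicative update: the sets of the lightest row are scaled up, and the cost of the cover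
proportional to the weights is recorded. -/
noncomputable def estimateStep (c : Fin m → ℝ) (rows : List (Finset (Fin m)))
    (p : (Fin m → ℝ) × ℝ) : (Fin m → ℝ) × ℝ :=
  (scaleUp c p.1 (lightestRow p.1 rows).2, min p.2 ((∑ S, c S * p.1 S) / (lightestRow p.1 rows).1))

/-- The products `c S * w S` start at `1`, and in each round at least one of them is multiplied by
`e`. After `2m²` rounds the logarithm of their sum is at least `2m`, which dominates the initial
`log m`. The number of rounds is written so that two nested loops realize it without multiplying
naturals. The initial value is the cost of buying everything. -/
noncomputable def estimate (c : Fin m → ℝ) (rows : List (Finset (Fin m))) : ℝ :=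
  ((estimateStep c rows)^[(m + m) * m] (fun S => 1 / c S, ∑ S, c S)).2

/-- The next guess, given the arrivals including the current one and the current guess. -/
noncomputable def nextGuess (c : Fin m → ℝ) (rows : List (Finset (Fin m))) (r : ℝ) : ℝ :=
  if r < estimate c rows then estimate c rows + estimate c rows else r

/-- The initial value of the fold exceeds the weight of every row, so the first row always replaces
the dummy `∅`. -/
lemma lightestRow_spec {w : Fin m → ℝ} (hw : ∀ S, 0 ≤ w S) {rows : List (Finset (Fin m))}
    (h : rows ≠ []) : (lightestRow w rows).2 ∈ rows ∧
      (lightestRow w rows).1 = ∑ S ∈ (lightestRow w rows).2, w S ∧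
      ∀ a ∈ rows, (lightestRow w rows).1 ≤ ∑ S ∈ a, w S := by
  have key : ∀ l : List (Finset (Fin m)),
      (l = [] → lightestRow w l = (∑ S, w S + 1, ∅)) ∧ (l ≠ [] → (lightestRow w l).2 ∈ l ∧
      (lightestRow w l).1 = ∑ S ∈ (lightestRow w l).2, w S ∧
      ∀ a ∈ l, (lightestRow w l).1 ≤ ∑ S ∈ a, w S) := by
    intro l
    induction l using List.reverseRecOn with
    | nil => exact ⟨fun _ => rfl, fun h => absurd rfl h⟩
    | append_singleton l a ih =>
      refine ⟨fun h => by simp at h, fun _ => ?_⟩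
      have hfold : lightestRow w (l ++ [a]) = if ∑ S ∈ a, w S < (lightestRow w l).1
          then (∑ S ∈ a, w S, a) else lightestRow w l := by
        rw [lightestRow, List.foldl_append]
        rfl
      rw [hfold]
      by_cases hl : l = []
      · subst hl
        rw [ih.1 rfl, if_pos]
        · simp
        · have : ∑ S ∈ a, w S ≤ ∑ S, w S :=
            Finset.sum_le_sum_of_subset_of_nonneg (Finset.subset_univ a) fun S _ _ => hw S
          simp only
          linarith
      · obtain ⟨h1, h2, h3⟩ := ih.2 hl
        split_ifs with hlt
        · refine ⟨by simp, rfl, fun b hb => ?_⟩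
          rcases List.mem_append.1 hb with hb | hb
          · exact hlt.le.trans (h3 b hb)
          · simp only [List.mem_singleton] at hb
            rw [hb]
        · refine ⟨by simp [h1], h2, fun b hb => ?_⟩
          rcases List.mem_append.1 hb with hb | hb
          · exact h3 b hb
          · simp only [List.mem_singleton] at hb
            rw [hb]
            exact not_lt.1 hlt
  exact (key rows).2 h

/-- The invariant of the estimation: the recorded cost is that of a fractional cover, and
the weights certify that no fractional cover is much cheaper. -/
structure EstimateInvariant (c : Fin m → ℝ) (rows : List (Finset (Fin m))) (k : ℕ)
    (p : (Fin m → ℝ) × ℝ) : Prop where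
  pos : ∀ S, 0 < p.1 S
  value_pos : 0 < p.2
  cover : ∃ x : Fin m → ℝ, (∀ S, 0 ≤ x S) ∧ ∑ S, c S * x S ≤ p.2 ∧ ∀ a ∈ rows, 1 ≤ ∑ S ∈ a, x S
  -- The cheapest set of the scaled row gains exactly `1` in each round, and no term decreases.
  progress : (k : ℝ) ≤ ∑ S, Real.log (c S * p.1 S)
  -- `Y` is the sum of the `kappa` of the rows chosen so far, the value of an unscaled dual
  -- solution.
  packing : ∃ Y : ℝ, 0 ≤ Y ∧
    Real.log (∑ S, c S * p.1 S) ≤ Real.log m + (Real.exp 1 - 1) * (Y / p.2) ∧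
    ∀ y : Fin m → ℝ, (∀ S, 0 ≤ y S) → (∀ a ∈ rows, 1 ≤ ∑ S ∈ a, y S) →
      Y ≤ ∑ S, c S * y S * Real.log (c S * p.1 S)

section

variable {c : Fin m → ℝ} {rows : List (Finset (Fin m))}

lemma estimateInvariant_init (hc : ∀ S, 0 < c S) (hrows : ∀ a ∈ rows, a.Nonempty)
    (hne : rows ≠ []) : EstimateInvariant c rows 0 (fun S => 1 / c S, ∑ S, c S) := by
  have hone : ∀ S, c S * (1 / c S) = 1 := fun S => mul_one_div_cancel (hc S).ne'
  refine ⟨fun S => one_div_pos.2 (hc S), ?_, ⟨fun _ => 1, fun _ => zero_le_one, by simp, ?_⟩, ?_,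
    0, le_rfl, ?_, ?_⟩
  · obtain ⟨a, ha⟩ := List.exists_mem_of_ne_nil rows hne
    obtain ⟨S, -⟩ := hrows a ha
    exact Finset.sum_pos (fun T _ => hc T) ⟨S, Finset.mem_univ S⟩
  · intro a ha
    rw [Finset.sum_const, nsmul_eq_mul, mul_one]
    exact_mod_cast Finset.card_pos.2 (hrows a ha)
  · simp only [hone]
    simp
  · simp only [hone]
    simp
  · intro y _ _
    simp only [hone]
    simp

/-- Let `D` be the cost of the weights and `α` the weight of the lightest row. Division of the
weights by `α` gives a cover of cost `D / α`. The update raises `D` by at most `(e - 1) κ α`, so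
`log D` by at most `(e - 1) κ / (D / α)`, and the recorded minimum may replace `D / α` in this
bound. A cover `y` gains `κ` times its coverage of the row, which is at least `κ`. -/
lemma EstimateInvariant.next (hc : ∀ S, 0 < c S) (hrows : ∀ a ∈ rows, a.Nonempty)
    (hne : rows ≠ []) {k : ℕ} {p : (Fin m → ℝ) × ℝ} (hp : EstimateInvariant c rows k p) :
    EstimateInvariant c rows (k + 1) (estimateStep c rows p) := by
  obtain ⟨w, L⟩ := p
  obtain ⟨hw, hL, ⟨x, hx0, hxL, hxc⟩, hprog, Y, hY, hlog, hpack⟩ := hp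
  simp only at hw hL hxL hprog hlog hpack
  obtain ⟨ha, hα, hmin⟩ := lightestRow_spec (fun S => (hw S).le) hne
  simp only [estimateStep]
  set a := (lightestRow w rows).2
  set α := (lightestRow w rows).1
  have hane := hrows a ha
  have hαpos : 0 < α := by
    rw [hα]
    exact Finset.sum_pos (fun S _ => hw S) hane
  have hκ := kappa_pos hc hane
  have hDpos : 0 < ∑ S, c S * w S := by
    obtain ⟨S, -⟩ := hane
    exact Finset.sum_pos (fun T _ => mul_pos (hc T) (hw T)) ⟨S, Finset.mem_univ S⟩
  set D := ∑ S, c S * w S with hD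
  have he : 2 ≤ Real.exp 1 := by
    have := Real.add_one_le_exp (1 : ℝ)
    linarith
  have hLnew : 0 < min L (D / α) := lt_min hL (div_pos hDpos hαpos)
  have hlogS : ∀ S, Real.log (c S * scaleUp c w a S) =
      Real.log (c S * w S) + if S ∈ a then kappa c a / c S else 0 := by
    intro S
    rw [scaleUp, ← mul_assoc, Real.log_mul (mul_pos (hc S) (hw S)).ne' (Real.exp_pos _).ne',
      Real.log_exp]
  refine ⟨fun S => mul_pos (hw S) (Real.exp_pos _), hLnew, ?_, ?_, Y + kappa c a, by linarith,
    ?_, ?_⟩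
  · rcases min_choice L (D / α) with h | h
    · exact ⟨x, hx0, hxL.trans_eq h.symm, hxc⟩
    · refine ⟨fun S => w S / α, fun S => (div_pos (hw S) hαpos).le, ?_, fun b hb => ?_⟩
      · simp only [h, ← mul_div_assoc, ← Finset.sum_div]
        exact le_rfl
      · rw [← Finset.sum_div, one_le_div hαpos]
        exact hmin b hb
  · simp only [hlogS, Finset.sum_add_distrib]
    push_cast
    refine add_le_add hprog ?_
    obtain ⟨S, hS, hSκ⟩ := exists_eq_kappa (c := c) hane
    calc (1 : ℝ) = if S ∈ a then kappa c a / c S else 0 := by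
          rw [if_pos hS, hSκ, div_self hκ.ne']
      _ ≤ _ := Finset.single_le_sum (f := fun S => if S ∈ a then kappa c a / c S else 0)
        (fun T _ => by
          split_ifs
          exacts [(div_pos hκ (hc T)).le, le_rfl]) (Finset.mem_univ S)
  · have h1 := sum_cost_scaleUp_le hc (fun S => (hw S).le) hane
    rw [← hα, ← hD] at h1
    set t := (Real.exp 1 - 1) * kappa c a * α / D with ht
    have ht0 : 0 ≤ t := by
      have : 0 ≤ Real.exp 1 - 1 := by linarith
      positivity
    have h2 : ∑ S, c S * scaleUp c w a S ≤ D * (1 + t) := by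
      refine h1.trans_eq ?_
      rw [ht]
      field_simp
    have hnewpos : 0 < ∑ S, c S * scaleUp c w a S := by
      refine hDpos.trans_le (Finset.sum_le_sum fun S _ => ?_)
      exact mul_le_mul_of_nonneg_left (le_scaleUp hc hane (fun S => (hw S).le) S) (hc S).le
    have h3 : Real.log (∑ S, c S * scaleUp c w a S) ≤ Real.log D + t := by
      refine (Real.log_le_log hnewpos h2).trans ?_
      rw [Real.log_mul hDpos.ne' (by linarith)]
      have := Real.log_le_sub_one_of_pos (show 0 < 1 + t by linarith)
      linarith
    have h4 : t ≤ (Real.exp 1 - 1) * (kappa c a / min L (D / α)) := by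
      have h5 : kappa c a / (D / α) ≤ kappa c a / min L (D / α) :=
        div_le_div_of_nonneg_left hκ.le hLnew (min_le_right _ _)
      calc t = (Real.exp 1 - 1) * (kappa c a / (D / α)) := by
            rw [ht]
            field_simp
        _ ≤ _ := mul_le_mul_of_nonneg_left h5 (by linarith)
    have h6 : (Real.exp 1 - 1) * (Y / L) ≤ (Real.exp 1 - 1) * (Y / min L (D / α)) :=
      mul_le_mul_of_nonneg_left (div_le_div_of_nonneg_left hY hLnew (min_le_left _ _)) (by linarith)
    rw [add_div, mul_add]
    linarith
  · intro y hy0 hyc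
    simp only [hlogS, mul_add, Finset.sum_add_distrib]
    refine add_le_add (hpack y hy0 hyc) ?_
    have h1 : ∀ S, c S * y S * (if S ∈ a then kappa c a / c S else 0) =
        if S ∈ a then kappa c a * y S else 0 := by
      intro S
      have := (hc S).ne'
      split_ifs
      · field_simp
      · simp
    simp only [h1]
    rw [← Finset.sum_filter]
    simp only [Finset.filter_univ_mem]
    rw [← Finset.mul_sum]
    exact le_mul_of_one_le_right hκ.le (hyc a ha)

lemma estimateInvariant_iterate (hc : ∀ S, 0 < c S) (hrows : ∀ a ∈ rows, a.Nonempty)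
    (hne : rows ≠ []) (k : ℕ) : EstimateInvariant c rows k
      ((estimateStep c rows)^[k] (fun S => 1 / c S, ∑ S, c S)) := by
  induction k with
  | zero => exact estimateInvariant_init hc hrows hne
  | succ k ih =>
    rw [Function.iterate_succ_apply']
    exact ih.next hc hrows hne

lemma estimate_pos (hc : ∀ S, 0 < c S) (hrows : ∀ a ∈ rows, a.Nonempty) (hne : rows ≠ []) :
    0 < estimate c rows :=
  (estimateInvariant_iterate hc hrows hne _).value_pos

lemma exists_cover_le_estimate (hc : ∀ S, 0 < c S) (hrows : ∀ a ∈ rows, a.Nonempty)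
    (hne : rows ≠ []) : ∃ x : Fin m → ℝ, (∀ S, 0 ≤ x S) ∧ ∑ S, c S * x S ≤ estimate c rows ∧
      ∀ a ∈ rows, 1 ≤ ∑ S ∈ a, x S :=
  (estimateInvariant_iterate hc hrows hne _).cover

/-- Let `L` be the estimate and `Λ` the logarithm of the final cost of the weights. Progress gives
`Λ ≥ 2m ≥ 2 log m`, so the growth bound becomes `Λ / 2 ≤ (e - 1) Y / L`. On the other hand, `Y` is
at most `Λ` times the cost of any cover. Division by `Λ` leaves the factor `2 (e - 1)`. -/
lemma estimate_le (hc : ∀ S, 0 < c S) (hrows : ∀ a ∈ rows, a.Nonempty) (hne : rows ≠ [])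
    {y : Fin m → ℝ} (hy0 : ∀ S, 0 ≤ y S) (hyc : ∀ a ∈ rows, 1 ≤ ∑ S ∈ a, y S) :
    estimate c rows ≤ 2 * (Real.exp 1 - 1) * ∑ S, c S * y S := by
  have hinv := estimateInvariant_iterate hc hrows hne ((m + m) * m)
  have hL : ((estimateStep c rows)^[(m + m) * m] (fun S => 1 / c S, ∑ S, c S)).2 =
    estimate c rows := rfl
  obtain ⟨hw, hLpos, -, hprog, Y, hY, hlog, hpack⟩ := hinv
  rw [hL] at hLpos hlog
  set w := ((estimateStep c rows)^[(m + m) * m] (fun S => 1 / c S, ∑ S, c S)).1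
  set L := estimate c rows
  obtain ⟨a, ha⟩ := List.exists_mem_of_ne_nil rows hne
  obtain ⟨S₀, -⟩ := hrows a ha
  have hm : (0 : ℝ) < m := by exact_mod_cast S₀.pos
  set Λ := Real.log (∑ S, c S * w S) with hΛ
  have hlogle : ∀ S, Real.log (c S * w S) ≤ Λ := fun S =>
    Real.log_le_log (mul_pos (hc S) (hw S)) (Finset.single_le_sum (f := fun S => c S * w S)
      (fun T _ => (mul_pos (hc T) (hw T)).le) (Finset.mem_univ S))
  have h1 : ((m + m) * m : ℝ) ≤ m * Λ := by
    have := hprog.trans (Finset.sum_le_sum fun S _ => hlogle S)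
    simpa using this
  have h2 : 2 * (m : ℝ) ≤ Λ := by
    have : (m : ℝ) * (2 * m) ≤ m * Λ := by linarith
    exact le_of_mul_le_mul_left this hm
  have h3 : Real.log m ≤ m := (Real.log_le_sub_one_of_pos hm).trans (by linarith)
  have h4 : Y ≤ (∑ S, c S * y S) * Λ := by
    rw [Finset.sum_mul]
    exact (hpack y hy0 hyc).trans (Finset.sum_le_sum fun S _ =>
      mul_le_mul_of_nonneg_left (hlogle S) (mul_nonneg (hc S).le (hy0 S)))
  have he : 2 ≤ Real.exp 1 := by
    have := Real.add_one_le_exp (1 : ℝ)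
    linarith
  have hΛpos : 0 < Λ := by linarith
  have h5 : Λ ≤ 2 * ((Real.exp 1 - 1) * (Y / L)) := by linarith
  have h6 : Λ * L ≤ 2 * (Real.exp 1 - 1) * Y := by
    have := mul_le_mul_of_nonneg_right h5 hLpos.le
    refine this.trans_eq ?_
    field_simp
  have h7 : 2 * (Real.exp 1 - 1) * Y ≤ 2 * (Real.exp 1 - 1) * ((∑ S, c S * y S) * Λ) :=
    mul_le_mul_of_nonneg_left h4 (by linarith)
  refine le_of_mul_le_mul_left ?_ hΛpos
  linarith

end

end LearnOrCover

open LearnOrCover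

/-- The guess is kept as long as it is at least the estimate, and otherwise replaced by twice the
estimate. -/
noncomputable def estimateRule : GuessRule := fun _ c rows =>
  (rows.foldl (fun p a => (p.1 ++ [a], nextGuess c (p.1 ++ [a]) p.2)) (([] : List _), (0 : ℝ))).2

/-! ### The guess rule derived from the estimate -/

section estimateRule

variable {m : ℕ} (c : Fin m → ℝ)

@[simp]
lemma estimateRule_nil : estimateRule m c [] = 0 := rfl

lemma estimateRule_append (h : List (Finset (Fin m))) (a : Finset (Fin m)) :
    estimateRule m c (h ++ [a]) = nextGuess c (h ++ [a]) (estimateRule m c h) := by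
  have hfst : ∀ l : List (Finset (Fin m)), (l.foldl (fun p a =>
      (p.1 ++ [a], nextGuess c (p.1 ++ [a]) p.2)) (([] : List _), (0 : ℝ))).1 = l := by
    intro l
    induction l using List.reverseRecOn with
    | nil => rfl
    | append_singleton l a ih => simp [List.foldl_append, ih]
  simp only [estimateRule, List.foldl_append, List.foldl_cons, List.foldl_nil, hfst]

variable {c}

lemma estimateRule_nonneg (hc : ∀ S, 0 < c S) (l : List (Finset (Fin m)))
    (hl : ∀ a ∈ l, a.Nonempty) : 0 ≤ estimateRule m c l := by
  induction l using List.reverseRecOn with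
  | nil => exact le_rfl
  | append_singleton l a ih =>
    rw [estimateRule_append, nextGuess]
    split_ifs
    · have := estimate_pos hc hl (by simp)
      linarith
    · exact ih fun b hb => hl b (by simp [hb])

lemma estimate_le_estimateRule (hc : ∀ S, 0 < c S) {l : List (Finset (Fin m))} (hne : l ≠ [])
    (hl : ∀ a ∈ l, a.Nonempty) : estimate c l ≤ estimateRule m c l := by
  obtain ⟨h, a, rfl⟩ := (List.eq_nil_or_concat l).resolve_left hne
  rw [List.concat_eq_append] at hne hl ⊢
  rw [estimateRule_append, nextGuess]
  split_ifs with hlt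
  · have := estimate_pos hc hl hne
    linarith
  · exact not_lt.1 hlt

lemma estimateRule_isDoubling : estimateRule.IsDoubling := by
  intro m c h a hc hrows
  refine ⟨(estimate_pos hc hrows (by simp)).trans_le
    (estimate_le_estimateRule hc (by simp) hrows), fun _ => ?_⟩
  rw [estimateRule_append, nextGuess]
  split_ifs with hlt
  · right
    linarith
  · exact Or.inl rfl

/-- A positive guess is twice the estimate of some prefix, and a cover of all rows covers every
prefix. -/
lemma estimateRule_le (hc : ∀ S, 0 < c S) (l : List (Finset (Fin m))) (hl : ∀ a ∈ l, a.Nonempty)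
    {y : Fin m → ℝ} (hy0 : ∀ S, 0 ≤ y S) (hyc : ∀ a ∈ l, 1 ≤ ∑ S ∈ a, y S) :
    estimateRule m c l ≤ 4 * (Real.exp 1 - 1) * ∑ S, c S * y S := by
  induction l using List.reverseRecOn with
  | nil =>
    have h1 := Real.add_one_le_exp (1 : ℝ)
    have h2 : 0 ≤ ∑ S, c S * y S := Finset.sum_nonneg fun S _ => mul_nonneg (hc S).le (hy0 S)
    exact mul_nonneg (by linarith) h2
  | append_singleton l a ih =>
    rw [estimateRule_append, nextGuess]
    split_ifs
    · have := estimate_le hc hl (by simp) hy0 hyc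
      linarith
    · exact ih (fun b hb => hl b (by simp [hb])) fun b hb => hyc b (by simp [hb])

end estimateRule

/-- The guarantee of guess-and-double. -/
lemma expectedCost_estimateRule_le {m n : ℕ} (I : SetCoverInstance m n) (hmn : 2 ≤ m * n) :
    (guessAndDouble estimateRule).expectedCost I ≤ ((14 + 8 * Real.exp 1) *
      (2 * (4 * (Real.exp 1 - 1)))) * Real.log ((m : ℝ) * n) * I.opt := by
  refine guessAndDouble_expectedCost_le estimateRule_isDoubling (fun m c => le_rfl) ?_ ?_ I hmn
  · intro m c l hc hne hl
    obtain ⟨x, hx0, hx, hxc⟩ := exists_cover_le_estimate hc hl hne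
    have hle := estimate_le_estimateRule hc hne hl
    exact exists_isBudgetCover hc ((estimate_pos hc hl hne).trans_le hle) hx0 (hx.trans hle) hxc
  · intro m c l x hc hl hx0 hxc
    exact estimateRule_le hc l hl hx0 hxc

namespace Machine

variable {m : ℕ}

/-! ### Running time

Array `0` of naturals holds the number of arrivals. A command is tame if it does not write this array
and all its loop bounds are built from constants, the number of sets and this array. -/

/-- Since there is no multiplication of naturals and the arrival counter cannot be changed by a tame
command, such bounds are polynomial. Truncated subtraction only decreases its first argument, so its
second one is free. -/
def NatExpr.IsBound : NatExpr → Prop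
  | lit _ => True
  | numSets => True
  | read a _ => a = 0
  | plus e f => e.IsBound ∧ f.IsBound
  | minus e _ => e.IsBound

def Cmd.Tame : Cmd → Prop
  | skip => True
  | seq P Q => P.Tame ∧ Q.Tame
  | setNat a _ _ => a ≠ 0
  | setReal _ _ _ => True
  | ite _ P Q => P.Tame ∧ Q.Tame
  | loop e P => e.IsBound ∧ P.Tame
  | flip _ P Q => P.Tame ∧ Q.Tame
  | buy _ => True

lemma le_add_two_pow (k N : ℕ) : k ≤ (N + 2) ^ k :=
  (Nat.lt_two_pow_self).le.trans (Nat.pow_le_pow_left (by omega) k)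

/-- With base at least `2`, one more in the exponent absorbs a sum. Hence all step bounds can be
kept in the form of a single power. -/
lemma pow_add_pow_le (N a b : ℕ) : (N + 2) ^ a + (N + 2) ^ b ≤ (N + 2) ^ (max a b + 1) := by
  have h1 : (N + 2) ^ a ≤ (N + 2) ^ max a b := Nat.pow_le_pow_right (by omega) (le_max_left _ _)
  have h2 : (N + 2) ^ b ≤ (N + 2) ^ max a b := Nat.pow_le_pow_right (by omega) (le_max_right _ _)
  have h3 : (N + 2) ^ max a b * 2 ≤ (N + 2) ^ max a b * (N + 2) :=
    Nat.mul_le_mul_left _ (by omega)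
  rw [pow_succ]
  omega

lemma NatExpr.IsBound.exists_eval_le {e : NatExpr} (he : e.IsBound) :
    ∃ k, ∀ (m N : ℕ) (s : State m), m ≤ N → (∀ i, s.nat 0 i ≤ N) → e.eval s ≤ (N + 2) ^ k := by
  induction e with
  | lit k => exact ⟨k, fun m N s _ _ => le_add_two_pow k N⟩
  | numSets => exact ⟨1, fun m N s hm _ => by simp only [NatExpr.eval, pow_one]; omega⟩
  | read a i =>
    refine ⟨1, fun m N s _ hs => ?_⟩
    simp only [NatExpr.IsBound] at he
    subst he
    simp only [NatExpr.eval, pow_one]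
    exact (hs _).trans (by omega)
  | plus e f ihe ihf =>
    obtain ⟨k, hk⟩ := ihe he.1
    obtain ⟨l, hl⟩ := ihf he.2
    exact ⟨max k l + 1, fun m N s hm hs =>
      (add_le_add (hk m N s hm hs) (hl m N s hm hs)).trans (pow_add_pow_le N k l)⟩
  | minus e f ihe _ =>
    obtain ⟨k, hk⟩ := ihe he
    exact ⟨k, fun m N s hm hs => (Nat.sub_le _ _).trans (hk m N s hm hs)⟩

/-- A tame command takes polynomially many steps. -/
lemma Cmd.Tame.exists_steps_le {P : Cmd} (hP : P.Tame) :
    ∃ d, ∀ (m N : ℕ) (E : Env m) (s : State m), m ≤ N → (∀ i, s.nat 0 i ≤ N) →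
      ∀ s' ∈ (P.run E s).support, s'.nat 0 = s.nat 0 ∧ s'.steps ≤ s.steps + (N + 2) ^ d := by
  induction P with
  | skip =>
    refine ⟨1, fun m N E s _ _ s' hs' => ?_⟩
    rw [Cmd.run, PMF.mem_support_pure_iff] at hs'
    subst hs'
    exact ⟨rfl, by simp [State.tick]⟩
  | seq P Q ihP ihQ =>
    obtain ⟨d, hd⟩ := ihP hP.1
    obtain ⟨e, he⟩ := ihQ hP.2
    refine ⟨max d e + 1, fun m N E s hm hs s' hs' => ?_⟩
    rw [Cmd.run, PMF.mem_support_bind_iff] at hs'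
    obtain ⟨s₁, hs₁, hs'⟩ := hs'
    obtain ⟨h1, h2⟩ := hd m N E s hm hs s₁ hs₁
    obtain ⟨h3, h4⟩ := he m N E s₁ hm (h1 ▸ hs) s' hs'
    exact ⟨h3.trans h1, by have := pow_add_pow_le N d e; omega⟩
  | setNat a i e =>
    refine ⟨i.time + e.time + 1, fun m N E s _ _ s' hs' => ?_⟩
    rw [Cmd.run, PMF.mem_support_pure_iff] at hs'
    subst hs'
    have ha : (0 : ℕ) ≠ a := fun h => hP h.symm
    refine ⟨by simp [State.tick, State.writeNat, Function.update_of_ne ha], ?_⟩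
    have := le_add_two_pow (i.time + e.time + 1) N
    simpa [State.tick, State.writeNat] using this
  | setReal a i e =>
    refine ⟨i.time + e.time + 1, fun m N E s _ _ s' hs' => ?_⟩
    rw [Cmd.run, PMF.mem_support_pure_iff] at hs'
    subst hs'
    have := le_add_two_pow (i.time + e.time + 1) N
    exact ⟨rfl, by simpa [State.tick, State.writeReal] using this⟩
  | ite b P Q ihP ihQ =>
    obtain ⟨d, hd⟩ := ihP hP.1
    obtain ⟨e, he⟩ := ihQ hP.2
    refine ⟨max (b.time + 1) (max d e) + 1, fun m N E s hm hs s' hs' => ?_⟩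
    have h0 := le_add_two_pow (b.time + 1) N
    have hd' : (N + 2) ^ d ≤ (N + 2) ^ max d e :=
      Nat.pow_le_pow_right (by omega) (le_max_left _ _)
    have he' : (N + 2) ^ e ≤ (N + 2) ^ max d e :=
      Nat.pow_le_pow_right (by omega) (le_max_right _ _)
    have hsum := pow_add_pow_le N (b.time + 1) (max d e)
    rw [Cmd.run] at hs'
    split_ifs at hs' with hb
    · obtain ⟨h1, h2⟩ := hd m N E (s.tick (b.time + 1)) hm hs s' hs'
      refine ⟨h1, h2.trans ?_⟩
      simp only [State.tick]
      omega
    · obtain ⟨h1, h2⟩ := he m N E (s.tick (b.time + 1)) hm hs s' hs'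
      refine ⟨h1, h2.trans ?_⟩
      simp only [State.tick]
      omega
  | loop e P ihP =>
    obtain ⟨k, hk⟩ := hP.1.exists_eval_le
    obtain ⟨d, hd⟩ := ihP hP.2
    refine ⟨max (e.time + 1) (k + (d + 1)) + 1, fun m N E s hm hs s' hs' => ?_⟩
    -- The body preserves array `0`, so its step bound is the same in every iteration; the exponent
    -- `d + 1` accommodates the one step of loop overhead.
    have key : ∀ (j : ℕ) (s₀ : State m), (∀ i, s₀.nat 0 i ≤ N) → ∀ s' ∈
        ((fun μ : PMF (State m) => μ.bind fun s' => P.run E (s'.tick 1))^[j]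
          (PMF.pure s₀)).support,
        s'.nat 0 = s₀.nat 0 ∧ s'.steps ≤ s₀.steps + j * (N + 2) ^ (d + 1) := by
      intro j
      induction j with
      | zero =>
        intro s₀ _ s' hs'
        rw [Function.iterate_zero, id, PMF.mem_support_pure_iff] at hs'
        subst hs'
        exact ⟨rfl, by omega⟩
      | succ j ih =>
        intro s₀ hs₀ s' hs'
        rw [Function.iterate_succ_apply', PMF.mem_support_bind_iff] at hs'
        obtain ⟨s₁, hs₁, hs'⟩ := hs'
        obtain ⟨h1, h2⟩ := ih s₀ hs₀ s₁ hs₁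
        obtain ⟨h3, h4⟩ := hd m N E (s₁.tick 1) hm (fun i => by
          rw [show (s₁.tick 1).nat 0 = s₁.nat 0 from rfl, h1]
          exact hs₀ i) s' hs'
        refine ⟨h3.trans h1, h4.trans ?_⟩
        have h5 : 1 + (N + 2) ^ d ≤ (N + 2) ^ (d + 1) := by
          have := pow_add_pow_le N 0 d
          simpa using this
        simp only [State.tick]
        rw [Nat.add_mul]
        omega
    rw [Cmd.run] at hs'
    obtain ⟨h1, h2⟩ := key _ (s.tick (e.time + 1)) hs s' hs'
    refine ⟨h1, h2.trans ?_⟩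
    have h3 : e.eval s * (N + 2) ^ (d + 1) ≤ (N + 2) ^ (k + (d + 1)) := by
      rw [pow_add (N + 2) k]
      exact Nat.mul_le_mul_right _ (hk m N s hm hs)
    have h4 := le_add_two_pow (e.time + 1) N
    have h5 := pow_add_pow_le N (e.time + 1) (k + (d + 1))
    simp only [State.tick]
    omega
  | flip p P Q ihP ihQ =>
    obtain ⟨d, hd⟩ := ihP hP.1
    obtain ⟨e, he⟩ := ihQ hP.2
    refine ⟨max (p.time + 1) (max d e) + 1, fun m N E s hm hs s' hs' => ?_⟩
    have h0 := le_add_two_pow (p.time + 1) N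
    have hd' : (N + 2) ^ d ≤ (N + 2) ^ max d e :=
      Nat.pow_le_pow_right (by omega) (le_max_left _ _)
    have he' : (N + 2) ^ e ≤ (N + 2) ^ max d e :=
      Nat.pow_le_pow_right (by omega) (le_max_right _ _)
    have hsum := pow_add_pow_le N (p.time + 1) (max d e)
    rw [Cmd.run, PMF.mem_support_bind_iff] at hs'
    obtain ⟨b, -, hs'⟩ := hs'
    split_ifs at hs'
    · obtain ⟨h1, h2⟩ := hd m N E (s.tick (p.time + 1)) hm hs s' hs'
      refine ⟨h1, h2.trans ?_⟩
      simp only [State.tick]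
      omega
    · obtain ⟨h1, h2⟩ := he m N E (s.tick (p.time + 1)) hm hs s' hs'
      refine ⟨h1, h2.trans ?_⟩
      simp only [State.tick]
      omega
  | buy i =>
    refine ⟨i.time + 1, fun m N E s _ _ s' hs' => ?_⟩
    rw [Cmd.run, PMF.mem_support_pure_iff] at hs'
    subst hs'
    have := le_add_two_pow (i.time + 1) N
    unfold State.buy
    split_ifs <;> exact ⟨rfl, by simpa [State.tick] using this⟩

/-- The program that counts the arrivals in cell `0` of array `0` and executes `body` at each
arrival. -/
def countingProgram (init body : Cmd) : OnlineProgram where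
  init := init
  arrive := .seq (.setNat 0 (.lit 0) (.plus (.read 0 (.lit 0)) (.lit 1))) body

lemma exists_steps_countingProgram_le {init body : Cmd} (hinit : init.Tame) (hbody : body.Tame) :
    ∃ d, ∀ (m : ℕ) (c : Fin m → ℝ) (β : ℝ) (rows : List (Finset (Fin m))),
      ∀ s ∈ ((countingProgram init body).run c β rows).support,
        s.steps ≤ (m + rows.length + 2) ^ d := by
  obtain ⟨d, hd⟩ := hinit.exists_steps_le
  obtain ⟨e, he⟩ := hbody.exists_steps_le
  refine ⟨max d (e + 4) + 1, fun m c β rows s hs => ?_⟩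
  have key : ∀ l : List (Finset (Fin m)), l.length ≤ rows.length →
      ∀ s ∈ ((countingProgram init body).run c β l).support,
      (∀ i, s.nat 0 i ≤ l.length) ∧ s.steps ≤ (m + rows.length + 2) ^ d +
        l.length * ((m + rows.length + 2) ^ e + 8) := by
    intro l
    induction l using List.reverseRecOn with
    | nil =>
      intro _ s hs
      obtain ⟨h1, h2⟩ := hd m (m + rows.length) ⟨c, β, ∅⟩ (State.start m) (by omega)
        (fun i => Nat.zero_le _) s hs
      exact ⟨fun i => by rw [h1]; exact le_rfl, by simpa [State.start] using h2⟩
    | append_singleton l a ih =>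
      intro hl s hs
      simp only [List.length_append, List.length_singleton] at hl ⊢
      rw [OnlineProgram.run, List.foldl_append, List.foldl_cons, List.foldl_nil,
        PMF.mem_support_bind_iff] at hs
      obtain ⟨s₁, hs₁, hs⟩ := hs
      obtain ⟨h1, h2⟩ := ih (by omega) s₁ hs₁
      simp only [countingProgram, Cmd.run, PMF.pure_bind] at hs
      obtain ⟨h3, h4⟩ := he m (m + rows.length) ⟨c, β, a⟩ _ (by omega) (fun i => by
        simp only [State.tick, State.writeNat, Function.update_self, NatExpr.eval]
        by_cases hi : i = 0
        · subst hi
          rw [Function.update_self]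
          have := h1 0
          omega
        · rw [Function.update_of_ne hi]
          exact (h1 i).trans (by omega)) s hs
      constructor
      · intro i
        rw [h3]
        simp only [State.tick, State.writeNat, Function.update_self, NatExpr.eval]
        by_cases hi : i = 0
        · subst hi
          rw [Function.update_self]
          have := h1 0
          omega
        · rw [Function.update_of_ne hi]
          exact (h1 i).trans (by omega)
      · simp only [State.tick, State.writeNat, NatExpr.time] at h4
        rw [Nat.add_mul]
        omega
  obtain ⟨-, h⟩ := key rows le_rfl s hs
  refine h.trans ((add_le_add_right ?_ _).trans (pow_add_pow_le _ d (e + 4)))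
  have h1 : 1 ≤ (m + rows.length + 2) ^ e := Nat.one_le_pow _ _ (by omega)
  have h2 : (m + rows.length + 2) ^ (e + 4) =
      (m + rows.length + 2) ^ e * (m + rows.length + 2) ^ 4 := pow_add _ _ _
  have h3 : rows.length * 9 ≤ (m + rows.length + 2) ^ 4 := by
    set M := m + rows.length + 2 with hM
    have h4 : 8 ≤ M ^ 3 := by
      calc 8 = 2 ^ 3 := rfl
        _ ≤ M ^ 3 := Nat.pow_le_pow_left (by omega) 3
    -- For `M = 2` the factor `9` exceeds `M ^ 3 = 8`, but then there are no rows.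
    by_cases h5 : M = 2
    · have : rows.length = 0 := by omega
      simp [this]
    · have h6 : 27 ≤ M ^ 3 := by
        calc 27 = 3 ^ 3 := rfl
          _ ≤ M ^ 3 := Nat.pow_le_pow_left (by omega) 3
      calc rows.length * 9 ≤ M * M ^ 3 := Nat.mul_le_mul (by omega) (by omega)
        _ = M ^ 4 := by ring
  calc rows.length * ((m + rows.length + 2) ^ e + 8)
      ≤ rows.length * ((m + rows.length + 2) ^ e * 9) := Nat.mul_le_mul_left _ (by omega)
    _ = (m + rows.length + 2) ^ e * (rows.length * 9) := by ring
    _ ≤ _ := by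
      rw [h2]
      exact Nat.mul_le_mul_left _ h3

/-! ### Semantics without step counts -/

def State.erase (s : State m) : State m := { s with steps := 0 }

lemma NatExpr.eval_congr {s t : State m} (h : s.nat = t.nat) (e : NatExpr) :
    e.eval s = e.eval t := by
  induction e with
  | lit k => rfl
  | numSets => rfl
  | read a i ih => simp only [NatExpr.eval, ih, h]
  | plus e f ihe ihf => simp only [NatExpr.eval, ihe, ihf]
  | minus e f ihe ihf => simp only [NatExpr.eval, ihe, ihf]

lemma RealExpr.eval_congr {s t : State m} (E : Env m) (h : s.nat = t.nat) (h' : s.real = t.real)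
    (e : RealExpr) : e.eval E s = e.eval E t := by
  induction e with
  | lit q => rfl
  | guess => rfl
  | cost i => simp only [RealExpr.eval, NatExpr.eval_congr h i]
  | read a i => simp only [RealExpr.eval, NatExpr.eval_congr h i, h']
  | plus e f ihe ihf => simp only [RealExpr.eval, ihe, ihf]
  | minus e f ihe ihf => simp only [RealExpr.eval, ihe, ihf]
  | times e f ihe ihf => simp only [RealExpr.eval, ihe, ihf]
  | quot e f ihe ihf => simp only [RealExpr.eval, ihe, ihf]
  | expo e ihe => simp only [RealExpr.eval, ihe]

lemma Cond.holds_congr {s t : State m} (E : Env m) (h : s.nat = t.nat) (h' : s.real = t.real)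
    (b : Cond) : b.Holds E s ↔ b.Holds E t := by
  induction b with
  | natLt e f => simp only [Cond.Holds, NatExpr.eval_congr h]
  | realLt e f => simp only [Cond.Holds, RealExpr.eval_congr E h h']
  | mem i => simp only [Cond.Holds, NatExpr.eval_congr h]
  | neg b ih => simp only [Cond.Holds, ih]
  | conj b b' ih ih' => simp only [Cond.Holds, ih, ih']

open Classical in
/-- The law of the state after the execution of a command, without counting the steps. -/
noncomputable def Cmd.erasedRun (E : Env m) : Cmd → State m → PMF (State m)
  | skip, s => PMF.pure s
  | seq P Q, s => (P.erasedRun E s).bind (Q.erasedRun E)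
  | setNat a i e, s => PMF.pure (s.writeNat a (i.eval s) (e.eval s))
  | setReal a i e, s => PMF.pure (s.writeReal a (i.eval s) (e.eval E s))
  | ite b P Q, s => if b.Holds E s then P.erasedRun E s else Q.erasedRun E s
  | loop e P, s => (fun μ => μ.bind (P.erasedRun E))^[e.eval s] (PMF.pure s)
  | flip p P Q, s =>
      (coin (p.eval E s)).bind fun b => if b then P.erasedRun E s else Q.erasedRun E s
  | buy i, s => PMF.pure (s.buy (i.eval s))

/-- No expression or condition reads the step counter, so forgetting it commutes with execution. -/
lemma Cmd.map_erase_run (E : Env m) (P : Cmd) (s : State m) :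
    (P.run E s).map State.erase = P.erasedRun E s.erase := by
  induction P generalizing s with
  | skip => simp [Cmd.run, Cmd.erasedRun, PMF.pure_map, State.tick, State.erase]
  | seq P Q ihP ihQ =>
    rw [Cmd.run, Cmd.erasedRun, PMF.map_bind, ← ihP, PMF.bind_map]
    congr 1
    funext s'
    exact ihQ s'
  | setNat a i e =>
    rw [Cmd.run, Cmd.erasedRun, PMF.pure_map, NatExpr.eval_congr (s := s.erase) (t := s) rfl i,
      NatExpr.eval_congr (s := s.erase) (t := s) rfl e]
    rfl
  | setReal a i e =>
    rw [Cmd.run, Cmd.erasedRun, PMF.pure_map, NatExpr.eval_congr (s := s.erase) (t := s) rfl i,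
      RealExpr.eval_congr (s := s.erase) (t := s) E rfl rfl]
    rfl
  | ite b P Q ihP ihQ =>
    rw [Cmd.run, Cmd.erasedRun]
    have hb : b.Holds E s.erase ↔ b.Holds E s :=
      Cond.holds_congr (s := s.erase) (t := s) E rfl rfl b
    by_cases h : b.Holds E s
    · rw [if_pos h, if_pos (hb.2 h), ihP]
      rfl
    · rw [if_neg h, if_neg fun h' => h (hb.1 h'), ihQ]
      rfl
  | loop e P ihP =>
    have key : ∀ (j : ℕ) (s₀ : State m),
        ((fun μ : PMF (State m) => μ.bind fun s' => P.run E (s'.tick 1))^[j]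
          (PMF.pure s₀)).map State.erase =
        (fun μ => μ.bind (P.erasedRun E))^[j] (PMF.pure s₀.erase) := by
      intro j
      induction j with
      | zero => intro s₀; simp [PMF.pure_map]
      | succ j ih =>
        intro s₀
        rw [Function.iterate_succ_apply', Function.iterate_succ_apply', ← ih, PMF.map_bind,
          PMF.bind_map]
        congr 1
        funext s'
        exact ihP (s'.tick 1)
    rw [Cmd.run, Cmd.erasedRun, key, NatExpr.eval_congr (s := s.erase) (t := s) rfl]
    rfl
  | flip p P Q ihP ihQ =>
    rw [Cmd.run, Cmd.erasedRun, PMF.map_bind,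
      RealExpr.eval_congr (s := s.erase) (t := s) E rfl rfl]
    congr 1
    funext b
    cases b
    · exact ihQ (s.tick (p.time + 1))
    · exact ihP (s.tick (p.time + 1))
  | buy i =>
    rw [Cmd.run, Cmd.erasedRun, PMF.pure_map, NatExpr.eval_congr (s := s.erase) (t := s) rfl]
    unfold State.buy
    split_ifs <;> rfl

/-! ### Deterministic commands -/

def Cmd.Deterministic : Cmd → Prop
  | seq P Q => P.Deterministic ∧ Q.Deterministic
  | ite _ P Q => P.Deterministic ∧ Q.Deterministic
  | loop _ P => P.Deterministic
  | flip _ _ _ => False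
  | _ => True

open Classical in
/-- The state after the execution of a deterministic command. -/
noncomputable def Cmd.exec (E : Env m) : Cmd → State m → State m
  | skip, s => s
  | seq P Q, s => Q.exec E (P.exec E s)
  | setNat a i e, s => s.writeNat a (i.eval s) (e.eval s)
  | setReal a i e, s => s.writeReal a (i.eval s) (e.eval E s)
  | ite b P Q, s => if b.Holds E s then P.exec E s else Q.exec E s
  | loop e P, s => (P.exec E)^[e.eval s] s
  | flip _ _ _, s => s
  | buy i, s => s.buy (i.eval s)

lemma Cmd.Deterministic.erasedRun_eq {P : Cmd} (hP : P.Deterministic) (E : Env m) (s : State m) :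
    P.erasedRun E s = PMF.pure (P.exec E s) := by
  induction P generalizing s with
  | seq P Q ihP ihQ => rw [Cmd.erasedRun, ihP hP.1, PMF.pure_bind, ihQ hP.2, Cmd.exec]
  | ite b P Q ihP ihQ =>
    rw [Cmd.erasedRun, Cmd.exec]
    split_ifs
    exacts [ihP hP.1 s, ihQ hP.2 s]
  | loop e P ihP =>
    rw [Cmd.erasedRun, Cmd.exec]
    induction e.eval s with
    | zero => rfl
    | succ j ih => rw [Function.iterate_succ_apply', ih, PMF.pure_bind, ihP hP,
        Function.iterate_succ_apply']
  | flip => exact hP.elim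
  | _ => rfl

/-- The arrays of naturals that the command may write. -/
def Cmd.natArrays : Cmd → Finset ℕ
  | seq P Q => P.natArrays ∪ Q.natArrays
  | setNat a _ _ => {a}
  | ite _ P Q => P.natArrays ∪ Q.natArrays
  | loop _ P => P.natArrays
  | flip _ P Q => P.natArrays ∪ Q.natArrays
  | _ => ∅

/-- The arrays of reals that the command may write. -/
def Cmd.realArrays : Cmd → Finset ℕ
  | seq P Q => P.realArrays ∪ Q.realArrays
  | setReal a _ _ => {a}
  | ite _ P Q => P.realArrays ∪ Q.realArrays
  | loop _ P => P.realArrays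
  | flip _ P Q => P.realArrays ∪ Q.realArrays
  | _ => ∅

/-- The command buys no sets. -/
def Cmd.BuysNothing : Cmd → Prop
  | seq P Q => P.BuysNothing ∧ Q.BuysNothing
  | ite _ P Q => P.BuysNothing ∧ Q.BuysNothing
  | loop _ P => P.BuysNothing
  | flip _ P Q => P.BuysNothing ∧ Q.BuysNothing
  | buy _ => False
  | _ => True

lemma State.buy_nat (s : State m) (i : ℕ) : (s.buy i).nat = s.nat := by
  unfold State.buy
  split_ifs <;> rfl

lemma State.buy_real (s : State m) (i : ℕ) : (s.buy i).real = s.real := by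
  unfold State.buy
  split_ifs <;> rfl

/-- A syntactic frame rule: what a subroutine leaves untouched can be decided from its text. -/
lemma Cmd.exec_nat (E : Env m) {P : Cmd} {a : ℕ} (h : a ∉ P.natArrays) (s : State m) :
    (P.exec E s).nat a = s.nat a := by
  induction P generalizing s with
  | seq P Q ihP ihQ =>
    simp only [Cmd.natArrays, Finset.mem_union, not_or] at h
    rw [Cmd.exec, ihQ h.2, ihP h.1]
  | setNat b i e =>
    simp only [Cmd.natArrays, Finset.mem_singleton] at h
    simp [Cmd.exec, State.writeNat, Function.update_of_ne h]
  | ite b P Q ihP ihQ =>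
    simp only [Cmd.natArrays, Finset.mem_union, not_or] at h
    rw [Cmd.exec]
    split_ifs
    exacts [ihP h.1 s, ihQ h.2 s]
  | loop e P ihP =>
    rw [Cmd.exec]
    induction e.eval s with
    | zero => rfl
    | succ j ih => rw [Function.iterate_succ_apply', ihP h, ih]
  | buy i => rw [Cmd.exec, State.buy_nat]
  | _ => rfl

lemma Cmd.exec_real (E : Env m) {P : Cmd} {a : ℕ} (h : a ∉ P.realArrays) (s : State m) :
    (P.exec E s).real a = s.real a := by
  induction P generalizing s with
  | seq P Q ihP ihQ =>
    simp only [Cmd.realArrays, Finset.mem_union, not_or] at h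
    rw [Cmd.exec, ihQ h.2, ihP h.1]
  | setReal b i e =>
    simp only [Cmd.realArrays, Finset.mem_singleton] at h
    simp [Cmd.exec, State.writeReal, Function.update_of_ne h]
  | ite b P Q ihP ihQ =>
    simp only [Cmd.realArrays, Finset.mem_union, not_or] at h
    rw [Cmd.exec]
    split_ifs
    exacts [ihP h.1 s, ihQ h.2 s]
  | loop e P ihP =>
    rw [Cmd.exec]
    induction e.eval s with
    | zero => rfl
    | succ j ih => rw [Function.iterate_succ_apply', ihP h, ih]
  | buy i => rw [Cmd.exec, State.buy_real]
  | _ => rfl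

lemma Cmd.exec_bought (E : Env m) {P : Cmd} (h : P.BuysNothing) (s : State m) :
    (P.exec E s).bought = s.bought := by
  induction P generalizing s with
  | seq P Q ihP ihQ => rw [Cmd.exec, ihQ h.2, ihP h.1]
  | ite b P Q ihP ihQ =>
    rw [Cmd.exec]
    split_ifs
    exacts [ihP h.1 s, ihQ h.2 s]
  | loop e P ihP =>
    rw [Cmd.exec]
    induction e.eval s with
    | zero => rfl
    | succ j ih => rw [Function.iterate_succ_apply', ihP h, ih]
  | buy i => exact h.elim
  | _ => rfl

end Machine

namespace Machine

variable {m : ℕ}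

/-! ### Loops over the sets

Layout of the memory. Naturals: `0` number of arrivals, `1` loop index, `2` flags of the bought sets,
`3` rows, `4` start of the current row, `5` end of the rows, `6` covered flag, `7` cheapest set,
`8` start of the lightest row. Reals: `0` fractional vector, `1` guess, `2` cheapest cost,
`3` accumulator, `4` weights of the estimate, `5` smallest weight, `6` estimate, `7` total. -/

def cell (a : ℕ) : NatExpr := .read a (.lit 0)

def realCell (a : ℕ) : RealExpr := .read a (.lit 0)

/-- Executes `P` for every value of the loop index below the number of sets. -/
def forEach (P : Cmd) : Cmd :=
  .seq (.setNat 1 (.lit 0) (.lit 0))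
    (.loop .numSets (.seq P (.setNat 1 (.lit 0) (.plus (cell 1) (.lit 1)))))

/-- The invariant rule for loops over the sets. The body may not write array `1`, so the loop index
is known at each iteration. -/
lemma exec_forEach_induction (E : Env m) {P : Cmd} (hP : 1 ∉ P.natArrays)
    (I : ℕ → State m → Prop) (s : State m) (h0 : I 0 (s.writeNat 1 0 0))
    (hstep : ∀ k < m, ∀ t : State m, t.nat 1 0 = k → I k t →
      I (k + 1) ((P.exec E t).writeNat 1 0 (k + 1))) :
    I m ((forEach P).exec E s) := by
  have key : ∀ k ≤ m, I k ((Cmd.exec E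
      (.seq P (.setNat 1 (.lit 0) (.plus (cell 1) (.lit 1)))))^[k] (s.writeNat 1 0 0)) ∧
      ((Cmd.exec E (.seq P (.setNat 1 (.lit 0) (.plus (cell 1) (.lit 1)))))^[k]
        (s.writeNat 1 0 0)).nat 1 0 = k := by
    intro k
    induction k with
    | zero => exact fun _ => ⟨h0, by simp [State.writeNat]⟩
    | succ k ih =>
      intro hk
      obtain ⟨h1, h2⟩ := ih (by omega)
      rw [Function.iterate_succ_apply']
      generalize (Cmd.exec E (.seq P (.setNat 1 (.lit 0) (.plus (cell 1) (.lit 1)))))^[k]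
        (s.writeNat 1 0 0) = t at h1 h2
      have h3 : Cmd.exec E (.seq P (.setNat 1 (.lit 0) (.plus (cell 1) (.lit 1)))) t =
          (P.exec E t).writeNat 1 0 (k + 1) := by
        simp only [Cmd.exec, NatExpr.eval, cell]
        rw [Cmd.exec_nat E hP, h2]
      rw [h3]
      exact ⟨hstep k (by omega) t h2 h1, by simp [State.writeNat]⟩
  exact (key m le_rfl).1

lemma sum_ite_lt_succ (F : Fin m → ℝ) {k : ℕ} (hk : k < m) :
    ∑ S : Fin m, (if (S : ℕ) < k + 1 then F S else 0) =
      ∑ S : Fin m, (if (S : ℕ) < k then F S else 0) + F ⟨k, hk⟩ := by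
  have h : F ⟨k, hk⟩ = ∑ S : Fin m, if S = ⟨k, hk⟩ then F S else 0 := by simp
  rw [h, ← Finset.sum_add_distrib]
  refine Finset.sum_congr rfl fun S _ => ?_
  by_cases h1 : (S : ℕ) < k
  · have h2 : S ≠ ⟨k, hk⟩ := fun h => by simp [h] at h1
    simp [h1, h2, Nat.lt_succ_of_lt h1]
  · by_cases h2 : S = ⟨k, hk⟩
    · subst h2
      simp
    · have h3 : ¬ (S : ℕ) < k + 1 := fun h3 => h2 (Fin.ext (by simp; omega))
      simp [h1, h2, h3]

/-- Sums `e` over the indices that satisfy `b` in the accumulator. -/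
def accumulate (b : Cond) (e : RealExpr) : Cmd :=
  .seq (.setReal 3 (.lit 0) (.lit 0))
    (forEach (.ite b (.setReal 3 (.lit 0) (.plus (realCell 3) e)) .skip))

/-- The condition and the summand are evaluated in intermediate states, which are known to agree
with `s` except for the loop index and the accumulator. -/
lemma exec_accumulate (E : Env m) {b : Cond} {e : RealExpr} {s : State m} (A : Finset (Fin m))
    (f : Fin m → ℝ) (h : ∀ (S : Fin m) (t : State m), t.nat 1 0 = S → (∀ a ≠ 1, t.nat a = s.nat a) →
      (∀ k ≠ 3, t.real k = s.real k) → (b.Holds E t ↔ S ∈ A) ∧ e.eval E t = f S) :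
    ((accumulate b e).exec E s).real 3 0 = ∑ S ∈ A, f S := by
  have key := exec_forEach_induction E (P := .ite b (.setReal 3 (.lit 0) (.plus (realCell 3) e)) .skip)
    (by simp [Cmd.natArrays]) (fun k t => (∀ a ≠ 1, t.nat a = s.nat a) ∧
      (∀ k ≠ 3, t.real k = s.real k) ∧
      t.real 3 0 = ∑ S : Fin m, if (S : ℕ) < k then (if S ∈ A then f S else 0) else 0)
    (Cmd.exec E (.setReal 3 (.lit 0) (.lit 0)) s) ?_ ?_
  · rw [accumulate, Cmd.exec, key.2.2]
    simp
  · refine ⟨fun a ha => ?_, fun k hk => ?_, ?_⟩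
    · simp [Cmd.exec, State.writeNat, State.writeReal, Function.update_of_ne ha]
    · simp [Cmd.exec, State.writeNat, State.writeReal, Function.update_of_ne hk]
    · simp [Cmd.exec, State.writeNat, State.writeReal, NatExpr.eval, RealExpr.eval]
  · rintro k hk t ht ⟨h1, h2, h3⟩
    obtain ⟨h4, h5⟩ := h ⟨k, hk⟩ t ht h1 h2
    rw [sum_ite_lt_succ _ hk]
    by_cases hb : b.Holds E t
    · rw [Cmd.exec, if_pos hb, if_pos (h4.1 hb), ← h3, ← h5]
      refine ⟨fun a ha => ?_, fun k hk => ?_, ?_⟩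
      · simp [Cmd.exec, State.writeNat, State.writeReal, Function.update_of_ne ha, h1 a ha]
      · simp [Cmd.exec, State.writeNat, State.writeReal, Function.update_of_ne hk, h2 k hk]
      · simp [Cmd.exec, State.writeNat, State.writeReal, NatExpr.eval, RealExpr.eval, realCell]
    · rw [Cmd.exec, if_neg hb, if_neg fun h => hb (h4.2 h), ← h3]
      refine ⟨fun a ha => ?_, h2, by simp [Cmd.exec, State.writeNat]⟩
      simp [Cmd.exec, State.writeNat, Function.update_of_ne ha, h1 a ha]

/-- Writes `e` to the cells of the array `k` at the indices that satisfy `b`. -/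
def mapArray (k : ℕ) (b : Cond) (e : RealExpr) : Cmd :=
  forEach (.ite b (.setReal k (cell 1) e) .skip)

/-- When its turn comes, an entry still has its old value. So `e` may read the very cell that it
overwrites, as the in-place updates do. -/
lemma exec_mapArray (E : Env m) {k : ℕ} {b : Cond} {e : RealExpr} {s : State m}
    (A : Finset (Fin m)) (f : Fin m → ℝ) (h : ∀ (S : Fin m) (t : State m), t.nat 1 0 = S →
      (∀ a ≠ 1, t.nat a = s.nat a) → (∀ j ≠ k, t.real j = s.real j) → t.real k S = s.real k S →
        (b.Holds E t ↔ S ∈ A) ∧ (S ∈ A → e.eval E t = f S)) (S : Fin m) :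
    ((mapArray k b e).exec E s).real k S = if S ∈ A then f S else s.real k S := by
  have key := exec_forEach_induction E (P := .ite b (.setReal k (cell 1) e) .skip)
    (by simp [Cmd.natArrays]) (fun i t => (∀ a ≠ 1, t.nat a = s.nat a) ∧
      (∀ j ≠ k, t.real j = s.real j) ∧
      ∀ S : Fin m, t.real k S = if S ∈ A ∧ (S : ℕ) < i then f S else s.real k S) s ?_ ?_
  · rw [mapArray, key.2.2 S]
    simp
  · refine ⟨fun a ha => ?_, fun j hj => rfl, by simp [State.writeNat]⟩
    simp [State.writeNat, Function.update_of_ne ha]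
  · rintro i hi t ht ⟨h1, h2, h3⟩
    obtain ⟨h4, h5⟩ := h ⟨i, hi⟩ t ht h1 h2 ((h3 ⟨i, hi⟩).trans (if_neg (by simp)))
    by_cases hb : b.Holds E t
    · rw [Cmd.exec, if_pos hb]
      refine ⟨fun a ha => ?_, fun j hj => ?_, fun S => ?_⟩
      · simp [Cmd.exec, State.writeNat, State.writeReal, Function.update_of_ne ha, h1 a ha]
      · simp [Cmd.exec, State.writeNat, State.writeReal, Function.update_of_ne hj, h2 j hj]
      · simp only [Cmd.exec, State.writeNat, State.writeReal, Function.update_self, NatExpr.eval,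
          cell, ht, h5 (h4.1 hb)]
        by_cases hS : S = ⟨i, hi⟩
        · subst hS
          simp [h4.1 hb]
        · have hne : (S : ℕ) ≠ i := fun h => hS (Fin.ext h)
          have hlt : (S : ℕ) < i + 1 ↔ (S : ℕ) < i := by omega
          rw [Function.update_of_ne hne, h3]
          simp only [hlt]
    · rw [Cmd.exec, if_neg hb]
      refine ⟨fun a ha => ?_, h2, fun S => ?_⟩
      · simp [Cmd.exec, State.writeNat, Function.update_of_ne ha, h1 a ha]
      · have hS : (S ∈ A ∧ (S : ℕ) < i + 1) ↔ (S ∈ A ∧ (S : ℕ) < i) := by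
          constructor
          · rintro ⟨hA, hlt⟩
            refine ⟨hA, ?_⟩
            by_contra hge
            have : S = ⟨i, hi⟩ := Fin.ext (by simp; omega)
            exact hb (h4.2 (this ▸ hA))
          · rintro ⟨hA, hlt⟩
            exact ⟨hA, by omega⟩
        simp only [Cmd.exec, State.writeNat, hS]
        exact h3 S

/-! ### Subroutines -/

/-- The first `m` entries of an array of reals. -/
def State.vec (s : State m) (k : ℕ) : Fin m → ℝ := fun S => s.real k S

lemma vec_congr {s t : State m} {k : ℕ} (h : t.real k = s.real k) : t.vec k = s.vec k := by
  funext S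
  simp only [State.vec, h]

/-- The row that is stored from the given address on. -/
def State.rowAt (s : State m) (p : ℕ) : Finset (Fin m) :=
  Finset.univ.filter fun S => 0 < s.nat 3 (p + S)

def State.currentRow (s : State m) : Finset (Fin m) := s.rowAt (s.nat 4 0)

def inRow : Cond := .natLt (.lit 0) (.read 3 (.plus (cell 4) (cell 1)))

def always : Cond := .natLt (.lit 0) (.lit 1)

lemma inRow_holds (E : Env m) {s t : State m} {S : Fin m} (h1 : t.nat 1 0 = S)
    (h : ∀ a ≠ 1, t.nat a = s.nat a) : inRow.Holds E t ↔ S ∈ s.currentRow := by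
  simp [inRow, Cond.Holds, NatExpr.eval, cell, State.currentRow, State.rowAt, h1, h 3, h 4]

lemma always_holds (E : Env m) (t : State m) : always.Holds E t := by
  simp [always, Cond.Holds, NatExpr.eval]

lemma eval_cost {E : Env m} {t : State m} {S : Fin m} (h : t.nat 1 0 = S) :
    (RealExpr.cost (cell 1)).eval E t = E.cost S := by
  simp [RealExpr.eval, NatExpr.eval, cell, h]

def sumRow (k : ℕ) : Cmd := accumulate inRow (.read k (cell 1))

lemma exec_sumRow (E : Env m) (s : State m) {k : ℕ} (hk : k ≠ 3) :
    ((sumRow k).exec E s).real 3 0 = ∑ S ∈ s.currentRow, s.vec k S := by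
  refine exec_accumulate E _ _ fun S t ht h1 h2 => ⟨inRow_holds E ht h1, ?_⟩
  simp [RealExpr.eval, NatExpr.eval, cell, ht, h2 k hk, State.vec]

def sumAll (k : ℕ) : Cmd := accumulate always (.read k (cell 1))

lemma exec_sumAll (E : Env m) (s : State m) {k : ℕ} (hk : k ≠ 3) :
    ((sumAll k).exec E s).real 3 0 = ∑ S, s.vec k S := by
  refine exec_accumulate E _ _ fun S t ht h1 h2 => ⟨by simp [always_holds], ?_⟩
  simp [RealExpr.eval, NatExpr.eval, cell, ht, h2 k hk, State.vec]

def sumCosts : Cmd := accumulate always (.cost (cell 1))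

lemma exec_sumCosts (E : Env m) (s : State m) : (sumCosts.exec E s).real 3 0 = ∑ S, E.cost S :=
  exec_accumulate E _ _ fun _ _ ht _ _ => ⟨by simp [always_holds], eval_cost ht⟩

def sumWeightedCosts (k : ℕ) : Cmd :=
  accumulate always (.times (.cost (cell 1)) (.read k (cell 1)))

lemma exec_sumWeightedCosts (E : Env m) (s : State m) {k : ℕ} (hk : k ≠ 3) :
    ((sumWeightedCosts k).exec E s).real 3 0 = ∑ S, E.cost S * s.vec k S := by
  refine exec_accumulate E _ _ fun S t ht h1 h2 => ⟨by simp [always_holds], ?_⟩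
  rw [RealExpr.eval, eval_cost ht]
  simp [RealExpr.eval, NatExpr.eval, cell, ht, h2 k hk, State.vec]

/-- Multiplies the entries of the current row by the exponential factors. -/
def scaleRow (k : ℕ) : Cmd :=
  mapArray k inRow (.times (.read k (cell 1)) (.expo (.quot (realCell 2) (.cost (cell 1)))))

lemma exec_scaleRow (E : Env m) (s : State m) {k : ℕ} (hk : k ≠ 2)
    (hκ : s.real 2 0 = LearnOrCover.kappa E.cost s.currentRow) :
    ((scaleRow k).exec E s).vec k =
      LearnOrCover.scaleUp E.cost (s.vec k) s.currentRow := by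
  funext S
  have h := exec_mapArray E (k := k) (b := inRow)
    (e := .times (.read k (cell 1)) (.expo (.quot (realCell 2) (.cost (cell 1))))) (s := s)
    s.currentRow (fun S => s.vec k S * Real.exp (LearnOrCover.kappa E.cost s.currentRow / E.cost S))
    (fun S t ht h1 h2 h3 => ⟨inRow_holds E ht h1, fun _ => by
      rw [RealExpr.eval, RealExpr.eval, RealExpr.eval, RealExpr.eval, eval_cost ht, realCell,
        RealExpr.eval, h2 2 hk.symm]
      simp only [NatExpr.eval, cell, ht, h3, hκ]
      rfl⟩) S
  rw [LearnOrCover.scaleUp, State.vec, scaleRow, h]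
  split_ifs <;> simp [State.vec]

/-- Writes the initial weights for the guess in cell `0` of array `1`. -/
def writeInitialWeights : Cmd :=
  .seq (accumulate (.neg (.realLt (realCell 1) (.cost (cell 1)))) (.lit 1))
    (.seq (mapArray 0 (.neg (.realLt (realCell 1) (.cost (cell 1))))
        (.quot (realCell 1) (.times (.cost (cell 1)) (realCell 3))))
      (mapArray 0 (.realLt (realCell 1) (.cost (cell 1))) (.lit 0)))

lemma exec_writeInitialWeights (E : Env m) (s : State m) :
    (writeInitialWeights.exec E s).vec 0 = LearnOrCover.initWeights E.cost (s.real 1 0) := by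
  funext S
  simp only [writeInitialWeights, Cmd.exec]
  set s₁ := (accumulate (.neg (.realLt (realCell 1) (.cost (cell 1)))) (.lit 1)).exec E s with hs₁
  have hB₁ : s₁.real 1 = s.real 1 := Cmd.exec_real E (by decide) s
  have hcard : s₁.real 3 0 = ((Finset.univ.filter fun T => E.cost T ≤ s.real 1 0).card : ℝ) := by
    rw [hs₁, exec_accumulate E (Finset.univ.filter fun T => E.cost T ≤ s.real 1 0) fun _ => 1]
    · simp
    · intro S t ht h1 h2
      refine ⟨?_, by simp [RealExpr.eval]⟩
      rw [Cond.Holds, Cond.Holds, eval_cost ht]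
      simp [RealExpr.eval, realCell, h2 1, NatExpr.eval]
  have h₂ := exec_mapArray E (k := 0) (b := .neg (.realLt (realCell 1) (.cost (cell 1))))
    (e := .quot (realCell 1) (.times (.cost (cell 1)) (realCell 3))) (s := s₁)
    (Finset.univ.filter fun T => E.cost T ≤ s.real 1 0)
    (fun S => s.real 1 0 /
      (E.cost S * ((Finset.univ.filter fun T => E.cost T ≤ s.real 1 0).card : ℝ)))
    (fun S t ht h1 h2 h3 => ⟨by
        rw [Cond.Holds, Cond.Holds, eval_cost ht]
        simp [RealExpr.eval, realCell, h2 1, NatExpr.eval, hB₁], fun _ => by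
      rw [RealExpr.eval, RealExpr.eval, eval_cost ht]
      simp [RealExpr.eval, realCell, h2 1, h2 3, NatExpr.eval, hB₁, hcard]⟩) S
  set s₂ := (mapArray 0 (.neg (.realLt (realCell 1) (.cost (cell 1))))
        (.quot (realCell 1) (.times (.cost (cell 1)) (realCell 3)))).exec E s₁
  have hB₂ : s₂.real 1 = s.real 1 := (Cmd.exec_real E (by decide) s₁).trans hB₁
  -- The second pass clears the unaffordable sets, whose entries may be left over from an earlier
  -- phase.
  rw [State.vec, exec_mapArray E (s := s₂) (Finset.univ.filter fun T => s.real 1 0 < E.cost T)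
    (fun _ => 0), h₂]
  · rw [LearnOrCover.initWeights]
    by_cases hS : E.cost S ≤ s.real 1 0
    · simp [hS, not_lt.2 hS]
    · simp [hS, not_le.1 hS]
  · intro S t ht h1 h2 h3
    refine ⟨?_, by simp [RealExpr.eval]⟩
    rw [Cond.Holds, eval_cost ht]
    simp [RealExpr.eval, realCell, h2 1, NatExpr.eval, hB₂]

/-- Updates the fractional vector for the current row. -/
def updateVector : Cmd :=
  .seq (sumRow 0) (.ite (.realLt (realCell 3) (.lit 1))
    (.seq (scaleRow 0) (.seq (sumWeightedCosts 0)
      (.seq (.setReal 3 (.lit 0) (.quot (realCell 3) (realCell 1)))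
        (mapArray 0 always (.quot (.read 0 (cell 1)) (realCell 3)))))) .skip)

lemma currentRow_congr {s t : State m} (h3 : t.nat 3 = s.nat 3) (h4 : t.nat 4 = s.nat 4) :
    t.currentRow = s.currentRow := by
  simp [State.currentRow, State.rowAt, h3, h4]

lemma exec_updateVector (E : Env m) (s : State m)
    (hκ : s.real 2 0 = LearnOrCover.kappa E.cost s.currentRow) :
    (updateVector.exec E s).vec 0 =
      LearnOrCover.updateWeights E.cost (s.real 1 0) (s.vec 0) s.currentRow := by
  simp only [updateVector]
  rw [Cmd.exec, Cmd.exec]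
  have hsum := exec_sumRow E s (k := 0) (by decide)
  set s₁ := (sumRow 0).exec E s with hs₁
  have hx₁ : s₁.vec 0 = s.vec 0 :=
    vec_congr (Cmd.exec_real E (by decide) s)
  have hr₁ : s₁.currentRow = s.currentRow :=
    currentRow_congr (Cmd.exec_nat E (by decide) s) (Cmd.exec_nat E (by decide) s)
  have hB₁ : s₁.real 1 = s.real 1 := Cmd.exec_real E (by decide) s
  have hκ₁ : s₁.real 2 = s.real 2 := Cmd.exec_real E (by decide) s
  have hcond : Cond.Holds E s₁ (.realLt (realCell 3) (.lit 1)) ↔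
      ∑ S ∈ s.currentRow, s.vec 0 S < 1 := by
    simp [Cond.Holds, RealExpr.eval, realCell, NatExpr.eval, hsum]
  rw [LearnOrCover.updateWeights]
  by_cases hlt : ∑ S ∈ s.currentRow, s.vec 0 S < 1
  swap
  · rw [if_neg (fun h => hlt (hcond.1 h)), if_neg hlt, Cmd.exec, hx₁]
  rw [if_pos (hcond.2 hlt), if_pos hlt, Cmd.exec, Cmd.exec, Cmd.exec]
  have hscale := exec_scaleRow E s₁ (k := 0) (by decide) (by rw [hκ₁, hκ, hr₁])
  rw [hx₁, hr₁] at hscale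
  set s₂ := (scaleRow 0).exec E s₁
  have hB₂ : s₂.real 1 = s.real 1 := (Cmd.exec_real E (by decide) s₁).trans hB₁
  have hZ := exec_sumWeightedCosts E s₂ (k := 0) (by decide)
  set s₃ := (sumWeightedCosts 0).exec E s₂
  have hB₃ : s₃.real 1 = s.real 1 := (Cmd.exec_real E (by decide) s₂).trans hB₂
  have hx₃ : s₃.real 0 = s₂.real 0 := Cmd.exec_real E (by decide) s₂
  set s₄ := Cmd.exec E (.setReal 3 (.lit 0) (.quot (realCell 3) (realCell 1))) s₃ with hs₄
  have hx₄ : s₄.real 0 = s₂.real 0 := (Cmd.exec_real E (by decide) s₃).trans hx₃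
  have hZ₄ : s₄.real 3 0 = (∑ S, E.cost S * s₂.vec 0 S) / s.real 1 0 := by
    simp [hs₄, Cmd.exec, State.writeReal, RealExpr.eval, NatExpr.eval, realCell, hZ, hB₃]
  funext S
  rw [State.vec, exec_mapArray E (s := s₄) Finset.univ
    (fun S => s₂.vec 0 S / ((∑ S, E.cost S * s₂.vec 0 S) / s.real 1 0))]
  · simp [LearnOrCover.normalize, hscale]
  · intro S t ht h1 h2 h3
    refine ⟨by simp [always_holds], fun _ => ?_⟩
    simp only [RealExpr.eval, NatExpr.eval, cell, realCell, ht, h3, h2 3 (by decide), hZ₄, hx₄]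
    rfl

/-- Determines a cheapest set of the current row and its cost. -/
def findCheapest : Cmd :=
  .seq (.setNat 7 (.lit 0) .numSets)
    (forEach (.ite (.conj inRow (.neg (.conj (.natLt (cell 7) .numSets)
        (.neg (.realLt (.cost (cell 1)) (realCell 2))))))
      (.seq (.setReal 2 (.lit 0) (.cost (cell 1))) (.setNat 7 (.lit 0) (cell 1))) .skip))

/-- The value `m` in cell `7` means that no set of the row has been seen. Afterwards only a strictly
cheaper set replaces the candidate, so ties go to the smallest index. -/
lemma exec_findCheapest (E : Env m) (s : State m) (hne : s.currentRow.Nonempty) :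
    (findCheapest.exec E s).real 2 0 = LearnOrCover.kappa E.cost s.currentRow ∧
      ∃ j ∈ s.currentRow, (findCheapest.exec E s).nat 7 0 = j ∧
        LearnOrCover.cheapest E.cost s.currentRow = {j} := by
  have key := exec_forEach_induction E (P := .ite (.conj inRow (.neg (.conj
      (.natLt (cell 7) .numSets) (.neg (.realLt (.cost (cell 1)) (realCell 2))))))
      (.seq (.setReal 2 (.lit 0) (.cost (cell 1))) (.setNat 7 (.lit 0) (cell 1))) .skip)
    (by decide) (fun k t => (∀ a, a ≠ 1 → a ≠ 7 → t.nat a = s.nat a) ∧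
      ((t.nat 7 0 = m ∧ ∀ S ∈ s.currentRow, k ≤ S) ∨
        ∃ j ∈ s.currentRow, (j : ℕ) < k ∧ t.nat 7 0 = j ∧ t.real 2 0 = E.cost j ∧
          ∀ S ∈ s.currentRow, (S : ℕ) < k → E.cost j < E.cost S ∨ (E.cost j = E.cost S ∧ j ≤ S)))
    (Cmd.exec E (.setNat 7 (.lit 0) .numSets) s) ?_ ?_
  · obtain ⟨-, ⟨-, hno⟩ | ⟨j, hj, hjk, h7, h2, hmin⟩⟩ := key
    · obtain ⟨S, hS⟩ := hne
      exact absurd (hno S hS) (not_le.2 S.isLt)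
    · have hche := LearnOrCover.cheapest_eq_singleton hj fun S hS => hmin S hS S.isLt
      refine ⟨?_, j, hj, h7, hche⟩
      rw [findCheapest, Cmd.exec, h2]
      obtain ⟨S, -, hS, hκ⟩ := LearnOrCover.exists_cheapest (c := E.cost) hne
      rw [← hκ, Finset.singleton_injective (hche.symm.trans hS)]
  · refine ⟨fun a h1 h7 => ?_, Or.inl ⟨?_, fun S _ => Nat.zero_le _⟩⟩
    · simp [Cmd.exec, State.writeNat, Function.update_of_ne h1, Function.update_of_ne h7]
    · simp [Cmd.exec, State.writeNat, NatExpr.eval]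
  · rintro k hk t ht ⟨h1, hcase⟩
    have hin : inRow.Holds E t ↔ ⟨k, hk⟩ ∈ s.currentRow := by
      simp [inRow, Cond.Holds, NatExpr.eval, cell, State.currentRow, State.rowAt, ht, h1 3, h1 4]
    have hcost : (RealExpr.cost (cell 1)).eval E t = E.cost ⟨k, hk⟩ :=
      eval_cost (S := ⟨k, hk⟩) ht
    have hlt : ∀ S : Fin m, (S : ℕ) < k + 1 → (S : ℕ) < k ∨ S = ⟨k, hk⟩ := fun S hS => by
      rcases Nat.lt_succ_iff_lt_or_eq.1 hS with h | h
      · exact Or.inl h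
      · exact Or.inr (Fin.ext h)
    by_cases hb : Cond.Holds E t (.conj inRow (.neg (.conj (.natLt (cell 7) .numSets)
        (.neg (.realLt (.cost (cell 1)) (realCell 2))))))
    · rw [Cmd.exec, if_pos hb]
      simp only [Cond.Holds, hcost, hin] at hb
      simp only [RealExpr.eval, NatExpr.eval, cell, realCell] at hb
      refine ⟨fun a h1' h7 => ?_, Or.inr ⟨⟨k, hk⟩, hb.1, Nat.lt_succ_self k, ?_, ?_,
        fun S hS hSk => ?_⟩⟩
      · simp [Cmd.exec, State.writeNat, State.writeReal, Function.update_of_ne h1',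
          Function.update_of_ne h7, h1 a h1' h7]
      · simp [Cmd.exec, State.writeNat, State.writeReal, NatExpr.eval, cell, ht]
      · simp only [Cmd.exec, State.writeNat, State.writeReal, hcost, NatExpr.eval,
          Function.update_self]
      · rcases hlt S hSk with h | h
        · rcases hcase with ⟨-, hno⟩ | ⟨j, hj, hjk, h7, h2, hmin⟩
          · exact absurd (hno S hS) (not_le.2 h)
          · left
            have h3 : E.cost ⟨k, hk⟩ < E.cost j := by
              by_contra h4
              exact hb.2 ⟨h7 ▸ j.isLt, h2 ▸ h4⟩
            rcases hmin S hS h with h5 | h5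
            · exact h3.trans h5
            · exact h3.trans_eq h5.1
        · exact Or.inr ⟨by rw [h], h.ge⟩
    · rw [Cmd.exec, if_neg hb]
      simp only [Cond.Holds, hcost, hin] at hb
      simp only [RealExpr.eval, NatExpr.eval, cell, realCell] at hb
      refine ⟨fun a h1' h7 => ?_, ?_⟩
      · simp [Cmd.exec, State.writeNat, Function.update_of_ne h1', h1 a h1' h7]
      rcases hcase with ⟨h7, hno⟩ | ⟨j, hj, hjk, h7, h2, hmin⟩
      · left
        refine ⟨by simp [Cmd.exec, State.writeNat, h7], fun S hS => ?_⟩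
        by_contra hSk
        rcases hlt S (not_le.1 hSk) with h | h
        · exact absurd (hno S hS) (not_le.2 h)
        · exact hb ⟨h ▸ hS, fun hh => by rw [h7] at hh; exact absurd hh.1 (lt_irrefl m)⟩
      · right
        refine ⟨j, hj, by omega, by simp [Cmd.exec, State.writeNat, h7],
          by simp [Cmd.exec, State.writeNat, h2], fun S hS hSk => ?_⟩
        rcases hlt S hSk with h | h
        · exact hmin S hS h
        · subst h
          have h3 : ¬ E.cost ⟨k, hk⟩ < E.cost j := fun h3 => hb ⟨hS, fun hh => hh.2 (h2 ▸ h3)⟩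
          rcases (not_lt.1 h3).lt_or_eq with h4 | h4
          · exact Or.inl h4
          · exact Or.inr ⟨h4, hjk.le⟩

end Machine

namespace Machine

variable {m : ℕ}

/-! ### One round of LearnOrCover -/

/-- The flags in array `2` mark the sets that have been bought. -/
def State.Flagged (s : State m) : Prop := ∀ S : Fin m, 0 < s.nat 2 S ↔ S ∈ s.bought

/-- Determines whether the current row contains a flagged set. -/
def checkCovered : Cmd :=
  .seq (.setNat 6 (.lit 0) (.lit 0))
    (forEach (.ite (.conj inRow (.natLt (.lit 0) (.read 2 (cell 1))))
      (.setNat 6 (.lit 0) (.lit 1)) .skip))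

lemma exec_checkCovered (E : Env m) (s : State m) :
    0 < (checkCovered.exec E s).nat 6 0 ↔ ∃ S ∈ s.currentRow, 0 < s.nat 2 S := by
  have key := exec_forEach_induction E
    (P := .ite (.conj inRow (.natLt (.lit 0) (.read 2 (cell 1)))) (.setNat 6 (.lit 0) (.lit 1)) .skip)
    (by decide) (fun k t => (∀ a, a ≠ 1 → a ≠ 6 → t.nat a = s.nat a) ∧
      (0 < t.nat 6 0 ↔ ∃ S ∈ s.currentRow, (S : ℕ) < k ∧ 0 < s.nat 2 S))
    (Cmd.exec E (.setNat 6 (.lit 0) (.lit 0)) s) ?_ ?_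
  · rw [checkCovered, Cmd.exec, key.2]
    simp
  · refine ⟨fun a h1 h6 => ?_, ?_⟩
    · simp [Cmd.exec, State.writeNat, Function.update_of_ne h1, Function.update_of_ne h6]
    · simp [Cmd.exec, State.writeNat, NatExpr.eval]
  · rintro k hk t ht ⟨h1, h6⟩
    have hb : Cond.Holds E t (.conj inRow (.natLt (.lit 0) (.read 2 (cell 1)))) ↔
        ⟨k, hk⟩ ∈ s.currentRow ∧ 0 < s.nat 2 k := by
      simp [inRow, Cond.Holds, NatExpr.eval, cell, State.currentRow, State.rowAt, ht, h1 3, h1 4,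
        h1 2]
    have hex : (∃ S ∈ s.currentRow, (S : ℕ) < k + 1 ∧ 0 < s.nat 2 S) ↔
        (∃ S ∈ s.currentRow, (S : ℕ) < k ∧ 0 < s.nat 2 S) ∨
          ⟨k, hk⟩ ∈ s.currentRow ∧ 0 < s.nat 2 k := by
      constructor
      · rintro ⟨S, hS, hSk, hS2⟩
        rcases Nat.lt_succ_iff_lt_or_eq.1 hSk with h | h
        · exact Or.inl ⟨S, hS, h, hS2⟩
        · have : S = ⟨k, hk⟩ := Fin.ext h
          subst this
          exact Or.inr ⟨hS, hS2⟩
      · rintro (⟨S, hS, hSk, hS2⟩ | ⟨hS, hS2⟩)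
        · exact ⟨S, hS, by omega, hS2⟩
        · exact ⟨⟨k, hk⟩, hS, Nat.lt_succ_self k, hS2⟩
    rw [hex, Cmd.exec]
    by_cases h : Cond.Holds E t (.conj inRow (.natLt (.lit 0) (.read 2 (cell 1))))
    · rw [if_pos h]
      refine ⟨fun a h1' h6' => ?_, ?_⟩
      · simp [Cmd.exec, State.writeNat, Function.update_of_ne h1', Function.update_of_ne h6',
          h1 a h1' h6']
      · simp only [hb.1 h, and_self, or_true, iff_true]
        simp [Cmd.exec, State.writeNat, NatExpr.eval]
    · rw [if_neg h]
      refine ⟨fun a h1' h6' => ?_, ?_⟩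
      · simp [Cmd.exec, State.writeNat, Function.update_of_ne h1', h1 a h1' h6']
      · rw [← hb, ← h6]
        simp [Cmd.exec, State.writeNat, h]

/-- Buys every set independently with the probability prescribed by the fractional vector. -/
def sample : Cmd :=
  forEach (.flip (.quot (.times (realCell 2) (.read 0 (cell 1))) (realCell 1))
    (.seq (.buy (cell 1)) (.setNat 2 (cell 1) (.lit 1))) .skip)

/-- The state after `k` rounds of the sampling loop in which the sets in `R` were bought. -/
def State.afterSample (s : State m) (k : ℕ) (R : Finset (Fin m)) : State m :=
  { s with
    nat := Function.update (Function.update s.nat 1 (Function.update (s.nat 1) 0 k)) 2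
      (fun j => if ∃ S ∈ R, (S : ℕ) = j then 1 else s.nat 2 j)
    bought := s.bought ∪ R }

lemma State.afterSample_nat {s : State m} {k : ℕ} {R : Finset (Fin m)} {a : ℕ} (h1 : a ≠ 1)
    (h2 : a ≠ 2) : (s.afterSample k R).nat a = s.nat a := by
  simp [State.afterSample, Function.update_of_ne h1, Function.update_of_ne h2]

lemma State.afterSample_skip (s : State m) (k : ℕ) (R : Finset (Fin m)) :
    (s.afterSample k R).writeNat 1 0 (k + 1) = s.afterSample (k + 1) R := by
  simp only [State.afterSample, State.writeNat, State.mk.injEq, and_true]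
  funext a
  by_cases h1 : a = 1
  · subst h1
    simp
  · by_cases h2 : a = 2
    · subst h2
      simp
    · simp [Function.update_of_ne h1, Function.update_of_ne h2]

lemma State.afterSample_buy (s : State m) {k : ℕ} (hk : k < m) (R : Finset (Fin m)) :
    (((s.afterSample k R).buy k).writeNat 2 k 1).writeNat 1 0 (k + 1) =
      s.afterSample (k + 1) (insert ⟨k, hk⟩ R) := by
  simp only [State.afterSample, State.writeNat, State.buy, dif_pos hk, State.mk.injEq, and_true,
    Finset.union_insert]
  funext a
  by_cases h1 : a = 1
  · subst h1
    simp
  · by_cases h2 : a = 2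
    · subst h2
      funext j
      by_cases hj : j = k
      · subst hj
        simp
      · have hj' : k ≠ j := fun h => hj h.symm
        simp [Function.update_of_ne hj, hj']
    · simp [Function.update_of_ne h1, Function.update_of_ne h2]

/-- The entire machine state after `k` flips is a function of the collection sampled so far. The
loop is therefore the image of the fold over the first `k` sets that defines `sampleSets`. -/
lemma erasedRun_sample (E : Env m) (s : State m) :
    sample.erasedRun E s =
      (LearnOrCover.sampleSets fun S => min (s.real 2 0 * s.vec 0 S / s.real 1 0) 1).map
        (s.afterSample m) := by
  set p : Fin m → ℝ := fun S => s.real 2 0 * s.vec 0 S / s.real 1 0 with hp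
  have hmin : (LearnOrCover.sampleSets fun S => min (p S) 1) = LearnOrCover.sampleSets p := by
    simp only [LearnOrCover.sampleSets, coin_min_one]
  rw [hmin]
  set body : Cmd := .seq (.flip (.quot (.times (realCell 2) (.read 0 (cell 1))) (realCell 1))
    (.seq (.buy (cell 1)) (.setNat 2 (cell 1) (.lit 1))) .skip)
    (.setNat 1 (.lit 0) (.plus (cell 1) (.lit 1))) with hbody
  have hstep : ∀ (k : ℕ) (hk : k < m) (R : Finset (Fin m)),
      body.erasedRun E (s.afterSample k R) =
        ((coin (p ⟨k, hk⟩)).map fun b => if b then insert ⟨k, hk⟩ R else R).map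
          (s.afterSample (k + 1)) := by
    intro k hk R
    have hidx : (s.afterSample k R).nat 1 0 = k := by simp [State.afterSample]
    have hcoin : RealExpr.eval E (s.afterSample k R)
        (.quot (.times (realCell 2) (.read 0 (cell 1))) (realCell 1)) = p ⟨k, hk⟩ := by
      simp only [RealExpr.eval, NatExpr.eval, cell, realCell, hidx]
      rfl
    rw [hbody, Cmd.erasedRun, Cmd.erasedRun, hcoin, PMF.bind_bind, PMF.map_comp,
      ← PMF.bind_pure_comp]
    congr 1
    funext b
    cases b
    · simp only [Bool.false_eq_true, if_false, Cmd.erasedRun, PMF.pure_bind, Function.comp,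
        NatExpr.eval, cell, hidx]
      rw [State.afterSample_skip]
    · have hidx' : ∀ t : State m, ((t.buy k).writeNat 2 k 1).nat 1 = t.nat 1 := fun t => by
        simp [State.writeNat, State.buy_nat]
      simp only [if_true, Cmd.erasedRun, PMF.pure_bind, Function.comp,
        NatExpr.eval, cell, hidx, State.buy_nat, hidx']
      rw [State.afterSample_buy s hk]
  have key : ∀ k ≤ m, (fun μ => μ.bind (body.erasedRun E))^[k] (PMF.pure (s.writeNat 1 0 0)) =
      (((List.finRange m).take k).foldl (fun μ S => μ.bind fun R =>
        (coin (p S)).map fun b => if b then insert S R else R) (PMF.pure ∅)).map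
          (s.afterSample k) := by
    intro k
    induction k with
    | zero =>
      intro _
      rw [Function.iterate_zero, id, List.take_zero, List.foldl_nil, PMF.pure_map]
      congr 1
      simp only [State.afterSample, State.writeNat, Finset.notMem_empty, false_and, exists_false,
        if_false, Finset.union_empty, State.mk.injEq, and_true]
      funext a
      by_cases h2 : a = 2
      · subst h2
        simp
      · simp [Function.update_of_ne h2]
    | succ k ih =>
      intro hk
      have htake : (List.finRange m).take (k + 1) = (List.finRange m).take k ++ [⟨k, hk⟩] := by
        rw [List.take_succ_eq_append_getElem (by simpa using hk)]
        simp
      rw [Function.iterate_succ_apply', ih (by omega), htake, List.foldl_append, List.foldl_cons,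
        List.foldl_nil, PMF.bind_map, PMF.map_bind]
      congr 1
      funext R
      exact hstep k hk R
  have h := key m le_rfl
  rw [List.take_of_length_le (by simp)] at h
  rw [sample, forEach, Cmd.erasedRun, Cmd.erasedRun, PMF.pure_bind, Cmd.erasedRun]
  exact h

/-- Buys the cheapest set of the current row. -/
def buyCheapest : Cmd := .seq (.buy (cell 7)) (.setNat 2 (cell 7) (.lit 1))

/-- One round of LearnOrCover for the current row. -/
def learnRound : Cmd :=
  .seq checkCovered (.ite (.natLt (.lit 0) (cell 6)) .skip
    (.seq findCheapest (.seq sample (.seq updateVector buyCheapest))))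

/-- The state of the algorithm that is represented by the memory. -/
def State.toAlg (s : State m) : LearnOrCover.State m := ⟨s.vec 0, s.bought⟩

/-- The parts of the memory that a round does not change. -/
structure State.SameData (s s' : State m) : Prop where
  rows : s'.nat 3 = s.nat 3
  finish : s'.nat 5 = s.nat 5
  count : s'.nat 0 = s.nat 0
  guess : s'.real 1 = s.real 1

/-- The cheapest set is found before the sampling, which needs its cost, and bought at the end. The
sampling is the only source of randomness; the rest is a function of its outcome. The flags must
mirror the purchases because the machine cannot read what it has bought. -/
lemma erasedRun_learnRound (E : Env m) (s : State m) (hs : s.Flagged)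
    (hne : s.currentRow.Nonempty) :
    (learnRound.erasedRun E s).map State.toAlg =
      LearnOrCover.step E.cost (s.real 1 0) s.toAlg s.currentRow ∧
    ∀ s' ∈ (learnRound.erasedRun E s).support, s'.Flagged ∧ s.SameData s' := by
  have hdet : checkCovered.Deterministic := by simp [checkCovered, forEach, Cmd.Deterministic]
  rw [learnRound, Cmd.erasedRun, hdet.erasedRun_eq, PMF.pure_bind, Cmd.erasedRun]
  have hcheck := exec_checkCovered E s
  have hn₁ : ∀ a, a ≠ 1 → a ≠ 6 → (checkCovered.exec E s).nat a = s.nat a := fun a h1 h6 =>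
    Cmd.exec_nat E (by simp [checkCovered, forEach, Cmd.natArrays, h1, h6]) s
  have hr₁ : ∀ k, (checkCovered.exec E s).real k = s.real k := fun k =>
    Cmd.exec_real E (by simp [checkCovered, forEach, Cmd.realArrays]) s
  have hb₁ : (checkCovered.exec E s).bought = s.bought :=
    Cmd.exec_bought E (by simp [checkCovered, forEach, Cmd.BuysNothing]) s
  set s₁ := checkCovered.exec E s
  have hcond : Cond.Holds E s₁ (.natLt (.lit 0) (cell 6)) ↔ ∃ S ∈ s.bought, S ∈ s.currentRow := by
    rw [show Cond.Holds E s₁ (.natLt (.lit 0) (cell 6)) ↔ 0 < s₁.nat 6 0 from Iff.rfl, hcheck]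
    constructor
    · rintro ⟨S, hS, hS2⟩
      exact ⟨S, (hs S).1 hS2, hS⟩
    · rintro ⟨S, hS, hS2⟩
      exact ⟨S, hS2, (hs S).2 hS⟩
  rw [LearnOrCover.step]
  by_cases hcov : ∃ S ∈ s.bought, S ∈ s.currentRow
  · rw [if_pos (hcond.2 hcov), if_pos (show ∃ S ∈ s.toAlg.bought, S ∈ s.currentRow from hcov),
      Cmd.erasedRun]
    refine ⟨?_, fun s' hs' => ?_⟩
    · rw [PMF.pure_map, State.toAlg, State.toAlg, vec_congr (hr₁ 0), hb₁]
    · rw [PMF.mem_support_pure_iff] at hs'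
      subst hs'
      refine ⟨fun S => ?_, hn₁ 3 (by decide) (by decide), hn₁ 5 (by decide) (by decide),
        hn₁ 0 (by decide) (by decide), hr₁ 1⟩
      rw [hn₁ 2 (by decide) (by decide), hb₁]
      exact hs S
  rw [if_neg fun h => hcov (hcond.1 h),
    if_neg (show ¬ ∃ S ∈ s.toAlg.bought, S ∈ s.currentRow from hcov)]
  have hrow₁ : s₁.currentRow = s.currentRow :=
    currentRow_congr (hn₁ 3 (by decide) (by decide)) (hn₁ 4 (by decide) (by decide))
  have hdet₂ : findCheapest.Deterministic := by simp [findCheapest, forEach, Cmd.Deterministic]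
  obtain ⟨hκ, j, hj, h7, hche⟩ := exec_findCheapest E s₁ (hrow₁ ▸ hne)
  rw [hrow₁] at hκ hj hche
  rw [Cmd.erasedRun, hdet₂.erasedRun_eq, PMF.pure_bind, Cmd.erasedRun, erasedRun_sample,
    PMF.bind_map]
  have hn₂ : ∀ a, a ≠ 1 → a ≠ 6 → a ≠ 7 → (findCheapest.exec E s₁).nat a = s.nat a :=
    fun a h1 h6 h7 => (Cmd.exec_nat E
      (by simp [findCheapest, forEach, Cmd.natArrays, h1, h7]) s₁).trans (hn₁ a h1 h6)
  have hr₂ : ∀ k, k ≠ 2 → (findCheapest.exec E s₁).real k = s.real k := fun k h2 =>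
    (Cmd.exec_real E (by simp [findCheapest, forEach, Cmd.realArrays, h2]) s₁).trans (hr₁ k)
  have hb₂ : (findCheapest.exec E s₁).bought = s.bought :=
    (Cmd.exec_bought E (by simp [findCheapest, forEach, Cmd.BuysNothing]) s₁).trans hb₁
  set s₂ := findCheapest.exec E s₁
  set F : Finset (Fin m) → State m := fun R =>
    buyCheapest.exec E (updateVector.exec E (s₂.afterSample m R)) with hF
  have hdet₃ : (Cmd.seq updateVector buyCheapest).Deterministic := by
    simp [updateVector, buyCheapest, scaleRow, sumRow, sumWeightedCosts, accumulate, mapArray,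
      forEach, Cmd.Deterministic]
  have hfun : (Cmd.erasedRun E (.seq updateVector buyCheapest)) ∘ s₂.afterSample m =
      PMF.pure ∘ F := by
    funext R
    rw [Function.comp, hdet₃.erasedRun_eq]
    rfl
  rw [hfun, PMF.bind_pure_comp]
  have hFspec : ∀ R, (F R).toAlg = ⟨LearnOrCover.updateWeights E.cost (s.real 1 0) s.toAlg.x
      s.currentRow, s.toAlg.bought ∪ R ∪ LearnOrCover.cheapest E.cost s.currentRow⟩ ∧
      (F R).Flagged ∧ s.SameData (F R) := by
    intro R
    have hrow₃ : (s₂.afterSample m R).currentRow = s.currentRow := by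
      refine currentRow_congr ?_ ?_
      · rw [State.afterSample_nat (by decide) (by decide), hn₂ 3 (by decide) (by decide) (by decide)]
      · rw [State.afterSample_nat (by decide) (by decide), hn₂ 4 (by decide) (by decide) (by decide)]
    have hup := exec_updateVector E (s₂.afterSample m R) (by rw [hrow₃]; exact hκ)
    have hx₃ : (s₂.afterSample m R).vec 0 = s.vec 0 := vec_congr (hr₂ 0 (by decide))
    have hB₃ : (s₂.afterSample m R).real 1 = s.real 1 := hr₂ 1 (by decide)
    rw [hrow₃, hx₃, hB₃] at hup
    have hn₄ : ∀ a, a ≠ 1 → (updateVector.exec E (s₂.afterSample m R)).nat a =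
        (s₂.afterSample m R).nat a := fun a h1 => Cmd.exec_nat E (by
      simp [updateVector, scaleRow, sumRow, sumWeightedCosts, accumulate, mapArray,
        forEach, Cmd.natArrays, h1]) _
    have hb₄ : (updateVector.exec E (s₂.afterSample m R)).bought = s.bought ∪ R :=
      (Cmd.exec_bought E (by
        simp [updateVector, scaleRow, sumRow, sumWeightedCosts, accumulate, mapArray,
          forEach, Cmd.BuysNothing]) _).trans (by rw [State.afterSample, hb₂])
    have hB₄ : (updateVector.exec E (s₂.afterSample m R)).real 1 = s.real 1 :=
      (Cmd.exec_real E (by decide) _).trans hB₃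
    have h7₄ : (updateVector.exec E (s₂.afterSample m R)).nat 7 0 = j := by
      rw [hn₄ 7 (by decide), State.afterSample_nat (by decide) (by decide), h7]
    have hn₅ : ∀ a, a ≠ 1 → a ≠ 2 → a ≠ 6 → a ≠ 7 →
        (updateVector.exec E (s₂.afterSample m R)).nat a = s.nat a := fun a h1 h2 h6 h7 => by
      rw [hn₄ a h1, State.afterSample_nat h1 h2, hn₂ a h1 h6 h7]
    have hflag : (updateVector.exec E (s₂.afterSample m R)).nat 2 =
        fun i => if ∃ S ∈ R, (S : ℕ) = i then 1 else s.nat 2 i := by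
      rw [hn₄ 2 (by decide)]
      simp only [State.afterSample, Function.update_self]
      rw [hn₂ 2 (by decide) (by decide) (by decide)]
    simp only [hF]
    generalize updateVector.exec E (s₂.afterSample m R) = s₄ at *
    have hbuy : buyCheapest.exec E s₄ =
        ({ s₄ with bought := insert j s₄.bought } : State m).writeNat 2 j 1 := by
      simp only [buyCheapest, Cmd.exec, NatExpr.eval, cell, State.buy_nat, h7₄]
      rw [State.buy, dif_pos j.isLt]
    rw [hbuy]
    refine ⟨?_, fun S => ?_, ?_, ?_, ?_, ?_⟩
    · rw [State.toAlg, LearnOrCover.State.mk.injEq]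
      refine ⟨hup, ?_⟩
      rw [hche, Finset.union_singleton]
      simp [State.writeNat, hb₄, State.toAlg]
    · simp only [State.writeNat, Function.update_self, hflag, hb₄, Finset.mem_insert,
        Finset.mem_union]
      by_cases hSj : S = j
      · subst hSj
        simp
      · rw [Function.update_of_ne fun h => hSj (Fin.ext h)]
        by_cases hSR : S ∈ R
        · have : ∃ T ∈ R, (T : ℕ) = S := ⟨S, hSR, rfl⟩
          simp [this, hSR]
        · have : ¬ ∃ T ∈ R, (T : ℕ) = S := by
            rintro ⟨T, hT, h⟩
            exact hSR (Fin.ext h ▸ hT)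
          simp [this, hSR, hSj, hs S]
    · simp [State.writeNat, hn₅]
    · simp [State.writeNat, hn₅]
    · simp [State.writeNat, hn₅]
    · exact hB₄
  refine ⟨?_, fun s' hs' => ?_⟩
  · rw [PMF.map_comp, hκ, hr₂ 1 (by decide), vec_congr (hr₂ 0 (by decide))]
    congr 1
    funext R
    exact (hFspec R).1
  · rw [PMF.support_map] at hs'
    obtain ⟨R, -, rfl⟩ := hs'
    exact (hFspec R).2

/-! ### Storing the rows -/

/-- Stores the arriving row behind the rows that are already stored, and makes it current. -/
def storeRow : Cmd :=
  .seq (.setNat 4 (.lit 0) (cell 5))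
    (.seq (forEach (.ite (.mem (cell 1)) (.setNat 3 (.plus (cell 4) (cell 1)) (.lit 1))
        (.setNat 3 (.plus (cell 4) (cell 1)) (.lit 0))))
      (.setNat 5 (.lit 0) (.plus (cell 5) .numSets)))

/-- The rows in `l` are stored one after the other. -/
structure State.Stores (s : State m) (l : List (Finset (Fin m))) : Prop where
  finish : s.nat 5 0 = l.length * m
  row : ∀ (i : ℕ) (h : i < l.length), s.rowAt (i * m) = l[i]

lemma State.Stores.congr {s t : State m} {l : List (Finset (Fin m))} (h : s.Stores l)
    (h3 : t.nat 3 = s.nat 3) (h5 : t.nat 5 = s.nat 5) : t.Stores l :=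
  ⟨by rw [h5, h.finish], fun i hi => by rw [← h.row i hi, State.rowAt, State.rowAt, h3]⟩

/-- Zeros are written explicitly, so `Stores` need not say anything about memory behind the stored
rows. -/
lemma exec_storeRow (E : Env m) (s : State m) {l : List (Finset (Fin m))} (hl : s.Stores l) :
    (storeRow.exec E s).Stores (l ++ [E.row]) ∧ (storeRow.exec E s).nat 4 0 = l.length * m := by
  have key := exec_forEach_induction E
    (P := .ite (.mem (cell 1)) (.setNat 3 (.plus (cell 4) (cell 1)) (.lit 1))
        (.setNat 3 (.plus (cell 4) (cell 1)) (.lit 0)))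
    (by decide) (fun k t => t.nat 4 0 = l.length * m ∧ t.nat 5 = s.nat 5 ∧
      (∀ i < l.length * m, t.nat 3 i = s.nat 3 i) ∧
      ∀ S : Fin m, (S : ℕ) < k → (0 < t.nat 3 (l.length * m + S) ↔ S ∈ E.row))
    (Cmd.exec E (.setNat 4 (.lit 0) (cell 5)) s) ?_ ?_
  · simp only [storeRow, Cmd.exec] at key ⊢
    generalize (forEach (.ite (.mem (cell 1)) (.setNat 3 (.plus (cell 4) (cell 1)) (.lit 1))
        (.setNat 3 (.plus (cell 4) (cell 1)) (.lit 0)))).exec E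
        (s.writeNat 4 (NatExpr.eval s (.lit 0)) (NatExpr.eval s (cell 5))) = t at key ⊢
    obtain ⟨h4, h5, h3, hrow⟩ := key
    refine ⟨⟨?_, fun i hi => ?_⟩, by simpa [State.writeNat] using h4⟩
    · simp only [State.writeNat, Function.update_self, NatExpr.eval, cell, h5, hl.finish,
        List.length_append, List.length_singleton]
      ring
    · have hrowAt : (t.writeNat 5 (NatExpr.eval t (.lit 0))
          (NatExpr.eval t (.plus (cell 5) .numSets))).rowAt (i * m) = t.rowAt (i * m) := by
        simp [State.rowAt, State.writeNat]
      rw [hrowAt]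
      rcases Nat.lt_succ_iff_lt_or_eq.1 (by simpa using hi : i < l.length + 1) with h | h
      · rw [List.getElem_append_left h, ← hl.row i h]
        ext S
        have hlt : i * m + S < l.length * m := by
          have : (i + 1) * m ≤ l.length * m := Nat.mul_le_mul_right m h
          have := S.isLt
          rw [Nat.add_mul] at *
          omega
        simp [State.rowAt, h3 _ hlt]
      · subst h
        rw [List.getElem_append_right le_rfl]
        ext S
        simp [State.rowAt, hrow S S.isLt]
  · refine ⟨?_, ?_, fun i _ => ?_, fun S hS => absurd hS (Nat.not_lt_zero _)⟩
    · simp [Cmd.exec, State.writeNat, NatExpr.eval, cell, hl.finish]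
    · simp [Cmd.exec, State.writeNat]
    · simp [Cmd.exec, State.writeNat]
  · rintro k hk t ht ⟨h4, h5, h3, hrow⟩
    have hmem : Cond.Holds E t (.mem (cell 1)) ↔ ⟨k, hk⟩ ∈ E.row := by
      simp [Cond.Holds, NatExpr.eval, cell, ht, hk]
    have hcell : ∀ v : ℕ, ∀ t' : State m,
        t' = ((t.writeNat 3 (l.length * m + k) v).writeNat 1 0 (k + 1)) →
        (0 < v ↔ ⟨k, hk⟩ ∈ E.row) →
        t'.nat 4 0 = l.length * m ∧ t'.nat 5 = s.nat 5 ∧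
        (∀ i < l.length * m, t'.nat 3 i = s.nat 3 i) ∧
        ∀ S : Fin m, (S : ℕ) < k + 1 → (0 < t'.nat 3 (l.length * m + S) ↔ S ∈ E.row) := by
      rintro v t' rfl hv
      refine ⟨by simp [State.writeNat, h4], by simp [State.writeNat, h5], fun i hi => ?_,
        fun S hS => ?_⟩
      · have : i ≠ l.length * m + k := by omega
        simp [State.writeNat, Function.update_of_ne this, h3 i hi]
      · by_cases hSk : S = ⟨k, hk⟩
        · subst hSk
          simpa [State.writeNat] using hv
        · have hne : (S : ℕ) ≠ k := fun h => hSk (Fin.ext h)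
          have hne' : l.length * m + (S : ℕ) ≠ l.length * m + k := by omega
          simpa [State.writeNat, Function.update_of_ne hne'] using hrow S (by omega)
    rw [Cmd.exec]
    by_cases h : Cond.Holds E t (.mem (cell 1))
    · rw [if_pos h]
      refine hcell 1 _ ?_ (by simp [hmem.1 h])
      simp [Cmd.exec, NatExpr.eval, cell, h4, ht]
    · rw [if_neg h]
      refine hcell 0 _ ?_ (by simpa using fun hh => h (hmem.2 hh))
      simp [Cmd.exec, NatExpr.eval, cell, h4, ht]

end Machine

namespace Machine

variable {m : ℕ}

/-! ### Computing the estimate -/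

lemma exec_setNat_eq (E : Env m) (s : State m) (a : ℕ) (e : NatExpr) :
    (Cmd.exec E (.setNat a (.lit 0) e) s).nat a 0 = e.eval s := by
  simp [Cmd.exec, State.writeNat, NatExpr.eval]

lemma exec_setReal_eq (E : Env m) (s : State m) (a : ℕ) (e : RealExpr) :
    (Cmd.exec E (.setReal a (.lit 0) e) s).real a 0 = e.eval E s := by
  simp [Cmd.exec, State.writeReal, NatExpr.eval]

/-- Compares the weight of the current row with the smallest weight, and moves to the next row. -/
def scanRow : Cmd :=
  .seq (sumRow 4) (.seq (.ite (.realLt (realCell 3) (realCell 5))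
    (.seq (.setReal 5 (.lit 0) (realCell 3)) (.setNat 8 (.lit 0) (cell 4))) .skip)
    (.setNat 4 (.lit 0) (.plus (cell 4) .numSets)))

lemma exec_scanRow (E : Env m) (s : State m) :
    (scanRow.exec E s).nat 4 0 = s.nat 4 0 + m ∧
    ((scanRow.exec E s).real 5 0, (scanRow.exec E s).nat 8 0) =
      if ∑ S ∈ s.currentRow, s.vec 4 S < s.real 5 0
      then (∑ S ∈ s.currentRow, s.vec 4 S, s.nat 4 0) else (s.real 5 0, s.nat 8 0) := by
  rw [scanRow, Cmd.exec, Cmd.exec]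
  have hsum := exec_sumRow E s (k := 4) (by decide)
  have h4 : ((sumRow 4).exec E s).nat 4 = s.nat 4 := Cmd.exec_nat E (by decide) s
  have h8 : ((sumRow 4).exec E s).nat 8 = s.nat 8 := Cmd.exec_nat E (by decide) s
  have h5 : ((sumRow 4).exec E s).real 5 = s.real 5 := Cmd.exec_real E (by decide) s
  generalize (sumRow 4).exec E s = t at *
  have hcond : Cond.Holds E t (.realLt (realCell 3) (realCell 5)) ↔
      ∑ S ∈ s.currentRow, s.vec 4 S < s.real 5 0 := by
    simp [Cond.Holds, RealExpr.eval, realCell, NatExpr.eval, hsum, h5]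
  by_cases hlt : ∑ S ∈ s.currentRow, s.vec 4 S < s.real 5 0
  · have hpos := hcond.2 hlt
    simp only [realCell] at hpos
    simp [Cmd.exec, hpos, hlt, State.writeNat, State.writeReal, RealExpr.eval, NatExpr.eval,
      cell, realCell, h4, hsum]
  · have hneg : ¬ Cond.Holds E t (.realLt (realCell 3) (realCell 5)) := fun h => hlt (hcond.1 h)
    simp only [realCell] at hneg
    simp [Cmd.exec, hneg, hlt, State.writeNat, NatExpr.eval, cell, realCell, h4, h5, h8]

/-- Determines the first row of minimal weight. -/
def scan : Cmd :=
  .seq (sumAll 4) (.seq (.setReal 5 (.lit 0) (.plus (realCell 3) (.lit 1)))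
    (.seq (.setNat 4 (.lit 0) (.lit 0)) (.loop (cell 0) scanRow)))

lemma exec_scan (E : Env m) (s : State m) {l : List (Finset (Fin m))} (hl : s.Stores l)
    (h0 : s.nat 0 0 = l.length) (hne : l ≠ []) (hw : ∀ S, 0 ≤ s.vec 4 S) :
    (scan.exec E s).real 5 0 = (LearnOrCover.lightestRow (s.vec 4) l).1 ∧
      s.rowAt ((scan.exec E s).nat 8 0) = (LearnOrCover.lightestRow (s.vec 4) l).2 := by
  set s₁ := Cmd.exec E (.setNat 4 (.lit 0) (.lit 0))
    (Cmd.exec E (.setReal 5 (.lit 0) (.plus (realCell 3) (.lit 1))) ((sumAll 4).exec E s)) with hs₁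
  have hn₁ : ∀ a, a ≠ 1 → a ≠ 4 → s₁.nat a = s.nat a := fun a h1 h4 =>
    Cmd.exec_nat E (P := .seq (.seq (sumAll 4) (.setReal 5 (.lit 0) (.plus (realCell 3) (.lit 1))))
      (.setNat 4 (.lit 0) (.lit 0)))
      (by simp [sumAll, accumulate, forEach, Cmd.natArrays, h1, h4]) s
  have hr₁ : s₁.real 4 = s.real 4 :=
    Cmd.exec_real E (P := .seq (.seq (sumAll 4) (.setReal 5 (.lit 0) (.plus (realCell 3) (.lit 1))))
      (.setNat 4 (.lit 0) (.lit 0))) (by decide) s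
  have h4₁ : s₁.nat 4 0 = 0 := exec_setNat_eq E _ 4 _
  have h5₁ : s₁.real 5 0 = ∑ S, s.vec 4 S + 1 := by
    rw [hs₁, Cmd.exec_real E (by decide), exec_setReal_eq]
    simp only [RealExpr.eval, realCell, NatExpr.eval, exec_sumAll E s (k := 4) (by decide)]
    norm_num
  have key : ∀ k ≤ l.length, (∀ a, a ≠ 1 → a ≠ 4 → a ≠ 8 →
      ((scanRow.exec E)^[k] s₁).nat a = s.nat a) ∧ ((scanRow.exec E)^[k] s₁).real 4 = s.real 4 ∧
      ((scanRow.exec E)^[k] s₁).nat 4 0 = k * m ∧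
      ((scanRow.exec E)^[k] s₁).real 5 0 =
        (LearnOrCover.lightestRow (s.vec 4) (l.take k)).1 ∧
      (k ≠ 0 → s.rowAt (((scanRow.exec E)^[k] s₁).nat 8 0) =
        (LearnOrCover.lightestRow (s.vec 4) (l.take k)).2) := by
    intro k
    induction k with
    | zero => exact fun _ => ⟨fun a h1 h4 _ => hn₁ a h1 h4, hr₁, by simpa using h4₁, h5₁,
        fun h => absurd rfl h⟩
    | succ k ih =>
      intro hk
      obtain ⟨hn, hr, h4, h5, h8⟩ := ih (by omega)
      rw [Function.iterate_succ_apply']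
      generalize (scanRow.exec E)^[k] s₁ = t at *
      obtain ⟨h4', h58⟩ := exec_scanRow E t
      have hrow : t.currentRow = l[k] := by
        rw [← hl.row k hk, State.currentRow, h4, State.rowAt, State.rowAt,
          hn 3 (by decide) (by decide) (by decide)]
      rw [hrow, vec_congr hr, h5] at h58
      have htake : l.take (k + 1) = l.take k ++ [l[k]] := List.take_succ_eq_append_getElem hk
      have hlight : LearnOrCover.lightestRow (s.vec 4) (l.take (k + 1)) =
          if ∑ S ∈ l[k], s.vec 4 S < (LearnOrCover.lightestRow (s.vec 4) (l.take k)).1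
          then (∑ S ∈ l[k], s.vec 4 S, l[k])
          else LearnOrCover.lightestRow (s.vec 4) (l.take k) := by
        rw [htake, LearnOrCover.lightestRow, List.foldl_append]
        rfl
      refine ⟨fun a h1 h4 h8 => (Cmd.exec_nat E (by
          simp [scanRow, sumRow, accumulate, forEach, Cmd.natArrays, h1, h4, h8]) t).trans
          (hn a h1 h4 h8), (Cmd.exec_real E (by decide) t).trans hr, ?_, ?_⟩
      · rw [h4', h4, Nat.add_mul, Nat.one_mul]
      rw [hlight]
      by_cases hlt : ∑ S ∈ l[k], s.vec 4 S < (LearnOrCover.lightestRow (s.vec 4) (l.take k)).1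
      · rw [if_pos hlt, Prod.mk.injEq] at h58
        rw [if_pos hlt, h58.1, h58.2, h4]
        exact ⟨rfl, fun _ => hl.row k hk⟩
      · rw [if_neg hlt, Prod.mk.injEq] at h58
        rw [if_neg hlt, h58.1, h58.2]
        refine ⟨rfl, fun _ => h8 ?_⟩
        -- For `k = 0` the address of the lightest row is still meaningless, but the first row
        -- always beats the initial value, so this branch does not occur.
        rintro rfl
        refine hlt ?_
        have : ∑ S ∈ l[0], s.vec 4 S ≤ ∑ S, s.vec 4 S :=
          Finset.sum_le_sum_of_subset_of_nonneg (Finset.subset_univ _) fun S _ _ => hw S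
        simp only [List.take_zero, LearnOrCover.lightestRow, List.foldl_nil]
        linarith
  have hloop : scan.exec E s = (scanRow.exec E)^[l.length] s₁ := by
    change (scanRow.exec E)^[NatExpr.eval s₁ (cell 0)] s₁ = _
    rw [show NatExpr.eval s₁ (cell 0) = l.length from
      (congrFun (hn₁ 0 (by decide) (by decide)) 0).trans h0]
  obtain ⟨-, -, -, h5, h8⟩ := key l.length le_rfl
  rw [hloop, h5, h8 (by simpa using hne), List.take_length]
  exact ⟨rfl, rfl⟩

/-- One multiplicative update of the estimation. -/
def estimateRound : Cmd :=
  .seq (sumWeightedCosts 4) (.seq (.setReal 7 (.lit 0) (realCell 3)) (.seq scan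
    (.seq (.setNat 4 (.lit 0) (cell 8))
      (.seq (.ite (.realLt (realCell 6) (.quot (realCell 7) (realCell 5))) .skip
          (.setReal 6 (.lit 0) (.quot (realCell 7) (realCell 5))))
        (.seq findCheapest (scaleRow 4))))))

lemma exec_estimateRound (E : Env m) (s : State m) {l : List (Finset (Fin m))} (hl : s.Stores l)
    (h0 : s.nat 0 0 = l.length) (hne : l ≠ []) (hrows : ∀ a ∈ l, a.Nonempty)
    (hw : ∀ S, 0 ≤ s.vec 4 S) :
    ((estimateRound.exec E s).vec 4, (estimateRound.exec E s).real 6 0) =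
      LearnOrCover.estimateStep E.cost l (s.vec 4, s.real 6 0) := by
  simp only [estimateRound]
  rw [Cmd.exec, Cmd.exec, Cmd.exec, Cmd.exec, Cmd.exec, Cmd.exec]
  have hD := exec_sumWeightedCosts E s (k := 4) (by decide)
  set s₁ := (sumWeightedCosts 4).exec E s with hs₁
  set s₂ := Cmd.exec E (.setReal 7 (.lit 0) (realCell 3)) s₁ with hs₂
  have h7₂ : s₂.real 7 0 = ∑ S, E.cost S * s.vec 4 S := by
    rw [hs₂, exec_setReal_eq]
    exact hD
  have hn₂ : ∀ a, a ≠ 1 → s₂.nat a = s.nat a := fun a h1 => Cmd.exec_nat E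
    (P := .seq (sumWeightedCosts 4) (.setReal 7 (.lit 0) (realCell 3)))
    (by simp [sumWeightedCosts, accumulate, forEach, Cmd.natArrays, h1]) s
  have hr₂ : ∀ a, a ≠ 3 → a ≠ 7 → s₂.real a = s.real a := fun a h3 h7 => Cmd.exec_real E
    (P := .seq (sumWeightedCosts 4) (.setReal 7 (.lit 0) (realCell 3)))
    (by simp [sumWeightedCosts, accumulate, forEach, Cmd.realArrays, h3, h7]) s
  have hv₂ : s₂.vec 4 = s.vec 4 := vec_congr (hr₂ 4 (by decide) (by decide))
  obtain ⟨h5, h8⟩ := exec_scan E s₂ (hl.congr (hn₂ 3 (by decide)) (hn₂ 5 (by decide)))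
    (by rw [hn₂ 0 (by decide), h0]) hne (by rw [hv₂]; exact hw)
  rw [hv₂] at h5 h8
  have hrow₂ : ∀ p, s₂.rowAt p = s.rowAt p := fun p => by
    rw [State.rowAt, State.rowAt, hn₂ 3 (by decide)]
  rw [hrow₂] at h8
  set s₃ := scan.exec E s₂ with hs₃
  -- The lightest row becomes the current row, so that the search for the cheapest set and the
  -- scaling act on it.
  set s₄ := Cmd.exec E (.setNat 4 (.lit 0) (cell 8)) s₃ with hs₄
  have h3₄ : s₄.nat 3 = s.nat 3 := (Cmd.exec_nat E (P := .seq scan (.setNat 4 (.lit 0) (cell 8)))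
    (by decide) s₂).trans (hn₂ 3 (by decide))
  have hr₄ : ∀ a, a ≠ 3 → a ≠ 5 → s₄.real a = s₂.real a := fun a h3 h5 => Cmd.exec_real E
    (P := .seq scan (.setNat 4 (.lit 0) (cell 8)))
    (by simp [scan, scanRow, sumRow, sumAll, accumulate, forEach, Cmd.realArrays, h3, h5]) s₂
  have h4₄ : s₄.nat 4 0 = s₃.nat 8 0 := exec_setNat_eq E s₃ 4 _
  have h5₄ : s₄.real 5 = s₃.real 5 := Cmd.exec_real E (by decide) s₃
  have hrow₄ : s₄.currentRow = (LearnOrCover.lightestRow (s.vec 4) l).2 := by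
    rw [State.currentRow, h4₄, ← h8, State.rowAt, State.rowAt, h3₄]
  set s₅ := Cmd.exec E (.ite (.realLt (realCell 6) (.quot (realCell 7) (realCell 5))) .skip
          (.setReal 6 (.lit 0) (.quot (realCell 7) (realCell 5)))) s₄ with hs₅
  have hn₅ : ∀ a, s₅.nat a = s₄.nat a := fun a => Cmd.exec_nat E (by simp [Cmd.natArrays]) s₄
  have hr₅ : s₅.real 4 = s.real 4 := ((Cmd.exec_real E (by decide) s₄).trans
    (hr₄ 4 (by decide) (by decide))).trans (hr₂ 4 (by decide) (by decide))
  have hq : RealExpr.eval E s₄ (.quot (realCell 7) (realCell 5)) =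
      (∑ S, E.cost S * s.vec 4 S) / (LearnOrCover.lightestRow (s.vec 4) l).1 := by
    simp only [RealExpr.eval, realCell, NatExpr.eval]
    rw [h5₄, h5, hr₄ 7 (by decide) (by decide), h7₂]
  have h6₄ : RealExpr.eval E s₄ (realCell 6) = s.real 6 0 := by
    simp only [RealExpr.eval, realCell, NatExpr.eval]
    rw [hr₄ 6 (by decide) (by decide), hr₂ 6 (by decide) (by decide)]
  have h6₅ : s₅.real 6 0 = min (s.real 6 0)
      ((∑ S, E.cost S * s.vec 4 S) / (LearnOrCover.lightestRow (s.vec 4) l).1) := by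
    have hiff : Cond.Holds E s₄ (.realLt (realCell 6) (.quot (realCell 7) (realCell 5))) ↔
        RealExpr.eval E s₄ (realCell 6) <
          RealExpr.eval E s₄ (.quot (realCell 7) (realCell 5)) := Iff.rfl
    rw [hs₅, Cmd.exec, min_def_lt, ← h6₄, ← hq]
    by_cases h : RealExpr.eval E s₄ (realCell 6) <
        RealExpr.eval E s₄ (.quot (realCell 7) (realCell 5))
    · rw [if_pos (hiff.2 h), if_pos h]
      rfl
    · rw [if_neg fun h' => h (hiff.1 h'), if_neg h, exec_setReal_eq]
  have hrow₅ : s₅.currentRow = (LearnOrCover.lightestRow (s.vec 4) l).2 :=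
    (currentRow_congr (hn₅ 3) (hn₅ 4)).trans hrow₄
  have hmem := (LearnOrCover.lightestRow_spec hw hne).1
  obtain ⟨hκ, -⟩ := exec_findCheapest E s₅ (by rw [hrow₅]; exact hrows _ hmem)
  set s₆ := findCheapest.exec E s₅
  have hrow₆ : s₆.currentRow = s₅.currentRow :=
    currentRow_congr (Cmd.exec_nat E (by decide) s₅) (Cmd.exec_nat E (by decide) s₅)
  have hv₆ : s₆.vec 4 = s.vec 4 := vec_congr ((Cmd.exec_real E (by decide) s₅).trans hr₅)
  have h6₇ : ((scaleRow 4).exec E s₆).real 6 = s₅.real 6 :=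
    (Cmd.exec_real E (by decide) s₆).trans (Cmd.exec_real E (by decide) s₅)
  rw [exec_scaleRow E s₆ (by decide) (by rw [hκ, hrow₆]), hrow₆, hrow₅, hv₆, h6₇, h6₅]
  rfl

/-- Computes the estimate for the rows that are stored, and makes the last row current. -/
def computeEstimate : Cmd :=
  .seq (mapArray 4 always (.quot (.lit 1) (.cost (cell 1)))) (.seq sumCosts
    (.seq (.setReal 6 (.lit 0) (realCell 3))
      (.seq (.loop .numSets (.loop (.plus .numSets .numSets) estimateRound))
        (.setNat 4 (.lit 0) (.minus (cell 5) .numSets)))))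

lemma exec_computeEstimate (E : Env m) (s : State m) {l : List (Finset (Fin m))}
    (hc : ∀ S, 0 < E.cost S) (hl : s.Stores l) (h0 : s.nat 0 0 = l.length) (hne : l ≠ [])
    (hrows : ∀ a ∈ l, a.Nonempty) :
    (computeEstimate.exec E s).real 6 0 = LearnOrCover.estimate E.cost l ∧
      (computeEstimate.exec E s).nat 4 0 = l.length * m - m := by
  simp only [computeEstimate]
  rw [Cmd.exec, Cmd.exec, Cmd.exec, Cmd.exec]
  set s₁ := (mapArray 4 always (.quot (.lit 1) (.cost (cell 1)))).exec E s with hs₁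
  have hv₁ : s₁.vec 4 = fun S => 1 / E.cost S := by
    funext S
    rw [State.vec, hs₁, exec_mapArray E Finset.univ (fun S => 1 / E.cost S)]
    · simp
    · intro S t ht h1 h2 h3
      refine ⟨by simp [always_holds], fun _ => ?_⟩
      rw [RealExpr.eval, eval_cost ht, RealExpr.eval]
      norm_num
  set s₂ := Cmd.exec E (.setReal 6 (.lit 0) (realCell 3)) (sumCosts.exec E s₁) with hs₂
  have h6₂ : s₂.real 6 0 = ∑ S, E.cost S := by
    rw [hs₂, exec_setReal_eq]
    exact exec_sumCosts E s₁
  have hv₂ : s₂.vec 4 = fun S => 1 / E.cost S := (vec_congr (Cmd.exec_real E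
    (P := .seq sumCosts (.setReal 6 (.lit 0) (realCell 3))) (by decide) s₁)).trans hv₁
  have hn₂ : ∀ a, a ≠ 1 → s₂.nat a = s.nat a := fun a h1 => Cmd.exec_nat E
    (P := .seq (mapArray 4 always (.quot (.lit 1) (.cost (cell 1)))) (.seq sumCosts
      (.setReal 6 (.lit 0) (realCell 3))))
    (by simp [sumCosts, mapArray, accumulate, forEach, Cmd.natArrays, h1]) s
  have hl₂ : s₂.Stores l := hl.congr (hn₂ 3 (by decide)) (hn₂ 5 (by decide))
  have h0₂ : s₂.nat 0 0 = l.length := by rw [hn₂ 0 (by decide), h0]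
  have key : ∀ k, (((estimateRound.exec E)^[k] s₂).Stores l ∧
      ((estimateRound.exec E)^[k] s₂).nat 0 0 = l.length ∧
      ∀ S, 0 ≤ ((estimateRound.exec E)^[k] s₂).vec 4 S) ∧
      (((estimateRound.exec E)^[k] s₂).vec 4, ((estimateRound.exec E)^[k] s₂).real 6 0) =
        (LearnOrCover.estimateStep E.cost l)^[k] (fun S => 1 / E.cost S, ∑ S, E.cost S) := by
    intro k
    induction k with
    | zero =>
      refine ⟨⟨hl₂, h0₂, fun S => ?_⟩, ?_⟩
      · rw [Function.iterate_zero, id, hv₂]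
        exact (one_div_pos.2 (hc S)).le
      · rw [Function.iterate_zero, Function.iterate_zero, id, id, hv₂, h6₂]
    | succ k ih =>
      obtain ⟨⟨hl', h0', hw'⟩, heq⟩ := ih
      rw [Function.iterate_succ_apply', Function.iterate_succ_apply', ← heq]
      generalize (estimateRound.exec E)^[k] s₂ = t at *
      have hstep := exec_estimateRound E t hl' h0' hne hrows hw'
      refine ⟨⟨hl'.congr (Cmd.exec_nat E (by decide) t) (Cmd.exec_nat E (by decide) t), ?_,
        fun S => ?_⟩, hstep⟩
      · rw [Cmd.exec_nat E (by decide), h0']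
      · rw [(Prod.mk.inj hstep).1]
        exact mul_nonneg (hw' S) (Real.exp_pos _).le
  -- The two nested loops multiply the bounds, and each bound is evaluated only once on entry to its
  -- loop.
  have hloop : Cmd.exec E (.loop .numSets (.loop (.plus .numSets .numSets) estimateRound)) s₂ =
      (estimateRound.exec E)^[(m + m) * m] s₂ := by
    rw [Function.iterate_mul]
    rfl
  rw [hloop]
  obtain ⟨⟨hl', -, -⟩, heq⟩ := key ((m + m) * m)
  constructor
  · rw [Cmd.exec_real E (by decide), LearnOrCover.estimate, ← heq]
  · rw [exec_setNat_eq]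
    simp only [NatExpr.eval, cell, hl'.finish]

/-- If the estimate exceeds the guess, restarts with twice the estimate as the guess. -/
def updateGuess : Cmd :=
  .ite (.realLt (realCell 1) (realCell 6))
    (.seq (.setReal 1 (.lit 0) (.plus (realCell 6) (realCell 6))) writeInitialWeights) .skip

lemma exec_updateGuess (E : Env m) (s : State m) :
    (updateGuess.exec E s).real 1 0 =
      (if s.real 1 0 < s.real 6 0 then s.real 6 0 + s.real 6 0 else s.real 1 0) ∧
    (updateGuess.exec E s).vec 0 = if s.real 1 0 < s.real 6 0
      then LearnOrCover.initWeights E.cost (s.real 6 0 + s.real 6 0) else s.vec 0 := by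
  rw [updateGuess, Cmd.exec]
  by_cases h : s.real 1 0 < s.real 6 0
  · rw [if_pos h, if_pos h, if_pos (show Cond.Holds E s (.realLt (realCell 1) (realCell 6)) from h),
      Cmd.exec, exec_writeInitialWeights, Cmd.exec_real E (by decide), exec_setReal_eq]
    exact ⟨rfl, rfl⟩
  · rw [if_neg h, if_neg h,
      if_neg (show ¬ Cond.Holds E s (.realLt (realCell 1) (realCell 6)) from h)]
    exact ⟨rfl, rfl⟩

end Machine

namespace PMF

lemma bind_congr_support {α β : Type*} (p : PMF α) {f g : α → PMF β}
    (h : ∀ a ∈ p.support, f a = g a) : p.bind f = p.bind g := by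
  ext b
  rw [bind_apply, bind_apply]
  refine tsum_congr fun a => ?_
  by_cases ha : a ∈ p.support
  · rw [h a ha]
  · rw [(p.apply_eq_zero_iff a).2 ha, zero_mul, zero_mul]

end PMF

namespace Machine

open LearnOrCover

variable {m : ℕ}

/-! ### The programs -/

lemma foldl_bind_eq (F : Finset (Fin m) → State m → PMF (State m))
    (rows : List (Finset (Fin m))) (μ : PMF (State m)) :
    rows.foldl (fun μ a => μ.bind (F a)) μ =
      μ.bind fun s => rows.foldl (fun μ a => μ.bind (F a)) (PMF.pure s) := by
  induction rows generalizing μ with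
  | nil => simp
  | cons a rows ih =>
    simp only [List.foldl_cons, PMF.pure_bind]
    rw [ih, PMF.bind_bind]
    congr 1
    funext s
    exact (ih _).symm

/-- A program with an invariant under which every arrival is processed as by guess-and-double. -/
lemma map_bought_run_eq {g : GuessRule} {init body : Cmd} {c : Fin m → ℝ} {β : ℝ}
    (Inv : List (Finset (Fin m)) → State m → Prop)
    (hinit : ∃ s₀, init.erasedRun ⟨c, β, ∅⟩ (State.start m) = PMF.pure s₀ ∧ Inv [] s₀ ∧
      s₀.bought = ∅)
    (hstep : ∀ h s a, Inv h s → (∀ b ∈ h ++ [a], b.Nonempty) →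
      (body.erasedRun ⟨c, β, a⟩ (s.writeNat 0 0 (s.nat 0 0 + 1))).map State.toAlg =
        doublingStep g c h s.toAlg a ∧
      ∀ s' ∈ (body.erasedRun ⟨c, β, a⟩ (s.writeNat 0 0 (s.nat 0 0 + 1))).support,
        Inv (h ++ [a]) s')
    {rows : List (Finset (Fin m))} (hrows : ∀ a ∈ rows, a.Nonempty) :
    ((countingProgram init body).run c β rows).map State.bought = guessAndDouble g m c rows := by
  obtain ⟨s₀, hs₀, hInv₀, hb₀⟩ := hinit
  set F : Finset (Fin m) → State m → PMF (State m) := fun a s =>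
    body.erasedRun ⟨c, β, a⟩ (s.writeNat 0 0 (s.nat 0 0 + 1)) with hF
  have herase : ∀ l : List (Finset (Fin m)),
      ((countingProgram init body).run c β l).map State.erase =
        l.foldl (fun μ a => μ.bind (F a)) (PMF.pure s₀) := by
    intro l
    induction l using List.reverseRecOn with
    | nil =>
      rw [List.foldl_nil, ← hs₀]
      exact Cmd.map_erase_run _ init _
    | append_singleton l a ih =>
      rw [OnlineProgram.run, List.foldl_append, List.foldl_append, ← ih, List.foldl_cons,
        List.foldl_nil, List.foldl_cons, List.foldl_nil, PMF.map_bind, PMF.bind_map]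
      congr 1
      funext s
      rw [Cmd.map_erase_run]
      simp only [countingProgram, Cmd.erasedRun, PMF.pure_bind]
      rfl
  have key : ∀ (rows h : List (Finset (Fin m))) (s : State m), Inv h s →
      (∀ a ∈ h ++ rows, a.Nonempty) →
      (rows.foldl (fun μ a => μ.bind (F a)) (PMF.pure s)).map State.toAlg =
        doublingRunFrom g c h rows s.toAlg := by
    intro rows
    induction rows with
    | nil => intro h s _ _; rw [List.foldl_nil, PMF.pure_map, doublingRunFrom]
    | cons a rows ih =>
      intro h s hs hne
      have hne' : ∀ b ∈ h ++ [a], b.Nonempty := fun b hb => hne b (by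
        rw [List.mem_append, List.mem_singleton] at hb
        rcases hb with hb | hb <;> simp [hb])
      obtain ⟨h1, h2⟩ := hstep h s a hs hne'
      rw [List.foldl_cons, PMF.pure_bind, foldl_bind_eq, PMF.map_bind, doublingRunFrom, ← h1,
        PMF.bind_map]
      exact PMF.bind_congr_support _ fun s' hs' => ih _ _ (h2 s' hs') (by simpa using hne)
  have hbought : (State.bought : State m → Finset (Fin m)) =
      LearnOrCover.State.bought ∘ State.toAlg ∘ State.erase := rfl
  rw [hbought, ← PMF.map_comp, ← PMF.map_comp, herase, key rows [] s₀ hInv₀ hrows, guessAndDouble]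
  cases rows with
  | nil => simp [doublingRunFrom, PMF.pure_map, State.toAlg, hb₀]
  | cons a rows =>
    -- The first arrival always reinitializes the vector, so the initial vector of the memory is
    -- irrelevant.
    rw [doublingRunFrom, doublingRunFrom, doublingStep, doublingStep, if_neg (by simp),
      if_neg (by simp)]
    simp [State.toAlg, hb₀]

/-- The memory after the arrivals `h`, with current guess `r`. -/
structure State.Represents (s : State m) (h : List (Finset (Fin m))) (r : ℝ) : Prop where
  stores : s.Stores h
  count : s.nat 0 0 = h.length
  flagged : s.Flagged
  guess : s.real 1 0 = r

lemma represents_start : (State.start m).Represents [] 0 :=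
  ⟨⟨by simp [State.start], fun i hi => absurd hi (Nat.not_lt_zero _)⟩, rfl,
    fun S => by simp [State.start], rfl⟩

/-- A round after a deterministic preparation that makes the arriving row current. -/
lemma erasedRun_seq_learnRound {E : Env m} {Q : Cmd} (hQ : Q.Deterministic) {s : State m}
    {h : List (Finset (Fin m))} {r : ℝ} {x : Fin m → ℝ} (hne : E.row.Nonempty)
    (hs : (Q.exec E s).Represents (h ++ [E.row]) r) (h4 : (Q.exec E s).nat 4 0 = h.length * m)
    (hx : (Q.exec E s).vec 0 = x) (hb : (Q.exec E s).bought = s.bought) :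
    ((Cmd.seq Q learnRound).erasedRun E s).map State.toAlg =
      step E.cost r ⟨x, s.bought⟩ E.row ∧
    ∀ s' ∈ ((Cmd.seq Q learnRound).erasedRun E s).support, s'.Represents (h ++ [E.row]) r := by
  rw [Cmd.erasedRun, hQ.erasedRun_eq, PMF.pure_bind]
  generalize Q.exec E s = t at *
  have hrow : t.currentRow = E.row := by
    rw [State.currentRow, h4, hs.stores.row h.length (by simp)]
    simp
  obtain ⟨h1, h2⟩ := erasedRun_learnRound E t hs.flagged (hrow ▸ hne)
  refine ⟨?_, fun s' hs' => ?_⟩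
  · rw [h1, hrow, hs.guess, State.toAlg, hx, hb]
  · obtain ⟨h3, h5⟩ := h2 s' hs'
    exact ⟨hs.stores.congr h5.rows h5.finish, by rw [h5.count, hs.count], h3,
      by rw [h5.guess, hs.guess]⟩

lemma represents_exec_storeRow (E : Env m) {s : State m} {h : List (Finset (Fin m))} {r : ℝ}
    (hs : s.Represents h r) :
    (storeRow.exec E (s.writeNat 0 0 (s.nat 0 0 + 1))).Represents (h ++ [E.row]) r := by
  set s₁ := s.writeNat 0 0 (s.nat 0 0 + 1) with hs₁
  obtain ⟨h1, -⟩ := exec_storeRow E s₁ (hs.stores.congr (t := s₁) (by simp [hs₁, State.writeNat])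
    (by simp [hs₁, State.writeNat]))
  refine ⟨h1, ?_, fun S => ?_, ?_⟩
  · rw [Cmd.exec_nat E (by decide)]
    simp [hs₁, State.writeNat, hs.count]
  · rw [Cmd.exec_nat E (by decide), Cmd.exec_bought E (by simp [storeRow, forEach,
      Cmd.BuysNothing])]
    simpa [hs₁, State.writeNat] using hs.flagged S
  · rw [Cmd.exec_real E (by decide)]
    exact hs.guess

lemma nat_four_exec_storeRow (E : Env m) {s : State m} {h : List (Finset (Fin m))} {r : ℝ}
    (hs : s.Represents h r) :
    (storeRow.exec E (s.writeNat 0 0 (s.nat 0 0 + 1))).nat 4 0 = h.length * m :=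
  (exec_storeRow E _ (hs.stores.congr (t := s.writeNat 0 0 (s.nat 0 0 + 1))
    (by simp [State.writeNat]) (by simp [State.writeNat]))).2

/-- Prepares the computation for a given guess. -/
def startGuess : Cmd := .seq (.setReal 1 (.lit 0) .guess) writeInitialWeights

/-- The program initializes the vector before any arrival, whereas guess-and-double does so at the
first one. The invariant therefore fixes the vector for the empty history only; afterwards the
states themselves are compared. -/
lemma map_bought_run_learnRound {c : Fin m → ℝ} {β : ℝ} {rows : List (Finset (Fin m))}
    (hrows : ∀ a ∈ rows, a.Nonempty) :
    ((countingProgram startGuess (.seq storeRow learnRound)).run c β rows).map State.bought =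
      learnOrCover β m c rows := by
  rw [learnOrCover_eq]
  refine map_bought_run_eq (fun h s => s.Represents h β ∧ (h = [] → s.vec 0 = initWeights c β))
    ?_ ?_ hrows
  · have hdet : startGuess.Deterministic := by
      simp [startGuess, writeInitialWeights, accumulate, mapArray, forEach, Cmd.Deterministic]
    have hr : (startGuess.exec ⟨c, β, ∅⟩ (State.start m)).real 1 0 = β := by
      rw [startGuess, Cmd.exec, Cmd.exec_real _ (by decide), exec_setReal_eq]
      rfl
    have hb : (startGuess.exec ⟨c, β, ∅⟩ (State.start m)).bought = ∅ :=
      Cmd.exec_bought _ (by simp [startGuess, writeInitialWeights, accumulate, mapArray, forEach,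
        Cmd.BuysNothing]) _
    have h₀ := represents_start (m := m)
    refine ⟨_, hdet.erasedRun_eq _ _, ⟨⟨h₀.stores.congr (Cmd.exec_nat _ (by decide) _)
      (Cmd.exec_nat _ (by decide) _), ?_, fun S => ?_, hr⟩, fun _ => ?_⟩, hb⟩
    · rw [Cmd.exec_nat _ (by decide), h₀.count]
    · rw [Cmd.exec_nat _ (by decide), hb]
      exact h₀.flagged S
    · rw [startGuess, Cmd.exec, exec_writeInitialWeights, exec_setReal_eq]
      rfl
  · rintro h s a ⟨hs, hx⟩ hne
    have hdet : storeRow.Deterministic := by simp [storeRow, forEach, Cmd.Deterministic]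
    set E : Env m := ⟨c, β, a⟩
    obtain ⟨h1, h2⟩ := erasedRun_seq_learnRound (E := E) (x := s.vec 0) hdet (hne a (by simp))
      (represents_exec_storeRow E hs) (nat_four_exec_storeRow E hs)
      (vec_congr (Cmd.exec_real E (by decide) _))
      (Cmd.exec_bought E (by simp [storeRow, forEach, Cmd.BuysNothing]) _)
    refine ⟨?_, fun s' hs' => ⟨h2 s' hs', fun hnil => by simp at hnil⟩⟩
    rw [h1, doublingStep]
    by_cases hh : h = []
    · rw [if_neg (by simp [hh]), hx hh]
      rfl
    · rw [if_pos ⟨hh, rfl⟩]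
      rfl

/-- Stores the arriving row and determines the current guess. -/
def prepare : Cmd := .seq storeRow (.seq computeEstimate updateGuess)

lemma map_bought_run_prepare {c : Fin m → ℝ} (hc : ∀ S, 0 < c S) {β : ℝ}
    {rows : List (Finset (Fin m))} (hrows : ∀ a ∈ rows, a.Nonempty) :
    ((countingProgram .skip (.seq prepare learnRound)).run c β rows).map State.bought =
      guessAndDouble estimateRule m c rows := by
  refine map_bought_run_eq (fun h s => s.Represents h (estimateRule m c h))
    ⟨State.start m, rfl, represents_start, rfl⟩ ?_ hrows
  intro h s a hs hne
  have hdet : prepare.Deterministic := by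
    simp [prepare, storeRow, computeEstimate, estimateRound, scan, scanRow, sumAll, sumRow,
      sumCosts, sumWeightedCosts, findCheapest, scaleRow, updateGuess, writeInitialWeights,
      accumulate, mapArray, forEach, Cmd.Deterministic]
  have hbuy : (Cmd.seq computeEstimate updateGuess).BuysNothing := by
    simp [computeEstimate, estimateRound, scan, scanRow, sumAll, sumRow,
      sumCosts, sumWeightedCosts, findCheapest, scaleRow, updateGuess, writeInitialWeights,
      accumulate, mapArray, forEach, Cmd.BuysNothing]
  set E : Env m := ⟨c, β, a⟩ with hE
  have hs₁ := represents_exec_storeRow E hs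
  have hx₁ : (storeRow.exec E (s.writeNat 0 0 (s.nat 0 0 + 1))).vec 0 = s.vec 0 :=
    vec_congr (Cmd.exec_real E (by decide) _)
  have hb₁ : (storeRow.exec E (s.writeNat 0 0 (s.nat 0 0 + 1))).bought = s.bought :=
    Cmd.exec_bought E (by simp [storeRow, forEach, Cmd.BuysNothing]) _
  have hexec : prepare.exec E (s.writeNat 0 0 (s.nat 0 0 + 1)) =
      (Cmd.seq computeEstimate updateGuess).exec E
        (storeRow.exec E (s.writeNat 0 0 (s.nat 0 0 + 1))) := rfl
  set s₁ := storeRow.exec E (s.writeNat 0 0 (s.nat 0 0 + 1)) with hs₁'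
  obtain ⟨h6, h4⟩ := exec_computeEstimate E s₁ hc hs₁.stores hs₁.count (by simp) hne
  have hr₂ : (computeEstimate.exec E s₁).real 1 0 = estimateRule m c h := by
    rw [Cmd.exec_real E (by decide), hs₁.guess]
  have hx₂ : (computeEstimate.exec E s₁).vec 0 = s.vec 0 :=
    (vec_congr (Cmd.exec_real E (by decide) _)).trans hx₁
  obtain ⟨hr₃, hx₃⟩ := exec_updateGuess E (computeEstimate.exec E s₁)
  rw [hr₂, h6] at hr₃ hx₃
  rw [hx₂] at hx₃
  have hr : (prepare.exec E (s.writeNat 0 0 (s.nat 0 0 + 1))).real 1 0 =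
      estimateRule m c (h ++ [a]) := by
    rw [estimateRule_append, nextGuess]
    exact hr₃
  have hb : (prepare.exec E (s.writeNat 0 0 (s.nat 0 0 + 1))).bought = s.bought := by
    rw [hexec, Cmd.exec_bought E hbuy, hb₁]
  have hrep : (prepare.exec E (s.writeNat 0 0 (s.nat 0 0 + 1))).Represents (h ++ [a])
      (estimateRule m c (h ++ [a])) := by
    refine ⟨hs₁.stores.congr
      (Cmd.exec_nat E (P := .seq computeEstimate updateGuess) (by decide) s₁)
      (Cmd.exec_nat E (P := .seq computeEstimate updateGuess) (by decide) s₁), ?_, fun S => ?_, hr⟩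
    · exact (congrFun (Cmd.exec_nat E (P := .seq computeEstimate updateGuess) (by decide) s₁)
        0).trans hs₁.count
    · rw [hb, ← hb₁, hexec, Cmd.exec_nat E (by decide)]
      exact hs₁.flagged S
  have h4' : (prepare.exec E (s.writeNat 0 0 (s.nat 0 0 + 1))).nat 4 0 = h.length * m := by
    rw [hexec, Cmd.exec, Cmd.exec_nat E (P := updateGuess) (by decide), h4, List.length_append,
      List.length_singleton, Nat.add_mul, Nat.one_mul, Nat.add_sub_cancel]
  obtain ⟨h1, h2⟩ := erasedRun_seq_learnRound (E := E) hdet (hne a (by simp)) hrep h4' hx₃ hb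
  refine ⟨?_, h2⟩
  rw [h1, doublingStep]
  change step c _ ⟨_, _⟩ a = _
  -- The machine restarts exactly when the estimate exceeds the guess. This agrees with the
  -- algorithm: a replaced guess is strictly larger than the old one, and at the first arrival the
  -- old guess `0` lies below the positive estimate.
  have hiff : (h ≠ [] ∧ estimateRule m c (h ++ [a]) = estimateRule m c h) ↔
      ¬ estimateRule m c h < estimate c (h ++ [a]) := by
    have hpos := estimate_pos hc hne (by simp)
    rw [estimateRule_append, nextGuess]
    split_ifs with hlt
    · have := estimateRule_nonneg hc h fun b hb => hne b (by simp [hb])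
      simp only [hlt, not_true_eq_false, iff_false, not_and]
      intro _ heq
      linarith
    · simp only [hlt, not_false_eq_true, iff_true, and_true]
      rintro rfl
      rw [estimateRule_nil] at hlt
      exact hlt hpos
  by_cases hlt : estimateRule m c h < estimate c (h ++ [a])
  · rw [if_pos hlt, if_neg fun h' => hiff.1 h' hlt, estimateRule_append, nextGuess, if_pos hlt]
    rfl
  · rw [if_neg hlt, if_pos (hiff.2 hlt)]
    rfl

end Machine

/-! ### Polynomial time of both algorithms, and the theorem -/

open Machine in
lemma isPolyTime_learnOrCover : IsPolyTime learnOrCover := by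
  obtain ⟨d, hd⟩ := exists_steps_countingProgram_le (init := startGuess)
    (body := .seq storeRow learnRound)
    (by simp [startGuess, writeInitialWeights, accumulate, mapArray, forEach, Cmd.Tame,
      NatExpr.IsBound])
    (by simp [storeRow, learnRound, checkCovered, findCheapest, sample, updateVector, buyCheapest,
      scaleRow, sumRow, sumWeightedCosts, accumulate, mapArray, forEach, Cmd.Tame, NatExpr.IsBound])
  exact ⟨_, d, fun m c β rows _ _ hrows => ⟨map_bought_run_learnRound hrows, hd m c β rows⟩⟩

open Machine in
lemma isPolyTime_guessAndDouble_estimateRule :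
    IsPolyTime fun _ => guessAndDouble estimateRule := by
  obtain ⟨d, hd⟩ := exists_steps_countingProgram_le (init := .skip)
    (body := .seq prepare learnRound) trivial
    (by simp [prepare, storeRow, computeEstimate, estimateRound, scan, scanRow, sumAll, sumCosts,
      updateGuess, writeInitialWeights, learnRound, checkCovered, findCheapest, sample,
      updateVector, buyCheapest, scaleRow, sumRow, sumWeightedCosts, accumulate, mapArray, forEach,
      cell, Cmd.Tame, NatExpr.IsBound])
  exact ⟨_, d, fun m c β rows hc _ hrows => ⟨map_bought_run_prepare hc hrows, hd m c β rows⟩⟩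

theorem mainTheorem1 :
    -- LearnOrCover with a guess for the optimal value of the linear relaxation
    (IsPolyTime learnOrCover ∧
      (∀ β : ℝ, 0 < β → (learnOrCover β).AlwaysCovers) ∧
      ∃ K : ℝ, ∀ (m n : ℕ) (I : SetCoverInstance m n) (β : ℝ), 2 ≤ m * n →
        I.lpOpt ≤ β → β ≤ 2 * I.lpOpt →
          (learnOrCover β).expectedCost I ≤ K * (β * Real.log ((m : ℝ) * n))) ∧
    -- LearnOrCover with guess-and-double: no guess is given
    (∃ g : GuessRule, g.IsDoubling ∧
      IsPolyTime (fun _ => guessAndDouble g) ∧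
      (guessAndDouble g).AlwaysCovers ∧
      ∃ K : ℝ, ∀ (m n : ℕ) (I : SetCoverInstance m n), 2 ≤ m * n →
        (guessAndDouble g).expectedCost I ≤ K * Real.log ((m : ℝ) * n) * I.opt) := by
  refine ⟨⟨isPolyTime_learnOrCover, fun β _ => ?_, _, fun m n I β hmn hβ _ =>
    learnOrCover_expectedCost_le I hmn hβ⟩, estimateRule, estimateRule_isDoubling,
    isPolyTime_guessAndDouble_estimateRule, guessAndDouble_alwaysCovers _, _, fun m n I hmn =>
    expectedCost_estimateRule_le I hmn⟩
  rw [learnOrCover_eq]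
  exact guessAndDouble_alwaysCovers _
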